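/- Let $H$ be a separable complex Hilbert space; all operators are bounded operators on $H$. Definitions. An operator $N$ is *quasinilpotent* if $\sigma(N)\subseteq\{0\}$. A *spectral measure* $E$ assigns to Borel sets $\delta\subseteq\mathbb C$ bounded idempotents $E(\delta)$, not necessarily self-adjoint, with $E(\emptyset)=0$, $E(\mathbb C)=I$, $E(\delta\cap\varepsilon)=E(\delta)E(\varepsilon)$, countably additive in the strong operator topology. An operator $S$ is *of scalar type* if $S=\int_{\mathbb C}\lambda\,E(d\lambda)$ for some spectral measure $E$ such that, for every Borel set $\delta$, $E(\delta)S=SE(\delta)$ and $\sigma\big(S|_{E(\delta)H}\big)\subseteq\overline{\delta}$. A *maximal chain* is a family of orthogonal projections $E_t$ $(a\le t\le b$, $a<b$ real$)$ with ranges increasing in $t$, $E_a=0$, $E_b=I$, $\dim (E_{a+0}-E_a)H\le1$, $\dim(E_b-E_{b-0})H\le1$ and $\dim(E_{t+0}-E_{t-0})H\le 1$ for $a<t<b$ (one-sided limits in the strong operator topology). An operator $T$ is *$(S+V)$-triangular*, with representation $T=S+V$ and chain $(E_t)$, if $S$ is of scalar type, $V$ is compact and quasinilpotent, $T=S+V$,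 $(E_t)$ is a maximal chain with $$E_tS=SE_t,\qquad E_tVE_t=VE_t\qquad(a<t<b),$$ and (A) $(S-\lambda I)^{-1}V$ is quasinilpotent for every $\lambda\notin\sigma(S)$; (B) $(T-\lambda I)^{-1}V$ is quasinilpotent for every $\lambda\notin\sigma(T)$. For an operator $A$ and a function $f$ analytic in a neighbourhood of $\sigma(A)$, the operator $f(A)$ is $\frac1{2\pi i}\int_C f(\lambda)(\lambda I-A)^{-1}d\lambda$, where $C$ is any admissible contour: a finite system of closed piecewise $C^1$ curves lying outside $\sigma(A)$ in the open set where $f$ is analytic, with winding number $1$ about every point of $\sigma(A)$ and $0$ about every point where $f$ is not analytic. (That such contours exist and give the same operator is part of the claim.) **Proposition.** Let $T$ be $(S+V)$-triangular with representation $T=S+V$ and chain $(E_t)$, and let $f$ be analytic in a neighbourhood of $\sigma(T)$. Then $f(T)$ and $f(S)$ are defined, and $$f(T)=f(S)+V_f,$$ where $V_f$ is compact and quasinilpotent; the operator $f(T)$ is again $(S+V)$-triangular, with representation $f(T)=f(S)+V_f$ and the same chain $(E_t)$. Moreover $$\sigma(f(T))=\sigma(f(S))=f(\sigma(S))=f(\sigma(T)).$$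 -/

import Mathlib

open Filter Topology

noncomputable section

namespace TriangularOperators

/-! ### Contours and analytic functions of an operator -/

/-- A contour: finitely many oriented `C¹` arcs `γ j : [0,1] → ℂ` that fit together into finitely
many closed piecewise `C¹` curves; the arc `next j` begins where the arc `j` ends. -/
structure Contour where
  n : ℕ
  γ : Fin n → ℝ → ℂ
  contDiffOn : ∀ j, ContDiffOn ℝ 1 (γ j) (Set.Icc 0 1)
  next : Equiv.Perm (Fin n)
  joined : ∀ j, γ j 1 = γ (next j) 0

/-- The contour integral `∫_C F(z) dz` of a vector valued function. -/
def Contour.integral {X : Type*} [NormedAddCommGroup X] [NormedSpace ℂ X]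
    (C : Contour) (F : ℂ → X) : X :=
  ∑ j, ∫ t in (0 : ℝ)..1, derivWithin (C.γ j) (Set.Icc 0 1) t • F (C.γ j t)

/-- The trace of a contour. -/
def Contour.trace (C : Contour) : Set ℂ :=
  ⋃ j, C.γ j '' Set.Icc 0 1

/-- The winding number of a contour about a point off its trace. -/
def Contour.windingNumber (C : Contour) (w : ℂ) : ℂ :=
  (2 * Real.pi * Complex.I)⁻¹ * C.integral fun z => (z - w)⁻¹

/-- `C` is an admissible contour for the function `f` and the compact set `K`: it runs in the open
set where `f` is analytic, off `K`, winds exactly once (positively) around every point of `K`, and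
does not wind around any point at which `f` is not analytic. -/
structure Contour.IsAdmissible (C : Contour) (f : ℂ → ℂ) (K : Set ℂ) : Prop where
  analyticAt : ∀ z ∈ C.trace, AnalyticAt ℂ f z
  avoids : ∀ z ∈ C.trace, z ∉ K
  winding_one : ∀ w ∈ K, C.windingNumber w = 1
  winding_zero : ∀ w, ¬ AnalyticAt ℂ f w → C.windingNumber w = 0

variable {H : Type*} [NormedAddCommGroup H] [InnerProductSpace ℂ H]

/-- `(2πi)⁻¹ ∫_C f(z) (zI - T)⁻¹ dz`. -/
def cauchyIntegral (C : Contour) (f : ℂ → ℂ) (T : H →L[ℂ] H) : H →L[ℂ] H :=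
  (2 * Real.pi * Complex.I)⁻¹ • C.integral fun z => f z • resolvent T z

/-- `A = f(T)` in the Riesz–Dunford calculus: admissible contours exist, and
`A = (2πi)⁻¹ ∫_C f(z) (zI - T)⁻¹ dz` for every one of them. -/
def IsAnalyticFunctionOf (f : ℂ → ℂ) (T A : H →L[ℂ] H) : Prop :=
  (∃ C : Contour, C.IsAdmissible f (spectrum ℂ T)) ∧
    ∀ C : Contour, C.IsAdmissible f (spectrum ℂ T) → A = cauchyIntegral C f T

/-! ### Quasinilpotent operators and operators of scalar type -/

/-- The spectrum is concentrated at zero. -/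
def IsQuasinilpotent (N : H →L[ℂ] H) : Prop :=
  spectrum ℂ N ⊆ {0}

variable (H) in
/-- A spectral measure on the Borel sets of `ℂ` in the sense of Dunford: its values are bounded,
not necessarily self-adjoint, idempotents (by `inter`), and it is countably additive in the strong
operator topology. Only the values on Borel sets matter. -/
structure SpectralMeasure where
  E : Set ℂ → H →L[ℂ] H
  empty : E ∅ = 0
  univ : E Set.univ = 1
  inter : ∀ δ ε, MeasurableSet δ → MeasurableSet ε → E (δ ∩ ε) = E δ * E ε
  hasSum : ∀ δ : ℕ → Set ℂ, (∀ n, MeasurableSet (δ n)) → Pairwise (Function.onFun Disjoint δ) →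
    ∀ x : H, HasSum (fun n => E (δ n) x) (E (⋃ n, δ n) x)

/-- The range of an operator commuting with `S` is invariant under `S`. -/
theorem mem_range_of_comm {P S : H →L[ℂ] H} (h : P * S = S * P) :
    ∀ x ∈ P.range, S x ∈ P.range := by
  rintro _ ⟨y, rfl⟩
  exact ⟨S y, DFunLike.congr_fun h y⟩

/-- The restriction of `S` to the subspace `P H`, where `P` commutes with `S`. -/
def restrictToRange (P S : H →L[ℂ] H) (h : P * S = S * P) : P.range →L[ℂ] P.range :=
  S.restrict (mem_range_of_comm h)

/-- `E` is a resolution of the identity for `S`: every `E(δ)`, `δ` Borel, commutes with `S`, and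
the restriction of `S` to `E(δ)H` has its spectrum in the closure of `δ`. -/
def SpectralMeasure.IsResolutionOfIdentity (E : SpectralMeasure H) (S : H →L[ℂ] H) : Prop :=
  ∀ δ, MeasurableSet δ → ∃ h : E.E δ * S = S * E.E δ,
    spectrum ℂ (restrictToRange (E.E δ) S h) ⊆ closure δ

/-- `∫ φ(z) E(dz)` for a simple function `φ`. -/
def SpectralMeasure.simpleIntegral (E : SpectralMeasure H)
    (φ : MeasureTheory.SimpleFunc ℂ ℂ) : H →L[ℂ] H :=
  ∑ z ∈ φ.range, z • E.E (φ ⁻¹' {z})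

/-- `S = ∫ z E(dz)`: there are simple functions converging to the identity function uniformly up to
`E`-null sets whose integrals converge to `S` in norm. -/
def SpectralMeasure.HasIntegral (E : SpectralMeasure H) (S : H →L[ℂ] H) : Prop :=
  ∃ φ : ℕ → MeasureTheory.SimpleFunc ℂ ℂ,
    (∀ ε : ℝ, 0 < ε → ∀ᶠ n in atTop, E.E {z | ε ≤ ‖φ n z - z‖} = 0) ∧
      Tendsto (fun n => E.simpleIntegral (φ n)) atTop (𝓝 S)

/-- A bounded operator of scalar type: `S = ∫ z E(dz)`, `E` a resolution of the identity for `S`. -/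
def IsScalarType (S : H →L[ℂ] H) : Prop :=
  ∃ E : SpectralMeasure H, E.IsResolutionOfIdentity S ∧ E.HasIntegral S

/-! ### Maximal chains and triangular operators -/

/-- `Q` is the limit of `P s` along `l` in the strong operator topology. -/
def HasStrongLimit (P : ℝ → H →L[ℂ] H) (l : Filter ℝ) (Q : H →L[ℂ] H) : Prop :=
  ∀ x, Tendsto (fun s => P s x) l (𝓝 (Q x))

/-- The range of `A` has dimension at most one. -/
def RankLEOne (A : H →L[ℂ] H) : Prop :=
  Module.rank ℂ A.range ≤ 1

/-- `P t`, `a ≤ t ≤ b`, is a maximal chain of orthogonal projections: the `P t` are orthogonal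
projections whose ranges increase from `0` to `H`, and the jumps `P (t+0) - P (t-0)`,
`P (a+0) - P a`, `P b - P (b-0)` have dimension at most one. -/
structure IsMaximalChain [CompleteSpace H] (a b : ℝ) (P : ℝ → H →L[ℂ] H) : Prop where
  lt : a < b
  isStarProjection : ∀ t ∈ Set.Icc a b, IsStarProjection (P t)
  mono : ∀ s ∈ Set.Icc a b, ∀ t ∈ Set.Icc a b, s ≤ t → (P s).range ≤ (P t).range
  left : P a = 0
  right : P b = 1
  jump_left : ∃ Q, HasStrongLimit P (𝓝[>] a) Q ∧ RankLEOne (Q - P a)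
  jump_right : ∃ Q, HasStrongLimit P (𝓝[<] b) Q ∧ RankLEOne (P b - Q)
  jump : ∀ t ∈ Set.Ioo a b, ∃ Q R, HasStrongLimit P (𝓝[>] t) Q ∧ HasStrongLimit P (𝓝[<] t) R ∧
    RankLEOne (Q - R)

/-- `T = S + N` is an `(S+N)`-triangular representation of `T` with respect to the maximal chain
`P t`, `a ≤ t ≤ b`. The last two fields are the conditions (A) and (B) on `N`. -/
structure IsSNTriangularWith [CompleteSpace H] (a b : ℝ) (P : ℝ → H →L[ℂ] H)
    (S N T : H →L[ℂ] H) : Prop where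
  chain : IsMaximalChain a b P
  scalarType : IsScalarType S
  quasinilpotent : IsQuasinilpotent N
  eq_add : T = S + N
  comm : ∀ t ∈ Set.Ioo a b, P t * S = S * P t
  triangular : ∀ t ∈ Set.Ioo a b, P t * N * P t = N * P t
  condA : ∀ z ∈ resolventSet ℂ S,
    IsQuasinilpotent (Ring.inverse (S - z • (1 : H →L[ℂ] H)) * N)
  condB : ∀ z ∈ resolventSet ℂ T,
    IsQuasinilpotent (Ring.inverse (T - z • (1 : H →L[ℂ] H)) * N)

/-- `T = S + V` is an `(S+V)`-triangular representation of `T`: an `(S+N)`-triangular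
representation with compact quasinilpotent part. -/
structure IsSVTriangularWith [CompleteSpace H] (a b : ℝ) (P : ℝ → H →L[ℂ] H)
    (S V T : H →L[ℂ] H) : Prop extends IsSNTriangularWith a b P S V T where
  compact : IsCompactOperator V

/-- `T` is `(S+V)`-triangular. -/
def IsSVTriangular [CompleteSpace H] (T : H →L[ℂ] H) : Prop :=
  ∃ (a b : ℝ) (P : ℝ → H →L[ℂ] H) (S V : H →L[ℂ] H), IsSVTriangularWith a b P S V T

end TriangularOperators

end

/-!
Write `R(z, A) = (z - A)⁻¹`. The conditions (A) and (B) give `σ(T) = σ(S)`, because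
`z - T = (z - S)(1 + (S - z)⁻¹ V)` and likewise with `S` and `T` interchanged
(`IsSNTriangularWith.spectrum_eq`). Hence one contour `C`, the boundary of a union of squares of a
grid (`exists_contour_around`), serves for `f(T)` and `f(S)`; that other admissible contours yield
the same operators is the homology form of Cauchy's theorem
(`Contour.integral_eq_of_windingNumber_eq`). By the second resolvent identity,
`f(T) - f(S) = (2πi)⁻¹ ∫_C f(z) R(z, T) V R(z, S) dz`.

*The nilpotent part.* The operators that leave all `P t` invariant form a closed algebra `𝒜`. It
contains `V`, the resolvents of `S`, and therefore those of `T` as well: the complement of the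
spectrum of a quasinilpotent element is connected, so that its resolvents remain in `𝒜`
(`IsQuasinilpotent.exists_inverse_mem`, `resolvent_add_mem`). For every `t` let `Δ t` be the jump of
the chain at `t`. The compression `A ↦ Δ t A Δ t` is multiplicative on `𝒜`, and has scalar values
because the jump has dimension at most one. Everything rests on the fact that a compact operator
`K` in `𝒜` is quasinilpotent if and only if `Δ t K Δ t = 0` for all `t`
(`IsChainWithJumps.jump_mul_jump_eq_zero`, `IsChainWithJumps.isQuasinilpotent`). For the essential
direction, the compressions of `K` to short intervals of the chain have small norm, as compactness
turns strong convergence into norm convergence; so the invertibility of `z - K P t`, which is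
trivial at `t = a`, can be continued along the chain up to `t = b`. Consequently the compact
quasinilpotent operators in `𝒜` form a closed two-sided ideal of `𝒜`. This ideal contains the
integrand above, hence `f(T) - f(S)`, hence also the products of `f(T) - f(S)` with the resolvents
of `f(S)` and `f(T)`, which gives (A) and (B) for the new representation.

*The scalar part.* A spectral measure is bounded, by the principle of uniform boundedness
(`SpectralMeasure.exists_norm_simpleIntegral_le`). Approximation by simple functions shows that
`f(S) = ∫ f dE`, and that `δ ↦ E(f⁻¹(δ))` is a resolution of the identity for `f(S)`, with
`σ(f(S)) ⊆ f(σ(S))` (`IsScalarType.cauchyIntegral`). The converse inclusion is the elementary half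
of the spectral mapping theorem (`mem_spectrum_cauchyIntegral`).
-/

noncomputable section

namespace TriangularOperators

/-! ### Integration along contours -/

namespace Contour

variable {X : Type*} [NormedAddCommGroup X] [NormedSpace ℂ X] (C : Contour)

theorem isCompact_trace : IsCompact C.trace :=
  isCompact_iUnion fun j => isCompact_Icc.image_of_continuousOn (C.contDiffOn j).continuousOn

theorem mem_trace (j : Fin C.n) {t : ℝ} (ht : t ∈ Set.Icc (0 : ℝ) 1) : C.γ j t ∈ C.trace :=
  Set.mem_iUnion.2 ⟨j, t, ht, rfl⟩

theorem continuousOn_derivWithin (j : Fin C.n) :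
    ContinuousOn (derivWithin (C.γ j) (Set.Icc 0 1)) (Set.Icc (0 : ℝ) 1) :=
  (C.contDiffOn j).continuousOn_derivWithin (uniqueDiffOn_Icc zero_lt_one) le_rfl

theorem continuousOn_integrand {F : ℂ → X} (hF : ContinuousOn F C.trace) (j : Fin C.n) :
    ContinuousOn (fun t => derivWithin (C.γ j) (Set.Icc 0 1) t • F (C.γ j t))
      (Set.Icc (0 : ℝ) 1) :=
  (C.continuousOn_derivWithin j).smul
    (hF.comp (C.contDiffOn j).continuousOn fun _ ht => C.mem_trace j ht)

theorem intervalIntegrable {F : ℂ → X} (hF : ContinuousOn F C.trace) (j : Fin C.n) :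
    IntervalIntegrable (fun t => derivWithin (C.γ j) (Set.Icc 0 1) t • F (C.γ j t))
      MeasureTheory.volume 0 1 :=
  (C.continuousOn_integrand hF j).intervalIntegrable_of_Icc zero_le_one

theorem integral_congr {F G : ℂ → X} (h : ∀ z ∈ C.trace, F z = G z) :
    C.integral F = C.integral G := by
  refine Finset.sum_congr rfl fun j _ => intervalIntegral.integral_congr fun t ht => ?_
  rw [Set.uIcc_of_le zero_le_one] at ht
  simp only [h _ (C.mem_trace j ht)]

theorem integral_add {F G : ℂ → X} (hF : ContinuousOn F C.trace) (hG : ContinuousOn G C.trace) :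
    C.integral (fun z => F z + G z) = C.integral F + C.integral G := by
  simp only [Contour.integral, smul_add, ← Finset.sum_add_distrib]
  exact Finset.sum_congr rfl fun j _ =>
    intervalIntegral.integral_add (C.intervalIntegrable hF j) (C.intervalIntegrable hG j)

theorem integral_sub {F G : ℂ → X} (hF : ContinuousOn F C.trace) (hG : ContinuousOn G C.trace) :
    C.integral (fun z => F z - G z) = C.integral F - C.integral G := by
  simp only [Contour.integral, smul_sub, ← Finset.sum_sub_distrib]
  exact Finset.sum_congr rfl fun j _ =>
    intervalIntegral.integral_sub (C.intervalIntegrable hF j) (C.intervalIntegrable hG j)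

theorem integral_const_smul (c : ℂ) (F : ℂ → X) :
    C.integral (fun z => c • F z) = c • C.integral F := by
  simp only [Contour.integral, Finset.smul_sum, ← intervalIntegral.integral_smul]
  simp only [smul_comm c]

theorem integral_neg (F : ℂ → X) : C.integral (fun z => -F z) = -C.integral F := by
  simpa using C.integral_const_smul (-1) F

theorem integral_finset_sum {ι : Type*} (s : Finset ι) {F : ι → ℂ → X}
    (hF : ∀ i ∈ s, ContinuousOn (F i) C.trace) :
    C.integral (fun z => ∑ i ∈ s, F i z) = ∑ i ∈ s, C.integral (F i) := by
  simp only [Contour.integral, Finset.smul_sum]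
  rw [Finset.sum_comm]
  exact Finset.sum_congr rfl fun j _ =>
    intervalIntegral.integral_finsetSum fun i hi => C.intervalIntegrable (hF i hi) j

theorem integral_clm [CompleteSpace X] {Y : Type*} [NormedAddCommGroup Y] [NormedSpace ℂ Y]
    [CompleteSpace Y] (L : X →L[ℂ] Y) {F : ℂ → X} (hF : ContinuousOn F C.trace) :
    C.integral (fun z => L (F z)) = L (C.integral F) := by
  simp only [Contour.integral, map_sum]
  refine Finset.sum_congr rfl fun j _ => ?_
  rw [← ContinuousLinearMap.intervalIntegral_comp_comm L (C.intervalIntegrable hF j)]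
  simp only [map_smul]

theorem integral_smul_const [CompleteSpace X] (g : ℂ → ℂ) (x : X) :
    C.integral (fun z => g z • x) = C.integral g • x := by
  simp only [Contour.integral, Finset.sum_smul, ← intervalIntegral.integral_smul_const, smul_assoc]

/-- A closed subspace that contains the values of the integrand contains the integral. -/
theorem integral_mem [CompleteSpace X] (M : Submodule ℂ X) (hM : IsClosed (M : Set X)) {F : ℂ → X}
    (hF : ContinuousOn F C.trace) (h : ∀ z ∈ C.trace, F z ∈ M) : C.integral F ∈ M := by
  refine M.sum_mem fun j _ => ?_
  rw [intervalIntegral.integral_of_le zero_le_one]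
  have : MeasureTheory.IsProbabilityMeasure
      (MeasureTheory.volume.restrict (Set.Ioc (0 : ℝ) 1)) := ⟨by simp⟩
  refine Convex.integral_mem (s := (M : Set X)) (M.restrictScalars ℝ).convex hM ?_
    (C.intervalIntegrable hF j).1
  refine (MeasureTheory.ae_restrict_iff' measurableSet_Ioc).2 (.of_forall fun t ht => ?_)
  exact M.smul_mem _ (h _ (C.mem_trace j (Set.Ioc_subset_Icc_self ht)))

/-- The standard estimate, with one bound for the length of the contour that serves integrands
with values in all normed spaces. -/
theorem exists_norm_integral_le :
    ∃ L : ℝ, 0 ≤ L ∧ ∀ {Y : Type*} [NormedAddCommGroup Y] [NormedSpace ℂ Y] (F : ℂ → Y) (c : ℝ),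
      (∀ z ∈ C.trace, ‖F z‖ ≤ c) → ‖C.integral F‖ ≤ L * c := by
  have hb : ∀ j, ∃ B : ℝ, ∀ t ∈ Set.Icc (0 : ℝ) 1,
      ‖derivWithin (C.γ j) (Set.Icc 0 1) t‖ ≤ B := fun j =>
    isCompact_Icc.exists_bound_of_continuousOn (C.continuousOn_derivWithin j)
  choose B hB using hb
  have hB0 : ∀ j, 0 ≤ B j := fun j => (norm_nonneg _).trans (hB j 0 (by simp))
  refine ⟨∑ j, B j, Finset.sum_nonneg fun j _ => hB0 j, fun {Y} _ _ F c hF => ?_⟩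
  rw [Finset.sum_mul]
  refine norm_sum_le_of_le _ fun j _ => ?_
  have := intervalIntegral.norm_integral_le_of_norm_le_const (a := 0) (b := 1) (C := B j * c)
    (f := fun t => derivWithin (C.γ j) (Set.Icc 0 1) t • F (C.γ j t)) fun t ht => by
      rw [Set.uIoc_of_le zero_le_one] at ht
      have ht' := Set.Ioc_subset_Icc_self ht
      rw [norm_smul]
      exact mul_le_mul (hB j t ht') (hF _ (C.mem_trace j ht')) (norm_nonneg _) (hB0 j)
  simpa using this

/-- The integral of a derivative along a (closed) contour vanishes. -/
theorem integral_eq_zero_of_hasDerivAt [CompleteSpace X] {F G : ℂ → X}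
    (hF : ContinuousOn F C.trace) (hG : ∀ z ∈ C.trace, HasDerivAt G (F z) z) :
    C.integral F = 0 := by
  have h1 : ∀ j, ∫ t in (0 : ℝ)..1, derivWithin (C.γ j) (Set.Icc 0 1) t • F (C.γ j t) =
      G (C.γ j 1) - G (C.γ j 0) := by
    intro j
    refine intervalIntegral.integral_eq_sub_of_hasDerivAt_of_le (f := fun t => G (C.γ j t))
      zero_le_one ?_ (fun t ht => ?_) (C.intervalIntegrable hF j)
    · exact fun t ht => ((hG _ (C.mem_trace j ht)).continuousAt.comp_continuousWithinAt
        ((C.contDiffOn j).continuousOn t ht))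
    · have hn : Set.Icc (0 : ℝ) 1 ∈ 𝓝 t := Icc_mem_nhds ht.1 ht.2
      have hd : HasDerivAt (C.γ j) (derivWithin (C.γ j) (Set.Icc 0 1) t) t :=
        (((C.contDiffOn j).differentiableOn one_ne_zero t
          (Set.Ioo_subset_Icc_self ht)).hasDerivWithinAt).hasDerivAt hn
      exact (hG _ (C.mem_trace j (Set.Ioo_subset_Icc_self ht))).scomp t hd
  simp only [Contour.integral, h1, Finset.sum_sub_distrib]
  rw [← Equiv.sum_comp C.next fun j => G (C.γ j 0), sub_eq_zero]
  exact Finset.sum_congr rfl fun j _ => by rw [C.joined]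

/-- Fubini's theorem for a continuous function on the product of two contours. -/
theorem integral_integral_swap [CompleteSpace X] (D : Contour) {G : ℂ → ℂ → X}
    (hG : ContinuousOn (fun p : ℂ × ℂ => G p.1 p.2) (C.trace ×ˢ D.trace)) :
    C.integral (fun z => D.integral fun w => G z w) =
      D.integral fun w => C.integral fun z => G z w := by
  have hc : ∀ j k, ContinuousOn (fun p : ℝ × ℝ => derivWithin (C.γ j) (Set.Icc 0 1) p.1 •
      derivWithin (D.γ k) (Set.Icc 0 1) p.2 • G (C.γ j p.1) (D.γ k p.2))
      (Set.Icc (0 : ℝ) 1 ×ˢ Set.Icc (0 : ℝ) 1) := by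
    intro j k
    refine ((C.continuousOn_derivWithin j).comp continuousOn_fst fun p hp => hp.1).smul
      (((D.continuousOn_derivWithin k).comp continuousOn_snd fun p hp => hp.2).smul ?_)
    refine hG.comp (f := fun p : ℝ × ℝ => (C.γ j p.1, D.γ k p.2)) ?_
      fun p hp => ⟨C.mem_trace j hp.1, D.mem_trace k hp.2⟩
    exact ((C.contDiffOn j).continuousOn.comp continuousOn_fst fun p hp => hp.1).prodMk
      ((D.contDiffOn k).continuousOn.comp continuousOn_snd fun p hp => hp.2)
  have hs : ∀ j k, (∫ s in (0 : ℝ)..1, ∫ t in (0 : ℝ)..1, derivWithin (C.γ j) (Set.Icc 0 1) s •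
      derivWithin (D.γ k) (Set.Icc 0 1) t • G (C.γ j s) (D.γ k t)) =
      ∫ t in (0 : ℝ)..1, ∫ s in (0 : ℝ)..1, derivWithin (C.γ j) (Set.Icc 0 1) s •
      derivWithin (D.γ k) (Set.Icc 0 1) t • G (C.γ j s) (D.γ k t) := by
    intro j k
    simp only [intervalIntegral.integral_of_le zero_le_one]
    refine MeasureTheory.integral_integral_swap ?_
    rw [MeasureTheory.Measure.prod_restrict]
    exact ((hc j k).integrableOn_compact (isCompact_Icc.prod isCompact_Icc)).mono_set
      (Set.prod_mono Set.Ioc_subset_Icc_self Set.Ioc_subset_Icc_self)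
  have hi1 : ∀ j k, IntervalIntegrable (fun s => ∫ t in (0 : ℝ)..1,
      derivWithin (C.γ j) (Set.Icc 0 1) s •
      derivWithin (D.γ k) (Set.Icc 0 1) t • G (C.γ j s) (D.γ k t)) MeasureTheory.volume 0 1 := by
    intro j k
    rw [intervalIntegrable_iff_integrableOn_Ioc_of_le zero_le_one]
    simp only [intervalIntegral.integral_of_le zero_le_one]
    refine MeasureTheory.Integrable.integral_prod_left (f := fun p : ℝ × ℝ =>
      derivWithin (C.γ j) (Set.Icc 0 1) p.1 •
      derivWithin (D.γ k) (Set.Icc 0 1) p.2 • G (C.γ j p.1) (D.γ k p.2)) ?_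
    rw [MeasureTheory.Measure.prod_restrict]
    exact ((hc j k).integrableOn_compact (isCompact_Icc.prod isCompact_Icc)).mono_set
      (Set.prod_mono Set.Ioc_subset_Icc_self Set.Ioc_subset_Icc_self)
  have hi2 : ∀ j k, IntervalIntegrable (fun t => ∫ s in (0 : ℝ)..1,
      derivWithin (C.γ j) (Set.Icc 0 1) s •
      derivWithin (D.γ k) (Set.Icc 0 1) t • G (C.γ j s) (D.γ k t)) MeasureTheory.volume 0 1 := by
    intro j k
    rw [intervalIntegrable_iff_integrableOn_Ioc_of_le zero_le_one]
    simp only [intervalIntegral.integral_of_le zero_le_one]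
    refine MeasureTheory.Integrable.integral_prod_right (f := fun p : ℝ × ℝ =>
      derivWithin (C.γ j) (Set.Icc 0 1) p.1 •
      derivWithin (D.γ k) (Set.Icc 0 1) p.2 • G (C.γ j p.1) (D.γ k p.2)) ?_
    rw [MeasureTheory.Measure.prod_restrict]
    exact ((hc j k).integrableOn_compact (isCompact_Icc.prod isCompact_Icc)).mono_set
      (Set.prod_mono Set.Ioc_subset_Icc_self Set.Ioc_subset_Icc_self)
  have h1 : C.integral (fun z => D.integral fun w => G z w) = ∑ j, ∑ k,
      ∫ s in (0 : ℝ)..1, ∫ t in (0 : ℝ)..1, derivWithin (C.γ j) (Set.Icc 0 1) s •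
      derivWithin (D.γ k) (Set.Icc 0 1) t • G (C.γ j s) (D.γ k t) := by
    refine Finset.sum_congr rfl fun j _ => ?_
    rw [← intervalIntegral.integral_finsetSum fun k _ => hi1 j k]
    simp only [Contour.integral, Finset.smul_sum, intervalIntegral.integral_smul]
  have h2 : D.integral (fun w => C.integral fun z => G z w) = ∑ k, ∑ j,
      ∫ t in (0 : ℝ)..1, ∫ s in (0 : ℝ)..1, derivWithin (C.γ j) (Set.Icc 0 1) s •
      derivWithin (D.γ k) (Set.Icc 0 1) t • G (C.γ j s) (D.γ k t) := by
    refine Finset.sum_congr rfl fun k _ => ?_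
    rw [← intervalIntegral.integral_finsetSum fun j _ => hi2 j k]
    simp only [Contour.integral, Finset.smul_sum]
    refine intervalIntegral.integral_congr fun t _ => ?_
    refine Finset.sum_congr rfl fun j _ => ?_
    simp only [← intervalIntegral.integral_smul]
    refine intervalIntegral.integral_congr fun s _ => ?_
    exact smul_comm _ _ _
  rw [h1, h2, Finset.sum_comm]
  exact Finset.sum_congr rfl fun k _ => Finset.sum_congr rfl fun j _ => hs j k

/-! ### Winding numbers -/

theorem integral_inv_sub {w : ℂ} :
    C.integral (fun z => (z - w)⁻¹) = 2 * Real.pi * Complex.I * C.windingNumber w := by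
  rw [Contour.windingNumber, mul_inv_cancel_left₀ Complex.two_pi_I_ne_zero]

theorem continuousOn_inv_sub {w : ℂ} (hw : w ∉ C.trace) :
    ContinuousOn (fun z : ℂ => (z - w)⁻¹) C.trace :=
  (continuousOn_id.sub continuousOn_const).inv₀ fun z hz h => hw (by
    have h' : z = w := sub_eq_zero.1 h
    exact h' ▸ hz)

/-- The winding number is constant on a disc that does not meet the contour: the quotient
`(z - w) / (z - w₀)` stays in the right half plane, where the logarithm is holomorphic. -/
theorem windingNumber_eq_of_dist_lt {w w₀ : ℂ} (h : ∀ z ∈ C.trace, ‖w - w₀‖ < ‖z - w₀‖) :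
    C.windingNumber w = C.windingNumber w₀ := by
  have hw₀ : ∀ z ∈ C.trace, z - w₀ ≠ 0 := fun z hz h0 => by
    have := h z hz; rw [h0, norm_zero] at this; exact absurd this (norm_nonneg _).not_gt
  have hw : ∀ z ∈ C.trace, z - w ≠ 0 := fun z hz h0 => by
    rw [sub_eq_zero] at h0; exact (h z hz).ne (by rw [h0])
  have hc := C.continuousOn_inv_sub (w := w) fun hm => hw _ hm (sub_self _)
  have hc₀ := C.continuousOn_inv_sub (w := w₀) fun hm => hw₀ _ hm (sub_self _)
  have key : C.integral (fun z => (z - w)⁻¹ - (z - w₀)⁻¹) = 0 := by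
    refine C.integral_eq_zero_of_hasDerivAt (G := fun z => Complex.log ((z - w) / (z - w₀)))
      (hc.sub hc₀) fun z hz => ?_
    have hs : (z - w) / (z - w₀) ∈ Complex.slitPlane := by
      have h1 : ‖(w₀ - w) / (z - w₀)‖ < 1 := by
        rw [norm_div, div_lt_one (norm_pos_iff.2 (hw₀ z hz)), norm_sub_rev]
        exact h z hz
      convert Complex.mem_slitPlane_of_norm_lt_one h1 using 1
      have := hw₀ z hz
      field_simp
      ring
    have e : (z - w)⁻¹ - (z - w₀)⁻¹ =
        (1 * (z - w₀) - (z - w) * 1) / (z - w₀) ^ 2 / ((z - w) / (z - w₀)) := by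
      have := hw₀ z hz
      have := hw z hz
      field_simp
    rw [e]
    exact (((hasDerivAt_id z).sub_const w).div ((hasDerivAt_id z).sub_const w₀)
      (hw₀ z hz)).clog hs
  rw [C.integral_sub hc hc₀, sub_eq_zero] at key
  rw [Contour.windingNumber, key, Contour.windingNumber]

theorem windingNumber_eventually_eq {w₀ : ℂ} (h : w₀ ∉ C.trace) :
    ∀ᶠ w in 𝓝 w₀, C.windingNumber w = C.windingNumber w₀ := by
  obtain ⟨r, hr, hd⟩ := Metric.isOpen_iff.1 C.isCompact_trace.isClosed.isOpen_compl w₀ h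
  filter_upwards [Metric.ball_mem_nhds w₀ hr] with w hw
  refine C.windingNumber_eq_of_dist_lt fun z hz => ?_
  have h1 : z ∉ Metric.ball w₀ r := fun hz' => hd hz' hz
  rw [Metric.mem_ball, dist_eq_norm] at hw h1
  linarith

/-- Winding numbers vanish far away, where `(z - w) / (-w)` stays in the right half plane. -/
theorem exists_windingNumber_eq_zero :
    ∃ R : ℝ, ∀ w : ℂ, R < ‖w‖ → C.windingNumber w = 0 := by
  obtain ⟨R, hR⟩ := C.isCompact_trace.isBounded.exists_norm_le
  refine ⟨R, fun w hw => ?_⟩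
  have hlt : ∀ z ∈ C.trace, ‖z‖ < ‖w‖ := fun z hz => (hR z hz).trans_lt hw
  have hne : ∀ z ∈ C.trace, z - w ≠ 0 := fun z hz h0 => by
    rw [sub_eq_zero] at h0; exact (hlt z hz).ne (by rw [h0])
  have key : C.integral (fun z => (z - w)⁻¹) = 0 := by
    refine C.integral_eq_zero_of_hasDerivAt (G := fun z => Complex.log ((z - w) / (-w)))
      (C.continuousOn_inv_sub fun hm => hne _ hm (sub_self _)) fun z hz => ?_
    have hw0 : w ≠ 0 := by
      rintro rfl
      exact absurd (hlt z hz) (by simp)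
    have hs : (z - w) / (-w) ∈ Complex.slitPlane := by
      have h1 : ‖-z / w‖ < 1 := by
        rw [norm_div, norm_neg, div_lt_one (norm_pos_iff.2 hw0)]
        exact hlt z hz
      convert Complex.mem_slitPlane_of_norm_lt_one h1 using 1
      field_simp
      ring
    have e : (z - w)⁻¹ = 1 / -w / ((z - w) / -w) := by
      have := hne z hz
      field_simp
    rw [e]
    exact (((hasDerivAt_id z).sub_const w).div_const (-w)).clog hs
  rw [Contour.windingNumber, key, mul_zero]

end Contour

/-! ### Integrals along segments and rectangles -/

/-- The integral of `F` along the segment from `a` to `b`. -/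
def segmentIntegral {X : Type*} [NormedAddCommGroup X] [NormedSpace ℂ X] (F : ℂ → X) (a b : ℂ) :
    X :=
  ∫ t in (0 : ℝ)..1, (b - a) • F (a + t * (b - a))

section Segment

variable {X : Type*} [NormedAddCommGroup X] [NormedSpace ℂ X]

theorem segmentIntegral_symm (F : ℂ → X) (a b : ℂ) :
    segmentIntegral F b a = -segmentIntegral F a b := by
  have h := intervalIntegral.integral_comp_sub_left (a := 0) (b := 1)
    (fun t : ℝ => (b - a) • F (a + t * (b - a))) 1
  simp only [sub_self, sub_zero] at h
  rw [segmentIntegral, segmentIntegral, ← h, ← intervalIntegral.integral_neg]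
  refine intervalIntegral.integral_congr fun t _ => ?_
  simp only [← neg_smul, neg_sub]
  congr 2
  push_cast
  ring

theorem segmentIntegral_eq_sub [CompleteSpace X] {F G : ℂ → X} {a b : ℂ}
    (hF : ContinuousOn F ((fun t : ℝ => a + t * (b - a)) '' Set.Icc 0 1))
    (hG : ∀ t ∈ Set.Icc (0 : ℝ) 1, HasDerivAt G (F (a + t * (b - a))) (a + t * (b - a))) :
    segmentIntegral F a b = G b - G a := by
  have hc : Continuous fun t : ℝ => a + t * (b - a) := by fun_prop
  have hd : ∀ t : ℝ, HasDerivAt (fun t : ℝ => a + t * (b - a)) (b - a) t := fun t => by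
    simpa using ((Complex.ofRealCLM.hasDerivAt (x := t)).mul_const (b - a)).const_add a
  have := intervalIntegral.integral_eq_sub_of_hasDerivAt (a := 0) (b := 1)
    (f := fun t : ℝ => G (a + t * (b - a))) (f' := fun t => (b - a) • F (a + t * (b - a)))
    (fun t ht => (hG t (by rwa [Set.uIcc_of_le zero_le_one] at ht)).scomp t (hd t)) ?_
  · rw [segmentIntegral, this]
    simp
  · refine ContinuousOn.intervalIntegrable_of_Icc zero_le_one (continuousOn_const.smul ?_)
    exact hF.comp hc.continuousOn fun t ht => ⟨t, ht, rfl⟩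

theorem segmentIntegral_horizontal (F : ℂ → X) (x₀ x₁ y : ℝ) :
    segmentIntegral F ⟨x₀, y⟩ ⟨x₁, y⟩ = ∫ x in x₀..x₁, F (x + y * Complex.I) := by
  have h := intervalIntegral.smul_integral_comp_add_mul (a := 0) (b := 1)
    (fun x : ℝ => F (x + y * Complex.I)) (x₁ - x₀) x₀
  simp only [mul_zero, add_zero, mul_one, add_sub_cancel] at h
  rw [← h, segmentIntegral, ← intervalIntegral.integral_smul]
  refine intervalIntegral.integral_congr fun t _ => ?_
  have e : (⟨x₁, y⟩ - ⟨x₀, y⟩ : ℂ) = ((x₁ - x₀ : ℝ) : ℂ) := by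
    apply Complex.ext <;> simp
  simp only [e, Complex.coe_smul]
  congr 2
  apply Complex.ext <;> simp
  ring

theorem segmentIntegral_vertical (F : ℂ → X) (x y₀ y₁ : ℝ) :
    segmentIntegral F ⟨x, y₀⟩ ⟨x, y₁⟩ =
      Complex.I • ∫ y in y₀..y₁, F (x + y * Complex.I) := by
  have h := intervalIntegral.smul_integral_comp_add_mul (a := 0) (b := 1)
    (fun y : ℝ => F (x + y * Complex.I)) (y₁ - y₀) y₀
  simp only [mul_zero, add_zero, mul_one, add_sub_cancel] at h
  rw [← h, segmentIntegral, ← intervalIntegral.integral_smul, ← intervalIntegral.integral_smul]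
  refine intervalIntegral.integral_congr fun t _ => ?_
  have e : (⟨x, y₁⟩ - ⟨x, y₀⟩ : ℂ) = Complex.I * ((y₁ - y₀ : ℝ) : ℂ) := by
    apply Complex.ext <;> simp
  simp only [e, mul_smul, Complex.coe_smul]
  congr 3
  apply Complex.ext <;> simp
  ring

/-- The integral of `F` along the positively oriented boundary of the rectangle
`[x₀, x₁] × [y₀, y₁]`. -/
def rectIntegral (F : ℂ → X) (x₀ x₁ y₀ y₁ : ℝ) : X :=
  segmentIntegral F ⟨x₀, y₀⟩ ⟨x₁, y₀⟩ + segmentIntegral F ⟨x₁, y₀⟩ ⟨x₁, y₁⟩ +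
    segmentIntegral F ⟨x₁, y₁⟩ ⟨x₀, y₁⟩ + segmentIntegral F ⟨x₀, y₁⟩ ⟨x₀, y₀⟩

theorem rectIntegral_eq_zero [CompleteSpace X] {F : ℂ → X} {x₀ x₁ y₀ y₁ : ℝ} (hx : x₀ ≤ x₁)
    (hy : y₀ ≤ y₁) (hF : DifferentiableOn ℂ F (Set.Icc x₀ x₁ ×ℂ Set.Icc y₀ y₁)) :
    rectIntegral F x₀ x₁ y₀ y₁ = 0 := by
  have := Complex.integral_boundary_rect_eq_zero_of_differentiableOn F ⟨x₀, y₀⟩ ⟨x₁, y₁⟩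
    (by simpa only [Set.uIcc_of_le hx, Set.uIcc_of_le hy] using hF)
  rw [rectIntegral, segmentIntegral_symm F ⟨x₀, y₁⟩ ⟨x₁, y₁⟩, segmentIntegral_symm F ⟨x₀, y₀⟩,
    segmentIntegral_horizontal, segmentIntegral_horizontal, segmentIntegral_vertical,
    segmentIntegral_vertical, ← this]
  simp only
  abel

theorem segmentIntegral_inv_sub {a b w : ℂ} (c : ℂ) (hc : c ≠ 0)
    (h : ∀ t ∈ Set.Icc (0 : ℝ) 1, c * (a + t * (b - a) - w) ∈ Complex.slitPlane) :
    segmentIntegral (fun z => (z - w)⁻¹) a b =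
      Complex.log (c * (b - w)) - Complex.log (c * (a - w)) := by
  have hne : ∀ t ∈ Set.Icc (0 : ℝ) 1, a + t * (b - a) - w ≠ 0 := fun t ht h0 => by
    have := h t ht
    rw [h0, mul_zero] at this
    exact Complex.zero_notMem_slitPlane this
  refine segmentIntegral_eq_sub (G := fun z => Complex.log (c * (z - w))) ?_ fun t ht => ?_
  · refine ContinuousOn.inv₀ (by fun_prop) ?_
    rintro _ ⟨t, ht, rfl⟩
    exact hne t ht
  · have e : (a + t * (b - a) - w)⁻¹ = c * 1 / (c * (a + t * (b - a) - w)) := by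
      have := hne t ht
      field_simp
    rw [e]
    exact (((hasDerivAt_id _).sub_const w).const_mul c).clog (h t ht)

/-- The boundary of a rectangle winds once around an interior point. On three of the sides the
principal logarithm is a primitive, on the left one the branch `log (-z)` is; the two branches
differ by `±πi` at the left corners. -/
theorem rectIntegral_inv_sub {x₀ x₁ y₀ y₁ : ℝ} {w : ℂ} (h₀ : x₀ < w.re) (h₁ : w.re < x₁)
    (h₂ : y₀ < w.im) (h₃ : w.im < y₁) :
    rectIntegral (fun z => (z - w)⁻¹) x₀ x₁ y₀ y₁ = 2 * Real.pi * Complex.I := by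
  have hb := segmentIntegral_inv_sub (a := ⟨x₀, y₀⟩) (b := ⟨x₁, y₀⟩) (w := w) 1 one_ne_zero
    fun t _ => by
      rw [Complex.mem_slitPlane_iff]
      right
      simp
      linarith
  have hr := segmentIntegral_inv_sub (a := ⟨x₁, y₀⟩) (b := ⟨x₁, y₁⟩) (w := w) 1 one_ne_zero
    fun t _ => by
      rw [Complex.mem_slitPlane_iff]
      left
      simp
      linarith
  have ht := segmentIntegral_inv_sub (a := ⟨x₁, y₁⟩) (b := ⟨x₀, y₁⟩) (w := w) 1 one_ne_zero
    fun t _ => by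
      rw [Complex.mem_slitPlane_iff]
      right
      simp
      linarith
  have hl := segmentIntegral_inv_sub (a := ⟨x₀, y₁⟩) (b := ⟨x₀, y₀⟩) (w := w) (-1) (by norm_num)
    fun t _ => by
      rw [Complex.mem_slitPlane_iff]
      left
      simp
      linarith
  have e₁ : Complex.log (-(⟨x₀, y₀⟩ - w)) = Complex.log (⟨x₀, y₀⟩ - w) + Real.pi * Complex.I := by
    rw [Complex.log, norm_neg, Complex.arg_neg_eq_arg_add_pi_of_im_neg (by simpa using h₂),
      Complex.log]
    push_cast
    ring
  have e₂ : Complex.log (-(⟨x₀, y₁⟩ - w)) = Complex.log (⟨x₀, y₁⟩ - w) - Real.pi * Complex.I := by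
    rw [Complex.log, norm_neg, Complex.arg_neg_eq_arg_sub_pi_of_im_pos (by simpa using h₃),
      Complex.log]
    push_cast
    ring
  rw [rectIntegral, hb, hr, ht, hl]
  simp only [one_mul, neg_one_mul, e₁, e₂]
  ring

end Segment

/-! ### Contours around compact sets -/

/-- The contour made of finitely many arcs indexed by an arbitrary finite type. -/
def Contour.ofFintype {ι : Type*} [Fintype ι] (γ : ι → ℝ → ℂ)
    (hγ : ∀ i, ContDiffOn ℝ 1 (γ i) (Set.Icc 0 1)) (next : Equiv.Perm ι)
    (h : ∀ i, γ i 1 = γ (next i) 0) : Contour where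
  n := Fintype.card ι
  γ j := γ ((Fintype.equivFin ι).symm j)
  contDiffOn j := hγ _
  next := (Fintype.equivFin ι).permCongr next
  joined j := by simp [h]

/-- The squares of the grid are indexed by their lower left corners in `ℤ × ℤ`, and their sides
(lower, right, upper, left) by `Fin 4`. This is the position, relative to the lower left corner,
of the corner in which a side begins. -/
def cornerOffset : Fin 4 → ℤ × ℤ := ![(0, 0), (1, 0), (1, 1), (0, 1)]

/-- The relative position of the square on the other side of a side. -/
def neighbourOffset : Fin 4 → ℤ × ℤ := ![(0, -1), (1, 0), (0, 1), (-1, 0)]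

/-- The pairs (square, side) on the boundary of a finite set of squares. -/
def boundaryEdges (Q : Finset (ℤ × ℤ)) : Finset ((ℤ × ℤ) × Fin 4) :=
  (Q ×ˢ Finset.univ).filter fun e => e.1 + neighbourOffset e.2 ∉ Q

theorem mem_boundaryEdges {Q : Finset (ℤ × ℤ)} {e : (ℤ × ℤ) × Fin 4} :
    e ∈ boundaryEdges Q ↔ e.1 ∈ Q ∧ e.1 + neighbourOffset e.2 ∉ Q := by
  simp [boundaryEdges]

/-- The grid point in which a side begins. -/
def edgeSource (e : (ℤ × ℤ) × Fin 4) : ℤ × ℤ := e.1 + cornerOffset e.2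

/-- The grid point in which a side ends. -/
def edgeTarget (e : (ℤ × ℤ) × Fin 4) : ℤ × ℤ := e.1 + cornerOffset (e.2 + 1)

/-- The boundary edges with a prescribed grid point `v` in the position `o` are described by their
direction alone. -/
def boundaryEdgesAtEquiv (Q : Finset (ℤ × ℤ)) (o : Fin 4 → ℤ × ℤ) (v : ℤ × ℤ) :
    {e : boundaryEdges Q // e.1.1 + o e.1.2 = v} ≃
      {d : Fin 4 // v - o d ∈ Q ∧ v - o d + neighbourOffset d ∉ Q} where
  toFun e := ⟨e.1.1.2, by
    rw [sub_eq_of_eq_add e.2.symm]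
    exact mem_boundaryEdges.1 e.1.2⟩
  invFun d := ⟨⟨(v - o d.1, d.1), mem_boundaryEdges.2 d.2⟩, sub_add_cancel _ _⟩
  left_inv e := Subtype.ext (Subtype.ext (Prod.ext (sub_eq_of_eq_add e.2.symm) rfl))
  right_inv _ := rfl

/-- On a cyclic arrangement of four squares, the changes from inside to outside are as numerous as
those from outside to inside. -/
theorem card_filter_cyclic : ∀ p : Fin 4 → Bool,
    (Finset.univ.filter fun d : Fin 4 => p (d + 1) = true ∧ ¬p (d + 2) = true).card =
      (Finset.univ.filter fun d : Fin 4 => p d = true ∧ ¬p (d - 1) = true).card := by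
  decide

/-- As many boundary edges begin as end in a given grid point: going round the point, one enters
the set of squares as often as one leaves it. -/
theorem nonempty_equiv_edges (Q : Finset (ℤ × ℤ)) (v : ℤ × ℤ) :
    Nonempty ({e : boundaryEdges Q // edgeTarget e = v} ≃
      {e : boundaryEdges Q // edgeSource e = v}) := by
  classical
  refine Fintype.card_eq.1 ?_
  have hs := Fintype.card_congr (boundaryEdgesAtEquiv Q cornerOffset v)
  have ht := Fintype.card_congr (boundaryEdgesAtEquiv Q (fun d => cornerOffset (d + 1)) v)
  rw [Fintype.card_subtype (fun d : Fin 4 => _ ∧ _)] at hs ht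
  have hn : ∀ d : Fin 4, v - cornerOffset d + neighbourOffset d = v - cornerOffset (d - 1) := by
    intro d
    fin_cases d <;> ext <;> simp [cornerOffset, neighbourOffset] <;> ring
  have hn' : ∀ d : Fin 4, v - cornerOffset (d + 1) + neighbourOffset d =
      v - cornerOffset (d + 2) := by
    intro d
    fin_cases d <;> ext <;> simp [cornerOffset, neighbourOffset] <;> ring
  simp only [hn, hn'] at hs ht
  have := card_filter_cyclic fun d => decide (v - cornerOffset d ∈ Q)
  simp only [decide_eq_true_eq] at this
  exact ht.trans (this.trans hs.symm)

/-- A permutation of the boundary edges that sends every edge to one that begins where it ends. -/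
theorem exists_perm_boundaryEdges (Q : Finset (ℤ × ℤ)) :
    ∃ σ : Equiv.Perm (boundaryEdges Q), ∀ e, edgeSource (σ e) = edgeTarget e := by
  let τ := fun v => (nonempty_equiv_edges Q v).some
  refine ⟨(Equiv.sigmaFiberEquiv fun e : boundaryEdges Q => edgeTarget e).symm.trans
    ((Equiv.sigmaCongrRight τ).trans
      (Equiv.sigmaFiberEquiv fun e : boundaryEdges Q => edgeSource e)), fun e => ?_⟩
  exact (τ (edgeTarget e) ⟨e, rfl⟩).2

/-- The grid point `v` as a complex number, for the grid with mesh `h`. -/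
def gridPoint (h : ℝ) (v : ℤ × ℤ) : ℂ := ⟨h * v.1, h * v.2⟩

/-- The parametrized side `e` of a square of the grid with mesh `h`. -/
def edgePath (h : ℝ) (e : (ℤ × ℤ) × Fin 4) (t : ℝ) : ℂ :=
  gridPoint h (edgeSource e) + t * (gridPoint h (edgeTarget e) - gridPoint h (edgeSource e))

/-- The closed square with lower left corner `q` of the grid with mesh `h`. -/
def gridSquare (h : ℝ) (q : ℤ × ℤ) : Set ℂ :=
  Set.Icc (h * q.1) (h * (q.1 + 1)) ×ℂ Set.Icc (h * q.2) (h * (q.2 + 1))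

/-- The same side, seen from the square on its other side. -/
def oppositeEdge (e : (ℤ × ℤ) × Fin 4) : (ℤ × ℤ) × Fin 4 :=
  (e.1 + neighbourOffset e.2, e.2 + 2)

theorem edgeSource_oppositeEdge (e : (ℤ × ℤ) × Fin 4) :
    edgeSource (oppositeEdge e) = edgeTarget e := by
  obtain ⟨q, d⟩ := e
  fin_cases d <;> ext <;>
    simp [edgeSource, edgeTarget, oppositeEdge, cornerOffset, neighbourOffset]

theorem edgeTarget_oppositeEdge (e : (ℤ × ℤ) × Fin 4) :
    edgeTarget (oppositeEdge e) = edgeSource e := by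
  obtain ⟨q, d⟩ := e
  fin_cases d <;> ext <;>
    simp [edgeSource, edgeTarget, oppositeEdge, cornerOffset, neighbourOffset]

theorem oppositeEdge_oppositeEdge (e : (ℤ × ℤ) × Fin 4) : oppositeEdge (oppositeEdge e) = e := by
  obtain ⟨q, d⟩ := e
  fin_cases d <;> simp [oppositeEdge, neighbourOffset, add_assoc]

theorem edgePath_mem_gridSquare {h : ℝ} (hh : 0 ≤ h) (e : (ℤ × ℤ) × Fin 4) {t : ℝ}
    (ht : t ∈ Set.Icc (0 : ℝ) 1) : edgePath h e t ∈ gridSquare h e.1 := by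
  have h1 : 0 ≤ t * h := mul_nonneg ht.1 hh
  have h2 : t * h ≤ h := mul_le_of_le_one_left hh ht.2
  obtain ⟨q, d⟩ := e
  rw [gridSquare, Complex.mem_reProdIm]
  refine ⟨⟨?_, ?_⟩, ?_, ?_⟩ <;> fin_cases d <;>
    simp [edgePath, edgeSource, edgeTarget, gridPoint, cornerOffset] <;> linarith

theorem edgePath_oppositeEdge (h : ℝ) (e : (ℤ × ℤ) × Fin 4) (t : ℝ) :
    edgePath h (oppositeEdge e) (1 - t) = edgePath h e t := by
  rw [edgePath, edgeSource_oppositeEdge, edgeTarget_oppositeEdge, edgePath]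
  push_cast
  ring

theorem hasDerivAt_edgePath (h : ℝ) (e : (ℤ × ℤ) × Fin 4) (t : ℝ) :
    HasDerivAt (edgePath h e) (gridPoint h (edgeTarget e) - gridPoint h (edgeSource e)) t := by
  have := ((Complex.ofRealCLM.hasDerivAt (x := t)).mul_const
    (gridPoint h (edgeTarget e) - gridPoint h (edgeSource e))).const_add
      (gridPoint h (edgeSource e))
  rw [Complex.ofRealCLM_apply, Complex.ofReal_one, one_mul] at this
  exact this

theorem contDiff_edgePath (h : ℝ) (e : (ℤ × ℤ) × Fin 4) : ContDiff ℝ 1 (edgePath h e) :=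
  contDiff_const.add (Complex.ofRealCLM.contDiff.mul contDiff_const)

/-- The boundary of a finite union of squares of the grid, as a contour. -/
def gridContour (h : ℝ) (Q : Finset (ℤ × ℤ)) : Contour :=
  Contour.ofFintype (fun e : boundaryEdges Q => edgePath h e)
    (fun e => (contDiff_edgePath h e).contDiffOn)
    (exists_perm_boundaryEdges Q).choose
    fun e => by
      rw [edgePath, edgePath, (exists_perm_boundaryEdges Q).choose_spec e]
      simp

theorem trace_gridContour (h : ℝ) (Q : Finset (ℤ × ℤ)) :
    (gridContour h Q).trace = ⋃ e ∈ boundaryEdges Q, edgePath h e '' Set.Icc 0 1 := by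
  ext z
  simp only [Contour.trace, Set.mem_iUnion]
  constructor
  · rintro ⟨j, hj⟩
    exact ⟨_, ((Fintype.equivFin (boundaryEdges Q)).symm j).2, hj⟩
  · rintro ⟨e, he, hz⟩
    refine ⟨Fintype.equivFin (boundaryEdges Q) ⟨e, he⟩, ?_⟩
    simpa [gridContour, Contour.ofFintype] using hz

section GridIntegral

variable {X : Type*} [NormedAddCommGroup X] [NormedSpace ℂ X]

/-- The contribution of one side of a square to a boundary integral. -/
def edgeIntegral (h : ℝ) (F : ℂ → X) (e : (ℤ × ℤ) × Fin 4) : X :=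
  segmentIntegral F (gridPoint h (edgeSource e)) (gridPoint h (edgeTarget e))

theorem edgeIntegral_oppositeEdge (h : ℝ) (F : ℂ → X) (e : (ℤ × ℤ) × Fin 4) :
    edgeIntegral h F (oppositeEdge e) = -edgeIntegral h F e := by
  rw [edgeIntegral, edgeSource_oppositeEdge, edgeTarget_oppositeEdge, segmentIntegral_symm,
    edgeIntegral]

theorem integral_gridContour_eq_sum_edgeIntegral (h : ℝ) (Q : Finset (ℤ × ℤ)) (F : ℂ → X) :
    (gridContour h Q).integral F = ∑ e ∈ boundaryEdges Q, edgeIntegral h F e := by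
  rw [← Finset.sum_coe_sort (boundaryEdges Q),
    ← Equiv.sum_comp (Fintype.equivFin (boundaryEdges Q)).symm]
  refine Finset.sum_congr rfl fun j _ => ?_
  rw [edgeIntegral, segmentIntegral]
  refine intervalIntegral.integral_congr fun t ht => ?_
  rw [Set.uIcc_of_le zero_le_one] at ht
  exact congrArg₂ _ ((hasDerivAt_edgePath h _ t).hasDerivWithinAt.derivWithin
    (uniqueDiffOn_Icc zero_lt_one t ht)) rfl

/-- The contributions of the interior sides cancel. -/
theorem integral_gridContour (h : ℝ) (Q : Finset (ℤ × ℤ)) (F : ℂ → X) :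
    (gridContour h Q).integral F =
      ∑ q ∈ Q, rectIntegral F (h * q.1) (h * (q.1 + 1)) (h * q.2) (h * (q.2 + 1)) := by
  have h1 : ∀ q : ℤ × ℤ, rectIntegral F (h * q.1) (h * (q.1 + 1)) (h * q.2) (h * (q.2 + 1)) =
      ∑ d, edgeIntegral h F (q, d) := by
    intro q
    simp [Fin.sum_univ_four, edgeIntegral, rectIntegral, edgeSource, edgeTarget, cornerOffset,
      gridPoint]
  have h2 : ∑ e ∈ (Q ×ˢ Finset.univ).filter
      (fun e : (ℤ × ℤ) × Fin 4 => ¬ e.1 + neighbourOffset e.2 ∉ Q), edgeIntegral h F e = 0 := by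
    refine Finset.sum_involution (fun e _ => oppositeEdge e) (fun e _ => ?_) (fun e _ _ => ?_)
      (fun e he => ?_) fun e _ => oppositeEdge_oppositeEdge e
    · rw [edgeIntegral_oppositeEdge, add_neg_cancel]
    · intro h
      have := congrArg Prod.snd h
      obtain ⟨q, d⟩ := e
      revert this
      fin_cases d <;> simp [oppositeEdge]
    · simp only [Finset.mem_filter, Finset.mem_product, Finset.mem_univ, and_true, not_not] at he ⊢
      refine ⟨he.2, ?_⟩
      have := congrArg Prod.fst (oppositeEdge_oppositeEdge e)
      simp only [oppositeEdge] at this ⊢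
      rw [this]
      exact he.1
  rw [integral_gridContour_eq_sum_edgeIntegral, Finset.sum_congr rfl fun q _ => h1 q,
    ← Finset.sum_product', ← Finset.sum_filter_add_sum_filter_not (Q ×ˢ Finset.univ)
      (fun e : (ℤ × ℤ) × Fin 4 => e.1 + neighbourOffset e.2 ∉ Q), h2, add_zero]
  rfl

end GridIntegral

theorem mem_gridSquare_iff {h : ℝ} {q : ℤ × ℤ} {z : ℂ} : z ∈ gridSquare h q ↔
    (h * q.1 ≤ z.re ∧ z.re ≤ h * (q.1 + 1)) ∧ h * q.2 ≤ z.im ∧ z.im ≤ h * (q.2 + 1) := by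
  rw [gridSquare, Complex.mem_reProdIm, Set.mem_Icc, Set.mem_Icc]

theorem exists_mem_gridSquare {h : ℝ} (hh : 0 < h) (z : ℂ) : ∃ q, z ∈ gridSquare h q := by
  refine ⟨(⌊z.re / h⌋, ⌊z.im / h⌋), mem_gridSquare_iff.2 ?_⟩
  have h1 := Int.floor_le (z.re / h)
  have h2 := (Int.lt_floor_add_one (z.re / h)).le
  have h3 := Int.floor_le (z.im / h)
  have h4 := (Int.lt_floor_add_one (z.im / h)).le
  rw [le_div_iff₀' hh] at h1 h3
  rw [div_le_iff₀' hh] at h2 h4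
  exact ⟨⟨h1, h2⟩, h3, h4⟩

theorem dist_le_of_mem_gridSquare {h : ℝ} {q : ℤ × ℤ} {z w : ℂ}
    (hz : z ∈ gridSquare h q) (hw : w ∈ gridSquare h q) : dist z w ≤ 2 * h := by
  rw [mem_gridSquare_iff] at hz hw
  obtain ⟨⟨a1, a2⟩, a3, a4⟩ := hz
  obtain ⟨⟨b1, b2⟩, b3, b4⟩ := hw
  rw [dist_eq_norm]
  refine (Complex.norm_le_abs_re_add_abs_im _).trans ?_
  have h1 : |(z - w).re| ≤ h := by
    rw [Complex.sub_re, abs_le]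
    constructor <;> linarith
  have h2 : |(z - w).im| ≤ h := by
    rw [Complex.sub_im, abs_le]
    constructor <;> linarith
  linarith

theorem finite_gridSquare_inter {h : ℝ} (hh : 0 < h) {K : Set ℂ} (hK : IsCompact K) :
    {q : ℤ × ℤ | (gridSquare h q ∩ K).Nonempty}.Finite := by
  obtain ⟨R, hR⟩ := hK.isBounded.exists_norm_le
  obtain ⟨N, hN⟩ := exists_nat_gt (R / h + 1)
  refine Set.Finite.subset ((Set.finite_Icc (-N : ℤ) N).prod (Set.finite_Icc (-N : ℤ) N)) ?_
  rintro q ⟨z, hz, hzK⟩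
  rw [mem_gridSquare_iff] at hz
  obtain ⟨⟨a1, a2⟩, a3, a4⟩ := hz
  have hre := abs_le.1 ((Complex.abs_re_le_norm z).trans (hR z hzK))
  have him := abs_le.1 ((Complex.abs_im_le_norm z).trans (hR z hzK))
  have hN' : R + h < h * N := by
    have := mul_lt_mul_of_pos_left hN hh
    rwa [mul_add, mul_div_cancel₀ _ hh.ne', mul_one] at this
  have key : ∀ (m : ℤ) (x : ℝ), -R ≤ x → x ≤ R → h * m ≤ x → x ≤ h * (m + 1) →
      -(N : ℤ) ≤ m ∧ m ≤ N := by
    intro m x x1 x2 m1 m2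
    constructor
    · have : h * (-N : ℝ) ≤ h * m := by linarith
      have := le_of_mul_le_mul_left this hh
      exact_mod_cast this
    · have : h * (m : ℝ) ≤ h * N := by linarith
      have := le_of_mul_le_mul_left this hh
      exact_mod_cast this
  exact ⟨key q.1 z.re hre.1 hre.2 a1 a2, key q.2 z.im him.1 him.2 a3 a4⟩

/-- Every compact subset `K` of an open set `U` can be surrounded by a contour in `U`, the boundary
of the union of those squares of a fine grid that meet `K`. By construction Cauchy's theorem holds
for this contour. -/
theorem exists_contour_around {X : Type*} [NormedAddCommGroup X] [NormedSpace ℂ X]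
    [CompleteSpace X] {K U : Set ℂ} (hK : IsCompact K) (hU : IsOpen U) (hKU : K ⊆ U) :
    ∃ Γ : Contour, (∀ z ∈ Γ.trace, z ∈ U ∧ z ∉ K) ∧ (∀ w ∈ K, Γ.windingNumber w = 1) ∧
      (∀ w ∉ U, Γ.windingNumber w = 0) ∧
      ∀ F : ℂ → X, DifferentiableOn ℂ F U → Γ.integral F = 0 := by
  obtain ⟨δ, hδ, hδU⟩ := hK.exists_thickening_subset_open hU hKU
  set h := δ / 3 with hh_def
  have hh : 0 < h := by positivity
  set Q := (finite_gridSquare_inter hh hK).toFinset with hQ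
  have memQ : ∀ q, q ∈ Q ↔ (gridSquare h q ∩ K).Nonempty := fun q => by simp [hQ]
  have hsqU : ∀ q ∈ Q, gridSquare h q ⊆ U := by
    intro q hq z hz
    obtain ⟨k, hk, hkK⟩ := (memQ q).1 hq
    refine hδU (Metric.mem_thickening_iff.2 ⟨k, hkK, ?_⟩)
    have := dist_le_of_mem_gridSquare hz hk
    linarith
  have htr : ∀ z ∈ (gridContour h Q).trace, z ∈ U ∧ z ∉ K := by
    intro z hz
    rw [trace_gridContour] at hz
    simp only [Set.mem_iUnion] at hz
    obtain ⟨e, he, t, ht, rfl⟩ := hz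
    rw [mem_boundaryEdges] at he
    refine ⟨hsqU _ he.1 (edgePath_mem_gridSquare hh.le e ht), fun hzK => he.2 ?_⟩
    refine (memQ _).2 ⟨_, ?_, hzK⟩
    rw [← edgePath_oppositeEdge]
    exact edgePath_mem_gridSquare hh.le (oppositeEdge e) ⟨by linarith [ht.2], by linarith [ht.1]⟩
  have hle : ∀ m : ℤ, h * m ≤ h * (m + 1) := fun m => by nlinarith
  refine ⟨gridContour h Q, htr, fun w hw => ?_, fun w hw => ?_, fun F hF => ?_⟩
  · obtain ⟨q, hq⟩ := exists_mem_gridSquare hh w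
    have hqQ : q ∈ Q := (memQ q).2 ⟨w, hq, hw⟩
    -- a point of the open square, so close to `w` that the winding number is the same
    obtain ⟨w', hw', ⟨a1, a2⟩, a3, a4⟩ : ∃ w',
        (gridContour h Q).windingNumber w' = (gridContour h Q).windingNumber w ∧
        (h * q.1 < w'.re ∧ w'.re < h * (q.1 + 1)) ∧ h * q.2 < w'.im ∧ w'.im < h * (q.2 + 1) := by
      set c : ℂ := ⟨h * q.1 + h / 2, h * q.2 + h / 2⟩ with hc
      have hlim : Tendsto (fun s : ℝ => w + s * (c - w)) (𝓝[>] 0) (𝓝 w) := by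
        have : Continuous fun s : ℝ => w + s * (c - w) := by fun_prop
        simpa using (this.tendsto 0).mono_left nhdsWithin_le_nhds
      have h1 := hlim.eventually ((gridContour h Q).windingNumber_eventually_eq
        fun hm => (htr w hm).2 hw)
      have h2 : ∀ᶠ s : ℝ in 𝓝[>] 0, s ∈ Set.Ioo (0 : ℝ) 1 := Ioo_mem_nhdsGT zero_lt_one
      obtain ⟨s, hs, hs0, hs1⟩ := (h1.and h2).exists
      refine ⟨_, hs, ?_⟩
      obtain ⟨⟨b1, b2⟩, b3, b4⟩ := mem_gridSquare_iff.1 hq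
      have p1 := mul_pos hs0 hh
      have p2 : 0 < (1 - s) := by linarith
      simp only [hc, Complex.add_re, Complex.add_im, Complex.mul_re, Complex.mul_im,
        Complex.sub_re, Complex.sub_im, Complex.ofReal_re, Complex.ofReal_im, zero_mul, sub_zero,
        add_zero]
      refine ⟨⟨?_, ?_⟩, ?_, ?_⟩ <;> nlinarith
    rw [← hw', Contour.windingNumber, integral_gridContour, Finset.sum_eq_single q,
      rectIntegral_inv_sub a1 a2 a3 a4, inv_mul_cancel₀ Complex.two_pi_I_ne_zero]
    · intro q' _ hne
      refine rectIntegral_eq_zero (hle _) (hle _) fun z hz => ?_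
      refine ((differentiableAt_id.sub_const w').inv fun h0 => hne ?_).differentiableWithinAt
      have hz' : z = w' := sub_eq_zero.1 h0
      rw [hz'] at hz
      obtain ⟨⟨b1, b2⟩, b3, b4⟩ := mem_gridSquare_iff.1 hz
      have key : ∀ (m n : ℤ) (x : ℝ), h * m < x → x < h * (m + 1) → h * n ≤ x → x ≤ h * (n + 1) →
          n = m := by
        intro m n x m1 m2 n1 n2
        have e1 := lt_of_mul_lt_mul_left (n1.trans_lt m2) hh.le
        have e2 := lt_of_mul_lt_mul_left (m1.trans_le n2) hh.le
        have e1' : n < m + 1 := by exact_mod_cast e1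
        have e2' : m < n + 1 := by exact_mod_cast e2
        omega
      exact Prod.ext (key _ _ _ a1 a2 b1 b2) (key _ _ _ a3 a4 b3 b4)
    · exact fun hq' => absurd hqQ hq'
  · rw [Contour.windingNumber, integral_gridContour, Finset.sum_eq_zero, mul_zero]
    intro q hq
    refine rectIntegral_eq_zero (hle _) (hle _) fun z hz => ?_
    refine ((differentiableAt_id.sub_const w).inv fun h0 => hw ?_).differentiableWithinAt
    have hz' : z = w := sub_eq_zero.1 h0
    exact hz' ▸ hsqU q hq hz
  · rw [integral_gridContour]
    exact Finset.sum_eq_zero fun q hq =>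
      rectIntegral_eq_zero (hle _) (hle _) (hF.mono (hsqU q hq))

/-! ### Homologous contours and Cauchy's theorem -/

namespace Contour

variable {X : Type*} [NormedAddCommGroup X] [NormedSpace ℂ X]

/-- The contour without arcs. -/
def emptyContour : Contour where
  n := 0
  γ j := j.elim0
  contDiffOn j := j.elim0
  next := Equiv.refl _
  joined j := j.elim0

theorem integral_emptyContour (F : ℂ → X) : emptyContour.integral F = 0 :=
  Finset.sum_eq_zero fun j _ => j.elim0

theorem trace_emptyContour : emptyContour.trace = ∅ :=
  Set.iUnion_eq_empty.2 fun j => j.elim0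

theorem windingNumber_emptyContour (w : ℂ) : emptyContour.windingNumber w = 0 := by
  rw [windingNumber, integral_emptyContour, mul_zero]

/-- Cauchy's integral formula for a contour for which Cauchy's theorem holds. -/
theorem integral_inv_sub_smul_of_forall_integral_eq_zero [CompleteSpace X] (C : Contour)
    {U : Set ℂ} (hU : IsOpen U) (hCU : C.trace ⊆ U)
    (hC : ∀ G : ℂ → X, DifferentiableOn ℂ G U → C.integral G = 0)
    {F : ℂ → X} (hF : DifferentiableOn ℂ F U) {z : ℂ} (hz : z ∈ U) (hzC : z ∉ C.trace) :
    C.integral (fun ζ => (ζ - z)⁻¹ • F ζ) =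
      (2 * Real.pi * Complex.I * C.windingNumber z) • F z := by
  have hd : DifferentiableOn ℂ (dslope F z) U :=
    (Complex.differentiableOn_dslope (hU.mem_nhds hz)).2 hF
  have h1 : C.integral (fun ζ => (ζ - z)⁻¹ • F ζ) =
      C.integral fun ζ => dslope F z ζ + (ζ - z)⁻¹ • F z := by
    refine C.integral_congr fun ζ hζ => ?_
    have hne : ζ ≠ z := fun h => hzC (h ▸ hζ)
    rw [dslope_of_ne _ hne, slope_def_module, ← smul_add, sub_add_cancel]
  rw [h1, C.integral_add (G := fun ζ => (ζ - z)⁻¹ • F z) (hd.continuousOn.mono hCU)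
    ((C.continuousOn_inv_sub hzC).smul continuousOn_const), hC _ hd, zero_add,
    C.integral_smul_const, C.integral_inv_sub]

/-- **Cauchy's theorem**, in the form of Ahlfors and Beardon: two contours in an open set `U` with
the same winding numbers about the points outside `U` yield the same integrals of holomorphic
functions on `U`. The function is represented by Cauchy's formula along a contour that surrounds
both traces and all the points at which the winding numbers differ, and the order of integration
is interchanged. -/
theorem integral_eq_of_windingNumber_eq [CompleteSpace X] (C D : Contour) {U : Set ℂ}
    (hU : IsOpen U) (hC : C.trace ⊆ U) (hD : D.trace ⊆ U)
    (h : ∀ w ∉ U, C.windingNumber w = D.windingNumber w)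
    {F : ℂ → X} (hF : DifferentiableOn ℂ F U) : C.integral F = D.integral F := by
  set W : Set ℂ := {w | w ∈ C.trace ∨ w ∈ D.trace ∨ C.windingNumber w ≠ D.windingNumber w}
    with hW
  have hWU : W ⊆ U := by
    rintro w (hw | hw | hw)
    · exact hC hw
    · exact hD hw
    · exact by_contra fun hwU => hw (h w hwU)
  have hWclosed : IsClosed W := by
    rw [← isOpen_compl_iff, isOpen_iff_mem_nhds]
    intro w hw
    simp only [hW, Set.mem_compl_iff, Set.mem_ofPred_eq, not_or, not_not] at hw
    filter_upwards [C.windingNumber_eventually_eq hw.1, D.windingNumber_eventually_eq hw.2.1,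
      C.isCompact_trace.isClosed.isOpen_compl.mem_nhds hw.1,
      D.isCompact_trace.isClosed.isOpen_compl.mem_nhds hw.2.1] with v h1 h2 h3 h4
    simp only [hW, Set.mem_compl_iff, Set.mem_ofPred_eq, not_or, not_not]
    exact ⟨h3, h4, by rw [h1, h2, hw.2.2]⟩
  have hWcompact : IsCompact W := by
    obtain ⟨R₁, hR₁⟩ := C.exists_windingNumber_eq_zero
    obtain ⟨R₂, hR₂⟩ := D.exists_windingNumber_eq_zero
    refine Metric.isCompact_of_isClosed_isBounded hWclosed ?_
    refine ((C.isCompact_trace.isBounded.union D.isCompact_trace.isBounded).union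
      (Metric.isBounded_closedBall (x := (0 : ℂ)) (r := max R₁ R₂))).subset ?_
    rintro w (hw | hw | hw)
    · exact Or.inl (Or.inl hw)
    · exact Or.inl (Or.inr hw)
    · refine Or.inr (mem_closedBall_zero_iff.2 (not_lt.1 fun hlt => hw ?_))
      rw [hR₁ w ((le_max_left _ _).trans_lt hlt), hR₂ w ((le_max_right _ _).trans_lt hlt)]
  obtain ⟨Γ, hΓ, hΓ1, -, hΓ0⟩ := exists_contour_around (X := X) hWcompact hU hWU
  have key : ∀ E : Contour, E.trace ⊆ W → (2 * Real.pi * Complex.I : ℂ) • E.integral F =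
      Γ.integral fun ζ => -(2 * Real.pi * Complex.I * E.windingNumber ζ) • F ζ := by
    intro E hE
    have hne : ∀ z ∈ E.trace, ∀ ζ ∈ Γ.trace, ζ - z ≠ 0 := fun z hz ζ hζ h0 =>
      (hΓ ζ hζ).2 (hE ((sub_eq_zero.1 h0).symm ▸ hz))
    calc (2 * Real.pi * Complex.I : ℂ) • E.integral F
        = E.integral fun z => (2 * Real.pi * Complex.I : ℂ) • F z :=
          (E.integral_const_smul _ _).symm
      _ = E.integral fun z => Γ.integral fun ζ => (ζ - z)⁻¹ • F ζ := by
          refine E.integral_congr fun z hz => ?_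
          rw [Γ.integral_inv_sub_smul_of_forall_integral_eq_zero hU (fun ζ hζ => (hΓ ζ hζ).1) hΓ0
            hF (hWU (hE hz)) fun hz' => (hΓ z hz').2 (hE hz), hΓ1 z (hE hz), mul_one]
      _ = Γ.integral fun ζ => E.integral fun z => (ζ - z)⁻¹ • F ζ := by
          refine E.integral_integral_swap Γ (ContinuousOn.smul ?_ ?_)
          · exact ContinuousOn.inv₀ (by fun_prop) fun p hp => hne _ hp.1 _ hp.2
          · exact (hF.continuousOn.mono fun ζ hζ => (hΓ ζ hζ).1).comp continuousOn_snd
              fun p hp => hp.2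
      _ = Γ.integral fun ζ => -(2 * Real.pi * Complex.I * E.windingNumber ζ) • F ζ := by
          refine Γ.integral_congr fun ζ _ => ?_
          rw [E.integral_smul_const, ← E.integral_inv_sub, ← E.integral_neg]
          simp only [← inv_neg, neg_sub]
  have heq : (2 * Real.pi * Complex.I : ℂ) • C.integral F =
      (2 * Real.pi * Complex.I : ℂ) • D.integral F := by
    rw [key C fun z hz => Or.inl hz, key D fun z hz => Or.inr (Or.inl hz)]
    refine Γ.integral_congr fun ζ hζ => ?_
    have := (hΓ ζ hζ).2
    simp only [hW, Set.mem_ofPred_eq, not_or, not_not] at this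
    rw [this.2.2]
  exact smul_right_injective X Complex.two_pi_I_ne_zero heq

theorem integral_eq_zero_of_differentiableOn [CompleteSpace X] (C : Contour) {U : Set ℂ}
    (hU : IsOpen U) (hC : C.trace ⊆ U) (h : ∀ w ∉ U, C.windingNumber w = 0)
    {F : ℂ → X} (hF : DifferentiableOn ℂ F U) : C.integral F = 0 := by
  rw [C.integral_eq_of_windingNumber_eq emptyContour hU hC (by simp [trace_emptyContour])
    (fun w hw => by rw [h w hw, windingNumber_emptyContour]) hF, integral_emptyContour]

/-- The circle about `0` of radius `R`. -/
def circleContour (R : ℝ) : Contour where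
  n := 1
  γ _ t := circleMap 0 R (2 * Real.pi * t)
  contDiffOn _ := ((contDiff_circleMap 0 R).comp (contDiff_const.mul contDiff_id)).contDiffOn
  next := Equiv.refl _
  joined _ := by simp [circleMap]

theorem integral_circleContour (R : ℝ) (F : ℂ → X) :
    (circleContour R).integral F = ∮ z in C(0, R), F z := by
  have h := intervalIntegral.smul_integral_comp_mul_left (a := 0) (b := 1)
    (fun θ : ℝ => deriv (circleMap 0 R) θ • F (circleMap 0 R θ)) (2 * Real.pi)
  rw [mul_zero, mul_one] at h
  rw [circleIntegral, ← h, ← intervalIntegral.integral_smul]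
  refine (Fin.sum_univ_one _).trans (intervalIntegral.integral_congr fun t ht => ?_)
  rw [Set.uIcc_of_le zero_le_one] at ht
  have hd : HasDerivAt (fun t : ℝ => circleMap 0 R (2 * Real.pi * t))
      ((2 * Real.pi) • deriv (circleMap 0 R) (2 * Real.pi * t)) t := by
    rw [deriv_circleMap]
    refine (hasDerivAt_circleMap 0 R (2 * Real.pi * t)).scomp t ?_
    simpa using (hasDerivAt_id t).const_mul (2 * Real.pi)
  have hd' := hd.hasDerivWithinAt.derivWithin (uniqueDiffOn_Icc zero_lt_one t ht)
  simp only [circleContour, hd', smul_assoc]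

theorem trace_circleContour {R : ℝ} (hR : 0 ≤ R) {z : ℂ} (hz : z ∈ (circleContour R).trace) :
    ‖z‖ = R := by
  obtain ⟨j, t, -, rfl⟩ := Set.mem_iUnion.1 hz
  simp [circleContour, abs_of_nonneg hR]

theorem windingNumber_circleContour {R : ℝ} {w : ℂ} (hw : ‖w‖ < R) :
    (circleContour R).windingNumber w = 1 := by
  rw [windingNumber, integral_circleContour,
    circleIntegral.integral_sub_inv_of_mem_ball (mem_ball_zero_iff.2 hw),
    inv_mul_cancel₀ Complex.two_pi_I_ne_zero]

theorem IsAdmissible.mono {C : Contour} {f : ℂ → ℂ} {K L : Set ℂ} (h : C.IsAdmissible f L)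
    (hKL : K ⊆ L) : C.IsAdmissible f K :=
  ⟨h.analyticAt, fun z hz hK => h.avoids z hz (hKL hK), fun w hw => h.winding_one w (hKL hw),
    h.winding_zero⟩

theorem exists_isAdmissible {f : ℂ → ℂ} {K : Set ℂ} (hK : IsCompact K)
    (hf : AnalyticOnNhd ℂ f K) : ∃ C : Contour, C.IsAdmissible f K := by
  obtain ⟨C, h1, h2, h3, -⟩ := exists_contour_around (X := ℂ) hK (isOpen_analyticAt ℂ f) hf
  exact ⟨C, fun z hz => (h1 z hz).1, fun z hz => (h1 z hz).2, h2, h3⟩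

theorem differentiableOn_analyticAt (f : ℂ → ℂ) :
    DifferentiableOn ℂ f {z | AnalyticAt ℂ f z} :=
  fun _ hz => hz.differentiableAt.differentiableWithinAt

/-- Cauchy's integral formula for an admissible contour. -/
theorem IsAdmissible.integral_inv_sub_mul {C : Contour} {f : ℂ → ℂ} {K : Set ℂ}
    (h : C.IsAdmissible f K) {w : ℂ} (hw : w ∈ K) (hf : AnalyticAt ℂ f w) :
    (2 * Real.pi * Complex.I)⁻¹ * C.integral (fun z => f z * (z - w)⁻¹) = f w := by
  have := C.integral_inv_sub_smul_of_forall_integral_eq_zero (isOpen_analyticAt ℂ f) h.analyticAt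
    (fun G hG => C.integral_eq_zero_of_differentiableOn (isOpen_analyticAt ℂ f) h.analyticAt
      h.winding_zero hG) (differentiableOn_analyticAt f) hf (fun hm => h.avoids w hm hw)
  simp only [smul_eq_mul, mul_comm _ (f _)] at this
  rw [this, h.winding_one w hw, mul_one, mul_comm (f w),
    inv_mul_cancel_left₀ Complex.two_pi_I_ne_zero]

end Contour

/-! ### Analytic functions of an operator -/

section FunctionalCalculus

variable {H : Type*} [NormedAddCommGroup H] [InnerProductSpace ℂ H]

theorem commute_ringInverse {A X : H →L[ℂ] H} (h : Commute X A) : Commute X (Ring.inverse A) := by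
  by_cases hA : IsUnit A
  · obtain ⟨u, rfl⟩ := hA
    rw [Ring.inverse_unit]
    exact h.units_inv_right
  · rw [Ring.inverse_non_unit _ hA]
    exact Commute.zero_right X

theorem commute_resolvent {T X : H →L[ℂ] H} (h : Commute X T) (z : ℂ) :
    Commute X (resolvent T z) :=
  commute_ringInverse ((Algebra.commute_algebraMap_right z X).sub_right h)

theorem sub_mul_resolvent {T : H →L[ℂ] H} {z : ℂ} (hz : z ∉ spectrum ℂ T) (w : ℂ) :
    (T - algebraMap ℂ _ w) * resolvent T z = (z - w) • resolvent T z - 1 := by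
  have h1 : (algebraMap ℂ _ z - T) * resolvent T z = 1 :=
    Ring.mul_inverse_cancel _ (spectrum.notMem_iff.1 hz)
  rw [← h1, Algebra.algebraMap_eq_smul_one, Algebra.algebraMap_eq_smul_one, sub_smul, sub_mul,
    sub_mul, smul_mul_assoc, smul_mul_assoc, one_mul]
  abel

variable [CompleteSpace H]

theorem differentiableOn_resolvent (T : H →L[ℂ] H) :
    DifferentiableOn ℂ (resolvent T) (spectrum ℂ T)ᶜ := fun _ hz =>
  (spectrum.hasDerivAt_resolvent_const_left (spectrum.notMem_iff.1 hz)).differentiableAt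
    |>.differentiableWithinAt

theorem continuousOn_resolvent_trace {C : Contour} {T : H →L[ℂ] H}
    (h : ∀ z ∈ C.trace, z ∉ spectrum ℂ T) : ContinuousOn (resolvent T) C.trace :=
  (differentiableOn_resolvent T).continuousOn.mono h

namespace Contour.IsAdmissible

variable {C : Contour} {f : ℂ → ℂ} {T : H →L[ℂ] H}

theorem continuousOn {K : Set ℂ} (h : C.IsAdmissible f K) : ContinuousOn f C.trace :=
  (differentiableOn_analyticAt f).continuousOn.mono h.analyticAt

theorem continuousOn_smul_resolvent (h : C.IsAdmissible f (spectrum ℂ T)) :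
    ContinuousOn (fun z => f z • resolvent T z) C.trace :=
  h.continuousOn.smul (continuousOn_resolvent_trace h.avoids)

end Contour.IsAdmissible

/-- The operator obtained from one admissible contour is `f(T)`: all admissible contours are
homologous in the complement of the spectrum in the domain of analyticity. -/
theorem isAnalyticFunctionOf_cauchyIntegral {f : ℂ → ℂ} {T : H →L[ℂ] H} {C : Contour}
    (hC : C.IsAdmissible f (spectrum ℂ T)) :
    IsAnalyticFunctionOf f T (cauchyIntegral C f T) := by
  refine ⟨⟨C, hC⟩, fun D hD => ?_⟩
  have hU : IsOpen ({z | AnalyticAt ℂ f z} ∩ (spectrum ℂ T)ᶜ) :=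
    (isOpen_analyticAt ℂ f).inter (spectrum.isClosed T).isOpen_compl
  rw [cauchyIntegral, cauchyIntegral, C.integral_eq_of_windingNumber_eq D hU
    (fun z hz => ⟨hC.analyticAt z hz, hC.avoids z hz⟩)
    (fun z hz => ⟨hD.analyticAt z hz, hD.avoids z hz⟩) (fun w hw => ?_)]
  · exact ((Contour.differentiableOn_analyticAt f).mono Set.inter_subset_left).smul
      ((differentiableOn_resolvent T).mono Set.inter_subset_right)
  · by_cases hw' : w ∈ spectrum ℂ T
    · rw [hC.winding_one w hw', hD.winding_one w hw']
    · have hn : ¬AnalyticAt ℂ f w := fun ha => hw ⟨ha, hw'⟩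
      rw [hC.winding_zero w hn, hD.winding_zero w hn]

/-- A closed subspace that contains the resolvents contains `f(T)`. -/
theorem cauchyIntegral_mem {f : ℂ → ℂ} {T : H →L[ℂ] H} {C : Contour}
    (hf : ContinuousOn f C.trace) (hT : ∀ z ∈ C.trace, z ∉ spectrum ℂ T)
    (M : Submodule ℂ (H →L[ℂ] H)) (hM : IsClosed (M : Set (H →L[ℂ] H)))
    (h : ∀ z ∈ C.trace, resolvent T z ∈ M) : cauchyIntegral C f T ∈ M :=
  M.smul_mem _ (C.integral_mem M hM (hf.smul (continuousOn_resolvent_trace hT)) fun z hz =>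
    M.smul_mem _ (h z hz))

theorem commute_cauchyIntegral {f : ℂ → ℂ} {T X : H →L[ℂ] H} {C : Contour}
    (hf : ContinuousOn f C.trace) (hT : ∀ z ∈ C.trace, z ∉ spectrum ℂ T) (h : Commute X T) :
    Commute X (cauchyIntegral C f T) :=
  cauchyIntegral_mem hf hT (Subalgebra.toSubmodule (Subalgebra.centralizer ℂ {X}))
    (Set.isClosed_centralizer {X})
    (fun z _ => by
      rw [Subalgebra.mem_toSubmodule, Subalgebra.mem_centralizer_iff]
      rintro _ rfl
      exact commute_resolvent h z) X rfl

/-- The function `1` of an operator is the identity. The contour may be replaced by large circles,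
where `(z - T)⁻¹ - z⁻¹ = z⁻¹ T (z - T)⁻¹` is `o(1/z)`. -/
theorem integral_resolvent {C : Contour} {T : H →L[ℂ] H} (hT : ∀ z ∈ C.trace, z ∉ spectrum ℂ T)
    (hC : ∀ w ∈ spectrum ℂ T, C.windingNumber w = 1) :
    C.integral (resolvent T) = (2 * Real.pi * Complex.I : ℂ) • (1 : H →L[ℂ] H) := by
  have hlim := spectrum.resolvent_tendsto_cobounded T (𝕜 := ℂ)
  rw [← sub_eq_zero, ← norm_eq_zero]
  refine le_antisymm (le_of_forall_pos_le_add fun ε hε => ?_) (norm_nonneg _)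
  obtain ⟨η, hη, hηε⟩ : ∃ η : ℝ, 0 < η ∧ 2 * Real.pi * (‖T‖ * η) ≤ ε := by
    refine ⟨ε / (2 * Real.pi * (‖T‖ + 1)), by positivity, ?_⟩
    rw [mul_div, ← mul_div_assoc, div_le_iff₀ (by positivity)]
    nlinarith [mul_pos Real.pi_pos hε, norm_nonneg T]
  obtain ⟨R₀, hR₀⟩ : ∃ R₀ : ℝ, ∀ z : ℂ, R₀ < ‖z‖ → ‖resolvent T z‖ < η := by
    have h1 := hlim.norm.eventually (gt_mem_nhds (by rwa [norm_zero] : ‖(0 : H →L[ℂ] H)‖ < η))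
    rw [← comap_norm_atTop, eventually_comap] at h1
    obtain ⟨R₀, h2⟩ := (h1.and (eventually_gt_atTop 0)).exists_forall_of_atTop
    exact ⟨R₀, fun z hz => (h2 _ hz.le).1 z rfl⟩
  set R := max (max R₀ (‖T‖ * ‖(1 : H →L[ℂ] H)‖)) 0 + 1 with hR
  have hR1 : R₀ < R := by
    have := (le_max_left R₀ (‖T‖ * ‖(1 : H →L[ℂ] H)‖)).trans (le_max_left _ 0)
    linarith
  have hR2 : ‖T‖ * ‖(1 : H →L[ℂ] H)‖ < R := by
    have := (le_max_right R₀ (‖T‖ * ‖(1 : H →L[ℂ] H)‖)).trans (le_max_left _ 0)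
    linarith
  have hR3 : 0 < R := by
    have := le_max_right (max R₀ (‖T‖ * ‖(1 : H →L[ℂ] H)‖)) 0
    linarith
  have hσ : ∀ w ∈ spectrum ℂ T, ‖w‖ < R := fun w hw =>
    (spectrum.norm_le_norm_mul_of_mem hw).trans_lt hR2
  have htr : ∀ z ∈ (Contour.circleContour R).trace, ‖z‖ = R := fun z hz =>
    Contour.trace_circleContour hR3.le hz
  have htrσ : ∀ z ∈ (Contour.circleContour R).trace, z ∉ spectrum ℂ T := fun z hz hz' =>
    (hσ z hz').ne (htr z hz)
  have hz0 : ∀ z : ℂ, ‖z‖ = R → z ≠ 0 := fun z hz h0 => by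
    rw [h0, norm_zero] at hz
    exact hR3.ne hz
  rw [C.integral_eq_of_windingNumber_eq (Contour.circleContour R)
    (spectrum.isClosed T).isOpen_compl hT htrσ (fun w hw => ?_) (differentiableOn_resolvent T)]
  swap
  · rw [Set.notMem_compl_iff] at hw
    rw [hC w hw, Contour.windingNumber_circleContour (hσ w hw)]
  have h0tr : (0 : ℂ) ∉ (Contour.circleContour R).trace := fun h => hz0 0 (htr 0 h) rfl
  have hinv : (Contour.circleContour R).integral (fun z => (z - 0)⁻¹ • (1 : H →L[ℂ] H)) =
      (2 * Real.pi * Complex.I : ℂ) • (1 : H →L[ℂ] H) := by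
    rw [Contour.integral_smul_const, Contour.integral_inv_sub,
      Contour.windingNumber_circleContour (by rwa [norm_zero]), mul_one]
  rw [← hinv, ← Contour.integral_sub _ (G := fun z => (z - 0)⁻¹ • (1 : H →L[ℂ] H))
      (continuousOn_resolvent_trace htrσ)
    ((Contour.continuousOn_inv_sub _ h0tr).smul continuousOn_const),
    Contour.integral_circleContour, zero_add]
  refine (circleIntegral.norm_integral_le_of_norm_le_const (C := R⁻¹ * (‖T‖ * η)) hR3.le
    fun z hz => ?_).trans ?_
  · rw [mem_sphere_zero_iff_norm] at hz
    have hzσ : z ∉ spectrum ℂ T := fun hz' => (hσ z hz').ne hz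
    have e : resolvent T z - (z - 0)⁻¹ • (1 : H →L[ℂ] H) = z⁻¹ • (T * resolvent T z) := by
      have := sub_mul_resolvent hzσ 0
      rw [map_zero, sub_zero, sub_zero] at this
      rw [this, smul_sub, smul_smul, inv_mul_cancel₀ (hz0 z hz), one_smul, sub_zero]
    rw [e, norm_smul, norm_inv, hz]
    refine mul_le_mul_of_nonneg_left ?_ (inv_nonneg.2 hR3.le)
    exact (norm_mul_le _ _).trans
      (mul_le_mul_of_nonneg_left (hR₀ z (by rwa [hz])).le (norm_nonneg _))
  · calc 2 * Real.pi * R * (R⁻¹ * (‖T‖ * η)) = 2 * Real.pi * (‖T‖ * η) := by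
          field_simp
      _ ≤ ε := hηε

/-- One half of the spectral mapping theorem: `f(T) - f(w) = (T - w) g(T)`, where `g` is the
difference quotient of `f` at `w`. -/
theorem mem_spectrum_cauchyIntegral {f : ℂ → ℂ} {T : H →L[ℂ] H} {C : Contour}
    (hf : AnalyticOnNhd ℂ f (spectrum ℂ T)) (hC : C.IsAdmissible f (spectrum ℂ T)) {w : ℂ}
    (hw : w ∈ spectrum ℂ T) : f w ∈ spectrum ℂ (cauchyIntegral C f T) := by
  have hg : DifferentiableOn ℂ (dslope f w) {z | AnalyticAt ℂ f z} :=
    (Complex.differentiableOn_dslope ((isOpen_analyticAt ℂ f).mem_nhds (hf w hw))).2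
      (Contour.differentiableOn_analyticAt f)
  have hgc : ContinuousOn (dslope f w) C.trace := hg.continuousOn.mono hC.analyticAt
  have hR := continuousOn_resolvent_trace hC.avoids
  have hcomm : Commute (T - algebraMap ℂ (H →L[ℂ] H) w) (cauchyIntegral C (dslope f w) T) :=
    commute_cauchyIntegral hgc hC.avoids
      ((Commute.refl T).sub_left (Algebra.commute_algebraMap_left w T))
  have key : (T - algebraMap ℂ (H →L[ℂ] H) w) * cauchyIntegral C (dslope f w) T =
      cauchyIntegral C f T - algebraMap ℂ (H →L[ℂ] H) (f w) := by
    have h1 : (T - algebraMap ℂ (H →L[ℂ] H) w) * C.integral (fun z => dslope f w z • resolvent T z)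
        = C.integral fun z => (f z • resolvent T z - f w • resolvent T z) - dslope f w z • 1 := by
      rw [← ContinuousLinearMap.mul_apply' ℂ (H →L[ℂ] H),
        ← C.integral_clm _ (F := fun z => dslope f w z • resolvent T z) (hgc.smul hR)]
      refine C.integral_congr fun z hz => ?_
      rw [ContinuousLinearMap.mul_apply', mul_smul_comm, sub_mul_resolvent (hC.avoids z hz),
        smul_sub, smul_smul, ← sub_smul, mul_comm, ← smul_eq_mul (z - w), sub_smul_dslope]
    have h2 : C.integral (fun z => f z • resolvent T z - f w • resolvent T z - dslope f w z • 1) =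
        C.integral (fun z => f z • resolvent T z) - f w • C.integral (resolvent T) := by
      have c1 : ContinuousOn (fun z => f z • resolvent T z) C.trace := hC.continuousOn.smul hR
      have c2 : ContinuousOn (fun z => f w • resolvent T z) C.trace := hR.const_smul (f w)
      have c3 : ContinuousOn (fun z => dslope f w z • (1 : H →L[ℂ] H)) C.trace :=
        hgc.smul continuousOn_const
      have c12 : ContinuousOn (fun z => f z • resolvent T z - f w • resolvent T z) C.trace :=
        c1.sub c2
      rw [C.integral_sub c12 c3, C.integral_sub c1 c2, C.integral_smul_const,
        C.integral_const_smul, C.integral_eq_zero_of_differentiableOn (isOpen_analyticAt ℂ f)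
          hC.analyticAt hC.winding_zero hg, zero_smul, sub_zero]
    rw [cauchyIntegral, mul_smul_comm, h1, h2, integral_resolvent hC.avoids hC.winding_one,
      smul_sub, smul_comm (f w), smul_smul, inv_mul_cancel₀ Complex.two_pi_I_ne_zero, one_smul,
      cauchyIntegral, Algebra.algebraMap_eq_smul_one]
  rw [spectrum.mem_iff, IsUnit.sub_iff, ← key, hcomm.isUnit_mul_iff]
  rw [spectrum.mem_iff, IsUnit.sub_iff] at hw
  exact fun h => hw h.1

end FunctionalCalculus

/-! ### Integration with respect to a spectral measure -/

namespace SpectralMeasure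

open MeasureTheory (SimpleFunc)

variable {H : Type*} [NormedAddCommGroup H] [InnerProductSpace ℂ H] (E : SpectralMeasure H)

theorem mul_self {A : Set ℂ} (hA : MeasurableSet A) : E.E A * E.E A = E.E A := by
  rw [← E.inter A A hA hA, Set.inter_self]

theorem commute {A B : Set ℂ} (hA : MeasurableSet A) (hB : MeasurableSet B) :
    Commute (E.E A) (E.E B) := by
  rw [commute_iff_eq, ← E.inter A B hA hB, ← E.inter B A hB hA, Set.inter_comm]

theorem union {A B : Set ℂ} (hA : MeasurableSet A) (hB : MeasurableSet B) (h : Disjoint A B) :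
    E.E (A ∪ B) = E.E A + E.E B := by
  ext x
  have hU : (⋃ n : ℕ, Nat.casesOn n A fun m => Nat.casesOn m B fun _ => (∅ : Set ℂ)) = A ∪ B := by
    ext z
    simp only [Set.mem_iUnion, Set.mem_union]
    constructor
    · rintro ⟨_ | _ | n, hn⟩
      · exact Or.inl hn
      · exact Or.inr hn
      · exact absurd hn (Set.notMem_empty z)
    · rintro (hz | hz)
      · exact ⟨0, hz⟩
      · exact ⟨1, hz⟩
  have h1 := E.hasSum
    (fun n : ℕ => Nat.casesOn n A fun m => Nat.casesOn m B fun _ => (∅ : Set ℂ)) (fun n => by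
      rcases n with _ | _ | n
      · exact hA
      · exact hB
      · exact MeasurableSet.empty) (fun m n hmn => by
      rcases m with _ | _ | m <;> rcases n with _ | _ | n <;>
        first
        | exact absurd rfl hmn
        | exact h
        | exact h.symm
        | exact Set.disjoint_empty _
        | exact Set.empty_disjoint _) x
  rw [hU] at h1
  refine h1.unique ?_
  have h2 := hasSum_sum_of_ne_finset_zero (s := Finset.range 2) (L := .unconditional ℕ)
    (f := fun n : ℕ =>
      E.E (Nat.casesOn n A fun m => Nat.casesOn m B fun _ => (∅ : Set ℂ)) x) fun n hn => by
      rcases n with _ | _ | n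
      · simp at hn
      · simp at hn
      · simp [E.empty]
  simpa [Finset.sum_range_succ] using h2

theorem compl {A : Set ℂ} (hA : MeasurableSet A) : E.E Aᶜ = 1 - E.E A := by
  rw [eq_sub_iff_add_eq', ← E.union hA hA.compl disjoint_compl_right, Set.union_compl_self, E.univ]

theorem null_mono {A B : Set ℂ} (hA : MeasurableSet A) (hB : MeasurableSet B) (hBA : B ⊆ A)
    (h : E.E A = 0) : E.E B = 0 := by
  rw [← Set.inter_eq_left.2 hBA, E.inter B A hB hA, h, mul_zero]

theorem null_union {A B : Set ℂ} (hA : MeasurableSet A) (hB : MeasurableSet B)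
    (h : E.E A = 0) (h' : E.E B = 0) : E.E (A ∪ B) = 0 := by
  rw [← Set.union_sdiff_self, E.union hA (hB.diff hA) Set.disjoint_sdiff_right, h,
    E.null_mono hB (hB.diff hA) Set.sdiff_subset h', add_zero]

theorem null_iUnion {A : ℕ → Set ℂ} (hA : ∀ n, MeasurableSet (A n)) (h : ∀ n, E.E (A n) = 0) :
    E.E (⋃ n, A n) = 0 := by
  ext x
  have h1 := E.hasSum (disjointed A) (fun n => MeasurableSet.disjointed hA n)
    (disjoint_disjointed A) x
  have h2 : ∀ n, E.E (disjointed A n) = 0 := fun n =>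
    E.null_mono (hA n) (MeasurableSet.disjointed hA n) (disjointed_subset A n) (h n)
  simp only [h2, iUnion_disjointed] at h1
  exact h1.unique (by simp)

theorem preimage_finset {β : Type*} (χ : SimpleFunc ℂ β) (s : Finset β) :
    E.E (χ ⁻¹' s) = ∑ b ∈ s, E.E (χ ⁻¹' {b}) := by
  classical
  induction s using Finset.induction_on with
  | empty => simp [E.empty]
  | insert a s ha ih =>
    rw [Finset.sum_insert ha, ← ih, Finset.coe_insert, Set.insert_eq, Set.preimage_union]
    refine E.union (χ.measurableSet_preimage _) (χ.measurableSet_preimage _)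
      (Disjoint.preimage _ ?_)
    simpa using ha

theorem mul_preimage_singleton {β : Type*} (χ : SimpleFunc ℂ β) {b c : β} (h : b ≠ c) :
    E.E (χ ⁻¹' {b}) * E.E (χ ⁻¹' {c}) = 0 := by
  rw [← E.inter _ _ (χ.measurableSet_preimage _) (χ.measurableSet_preimage _),
    ← Set.preimage_inter, Set.singleton_inter_eq_empty.2 (by simpa using h), Set.preimage_empty,
    E.empty]

theorem simpleIntegral_map {β : Type*} (χ : SimpleFunc ℂ β) (k : β → ℂ) :
    E.simpleIntegral (χ.map k) = ∑ b ∈ χ.range, k b • E.E (χ ⁻¹' {b}) := by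
  classical
  rw [simpleIntegral, SimpleFunc.range_map]
  simp only [SimpleFunc.map_preimage_singleton, E.preimage_finset, Finset.smul_sum]
  rw [← Finset.sum_fiberwise_of_maps_to (g := k) (t := χ.range.image k)
    fun b hb => Finset.mem_image_of_mem k hb]
  refine Finset.sum_congr rfl fun z _ => Finset.sum_congr rfl fun b hb => ?_
  rw [(Finset.mem_filter.1 hb).2]

theorem simpleIntegral_mul (φ ψ : SimpleFunc ℂ ℂ) :
    E.simpleIntegral (φ * ψ) = E.simpleIntegral φ * E.simpleIntegral ψ := by
  classical
  have h1 : E.simpleIntegral φ = E.simpleIntegral ((φ.pair ψ).map Prod.fst) := rfl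
  have h2 : E.simpleIntegral ψ = E.simpleIntegral ((φ.pair ψ).map Prod.snd) := rfl
  rw [h1, h2, SimpleFunc.mul_eq_map₂, simpleIntegral_map, simpleIntegral_map, simpleIntegral_map,
    Finset.sum_mul_sum]
  refine Finset.sum_congr rfl fun b hb => ?_
  rw [Finset.sum_eq_single b]
  · rw [smul_mul_smul_comm, E.mul_self ((φ.pair ψ).measurableSet_preimage _)]
  · intro c _ hc
    rw [smul_mul_smul_comm, E.mul_preimage_singleton _ hc.symm, smul_zero]
  · exact fun h => absurd hb h

theorem simpleIntegral_sub (φ ψ : SimpleFunc ℂ ℂ) :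
    E.simpleIntegral (φ - ψ) = E.simpleIntegral φ - E.simpleIntegral ψ := by
  have h1 : E.simpleIntegral φ = E.simpleIntegral ((φ.pair ψ).map Prod.fst) := rfl
  have h2 : E.simpleIntegral ψ = E.simpleIntegral ((φ.pair ψ).map Prod.snd) := rfl
  have h3 : φ - ψ = (φ.pair ψ).map fun p => p.1 - p.2 := rfl
  rw [h1, h2, h3, simpleIntegral_map, simpleIntegral_map, simpleIntegral_map,
    ← Finset.sum_sub_distrib]
  simp only [sub_smul]

theorem simpleIntegral_add (φ ψ : SimpleFunc ℂ ℂ) :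
    E.simpleIntegral (φ + ψ) = E.simpleIntegral φ + E.simpleIntegral ψ := by
  have h1 : E.simpleIntegral φ = E.simpleIntegral ((φ.pair ψ).map Prod.fst) := rfl
  have h2 : E.simpleIntegral ψ = E.simpleIntegral ((φ.pair ψ).map Prod.snd) := rfl
  rw [h1, h2, SimpleFunc.add_eq_map₂, simpleIntegral_map, simpleIntegral_map, simpleIntegral_map,
    ← Finset.sum_add_distrib]
  simp only [add_smul]

theorem simpleIntegral_const (c : ℂ) :
    E.simpleIntegral (SimpleFunc.const ℂ c) = c • (1 : H →L[ℂ] H) := by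
  rw [simpleIntegral, SimpleFunc.range_const, Finset.sum_singleton,
    Set.eq_univ_of_forall (s := SimpleFunc.const ℂ c ⁻¹' {c}) fun _ => rfl, E.univ]

/-- The indicator function of a Borel set, as a simple function. -/
def indicatorFunc {A : Set ℂ} (hA : MeasurableSet A) : SimpleFunc ℂ ℂ :=
  SimpleFunc.piecewise A hA (SimpleFunc.const ℂ 1) (SimpleFunc.const ℂ 0)

theorem simpleIntegral_indicatorFunc {A : Set ℂ} (hA : MeasurableSet A) :
    E.simpleIntegral (indicatorFunc hA) = E.E A := by
  classical
  have hsub : (indicatorFunc hA).range ⊆ {0, 1} := by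
    intro z hz
    obtain ⟨w, rfl⟩ := SimpleFunc.mem_range.1 hz
    by_cases hw : w ∈ A <;> simp [indicatorFunc, hw]
  have hpre : indicatorFunc hA ⁻¹' {1} = A := by
    ext w
    by_cases hw : w ∈ A <;> simp [indicatorFunc, hw]
  rw [simpleIntegral, Finset.sum_subset hsub]
  · rw [Finset.sum_pair zero_ne_one, zero_smul, zero_add, one_smul, hpre]
  · intro z _ hz
    rw [SimpleFunc.mem_range] at hz
    rw [Set.preimage_singleton_eq_empty.2 hz, E.empty, smul_zero]

/-- Commuting with the values of a spectral measure passes to the integrals. -/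
theorem commute_simpleIntegral {X : H →L[ℂ] H}
    (h : ∀ A, MeasurableSet A → Commute X (E.E A)) (φ : SimpleFunc ℂ ℂ) :
    Commute X (E.simpleIntegral φ) :=
  Commute.sum_right _ _ _ fun z _ => (h _ (φ.measurableSet_preimage _)).smul_right z

/-! ### Boundedness -/

/-- The signed measure `A ↦ L (E(A) x)`. -/
def signedMeasure (L : H →L[ℝ] ℝ) (x : H) : MeasureTheory.SignedMeasure ℂ where
  measureOf' A := by
    classical
    exact if MeasurableSet A then L (E.E A x) else 0
  empty' := by simp [E.empty]
  not_measurable' A hA := if_neg hA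
  m_iUnion' A hA hd := by
    simp only [hA, MeasurableSet.iUnion hA, if_true]
    exact (E.hasSum A hA hd x).mapL L

theorem exists_sum_abs_le (L : H →L[ℝ] ℝ) (x : H) :
    ∃ B : ℝ, ∀ φ : SimpleFunc ℂ ℂ, ∑ z ∈ φ.range, |L (E.E (φ ⁻¹' {z}) x)| ≤ B := by
  refine ⟨(E.signedMeasure L x).totalVariation.real Set.univ, fun φ => ?_⟩
  calc ∑ z ∈ φ.range, |L (E.E (φ ⁻¹' {z}) x)|
      ≤ ∑ z ∈ φ.range, (E.signedMeasure L x).totalVariation.real (φ ⁻¹' {z}) := by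
        refine Finset.sum_le_sum fun z _ => ?_
        have h := (E.signedMeasure L x).norm_le_totalVariation (φ ⁻¹' {z})
        have e : E.signedMeasure L x (φ ⁻¹' {z}) = L (E.E (φ ⁻¹' {z}) x) :=
          if_pos (φ.measurableSet_preimage _)
        rwa [e] at h
    _ = (E.signedMeasure L x).totalVariation.real (φ ⁻¹' φ.range) :=
        MeasureTheory.sum_measureReal_preimage_singleton _
          fun z _ => φ.measurableSet_preimage _
    _ ≤ (E.signedMeasure L x).totalVariation.real Set.univ :=
        MeasureTheory.measureReal_mono (Set.subset_univ _)

variable [CompleteSpace H]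

/-- The integrals of the simple functions bounded by `1` are uniformly bounded: the scalar measures
`⟪E(·) x, y⟫` have finite total variation, and the principle of uniform boundedness applies. -/
theorem exists_norm_simpleIntegral_le_of_norm_le_one :
    ∃ M : ℝ, ∀ φ : SimpleFunc ℂ ℂ, (∀ z, ‖φ z‖ ≤ 1) → ‖E.simpleIntegral φ‖ ≤ M := by
  have hweak : ∀ x y : H, ∃ B : ℝ, ∀ φ : {φ : SimpleFunc ℂ ℂ // ∀ z, ‖φ z‖ ≤ 1},
      ‖inner ℂ y (E.simpleIntegral φ x)‖ ≤ B := by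
    intro x y
    obtain ⟨B₁, hB₁⟩ :=
      E.exists_sum_abs_le (Complex.reCLM.comp ((innerSL ℂ y).restrictScalars ℝ)) x
    obtain ⟨B₂, hB₂⟩ :=
      E.exists_sum_abs_le (Complex.imCLM.comp ((innerSL ℂ y).restrictScalars ℝ)) x
    refine ⟨B₁ + B₂, fun φ => ?_⟩
    have e : inner ℂ y (E.simpleIntegral φ x) =
        ∑ z ∈ φ.1.range, z * inner ℂ y (E.E (φ.1 ⁻¹' {z}) x) := by
      simp [simpleIntegral]
    rw [e]
    refine (norm_sum_le _ _).trans ((Finset.sum_le_sum fun z hz => ?_).trans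
      (Finset.sum_add_distrib.trans_le (add_le_add (hB₁ φ.1) (hB₂ φ.1))))
    obtain ⟨w, rfl⟩ := SimpleFunc.mem_range.1 hz
    rw [norm_mul]
    exact (mul_le_of_le_one_left (norm_nonneg _) (φ.2 w)).trans
      (Complex.norm_le_abs_re_add_abs_im _)
  have hstrong : ∀ x : H, ∃ B : ℝ, ∀ φ : {φ : SimpleFunc ℂ ℂ // ∀ z, ‖φ z‖ ≤ 1},
      ‖E.simpleIntegral φ x‖ ≤ B := by
    intro x
    obtain ⟨B, hB⟩ := banach_steinhaus
      (g := fun φ : {φ : SimpleFunc ℂ ℂ // ∀ z, ‖φ z‖ ≤ 1} =>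
        innerSL ℂ (E.simpleIntegral φ x)) fun y => by
      obtain ⟨B, hB⟩ := hweak x y
      refine ⟨B, fun φ => ?_⟩
      rw [innerSL_apply_apply, norm_inner_symm]
      exact hB φ
    exact ⟨B, fun φ => by simpa only [innerSL_apply_norm] using hB φ⟩
  obtain ⟨M, hM⟩ := banach_steinhaus hstrong
  exact ⟨M, fun φ hφ => hM ⟨φ, hφ⟩⟩

/-- The integral of a simple function is bounded by its essential supremum. -/
theorem exists_norm_simpleIntegral_le :
    ∃ M : ℝ, 0 < M ∧ ∀ (φ : SimpleFunc ℂ ℂ) (c : ℝ), 0 < c → E.E {z | c < ‖φ z‖} = 0 →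
      ‖E.simpleIntegral φ‖ ≤ M * c := by
  classical
  obtain ⟨M, hM⟩ := E.exists_norm_simpleIntegral_le_of_norm_le_one
  refine ⟨max M 1, by positivity, fun φ c hc h => ?_⟩
  -- `φ = c k(φ)` up to a null set, and `k` is bounded by `1` everywhere
  set k : ℂ → ℂ := fun z => if ‖z‖ ≤ c then (c : ℂ)⁻¹ * z else 0 with hk
  have e : E.simpleIntegral φ = (c : ℂ) • E.simpleIntegral (φ.map k) := by
    rw [simpleIntegral_map, Finset.smul_sum]
    refine Finset.sum_congr rfl fun z _ => ?_
    by_cases hz : ‖z‖ ≤ c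
    · have hkz : k z = (c : ℂ)⁻¹ * z := if_pos hz
      rw [hkz, smul_smul, mul_inv_cancel_left₀ (Complex.ofReal_ne_zero.2 hc.ne')]
    · have hm : MeasurableSet {z | c < ‖φ z‖} :=
        measurableSet_lt measurable_const φ.measurable.norm
      rw [E.null_mono hm (φ.measurableSet_preimage _) (fun w hw => ?_) h, smul_zero, smul_zero,
        smul_zero]
      have hw' : φ w = z := hw
      simpa [hw'] using hz
  rw [e, norm_smul, Complex.norm_real, Real.norm_of_nonneg hc.le, mul_comm]
  refine mul_le_mul_of_nonneg_right ((hM _ fun z => ?_).trans (le_max_left _ _)) hc.le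
  by_cases hz : ‖φ z‖ ≤ c
  · rw [SimpleFunc.map_apply, hk]
    simp only [if_pos hz, norm_mul, norm_inv, Complex.norm_real, Real.norm_of_nonneg hc.le]
    rwa [inv_mul_le_iff₀ hc, mul_one]
  · rw [SimpleFunc.map_apply, hk]
    simp [if_neg hz]

end SpectralMeasure

namespace SpectralMeasure

open MeasureTheory (SimpleFunc)

variable {H : Type*} [NormedAddCommGroup H] [InnerProductSpace ℂ H] (E : SpectralMeasure H)

theorem measurableSet_le_norm_sub (φ : SimpleFunc ℂ ℂ) {g : ℂ → ℂ} (hg : Measurable g) (ε : ℝ) :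
    MeasurableSet {z | ε ≤ ‖φ z - g z‖} :=
  measurableSet_le measurable_const (φ.measurable.sub hg).norm

theorem simpleIntegral_congr [CompleteSpace H] {N : Set ℂ} (hN : MeasurableSet N) (h : E.E N = 0)
    {φ ψ : SimpleFunc ℂ ℂ} (hφ : ∀ z ∉ N, φ z = ψ z) :
    E.simpleIntegral φ = E.simpleIntegral ψ := by
  obtain ⟨M, hM, hb⟩ := E.exists_norm_simpleIntegral_le
  rw [← sub_eq_zero, ← simpleIntegral_sub, ← norm_eq_zero]
  refine le_antisymm (le_of_forall_pos_le_add fun ε hε => ?_) (norm_nonneg _)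
  refine (hb _ (ε / M) (by positivity) ?_).trans (by rw [mul_div_cancel₀ _ hM.ne', zero_add])
  refine E.null_mono hN (measurableSet_lt measurable_const (φ - ψ).measurable.norm)
    (fun z hz => by_contra fun hzN => ?_) h
  have hz' : ε / M < ‖φ z - ψ z‖ := hz
  rw [hφ z hzN, sub_self, norm_zero] at hz'
  exact absurd hz' (by positivity : (0 : ℝ) ≤ ε / M).not_gt

/-! ### Integrals of Borel functions -/

/-- `A = ∫ g(z) E(dz)`: there are simple functions converging to `g` uniformly up to `E`-null sets
whose integrals converge to `A` in norm. -/
def HasIntegralOf (g : ℂ → ℂ) (A : H →L[ℂ] H) : Prop :=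
  ∃ φ : ℕ → SimpleFunc ℂ ℂ,
    (∀ ε : ℝ, 0 < ε → ∀ᶠ n in atTop, E.E {z | ε ≤ ‖φ n z - g z‖} = 0) ∧
      Tendsto (fun n => E.simpleIntegral (φ n)) atTop (𝓝 A)

variable {E} {g : ℂ → ℂ} {A : H →L[ℂ] H}

theorem HasIntegralOf.commute (h : E.HasIntegralOf g A) {B : Set ℂ} (hB : MeasurableSet B) :
    Commute (E.E B) A := by
  obtain ⟨φ, -, hφ⟩ := h
  refine tendsto_nhds_unique (hφ.const_mul (E.E B)) ?_
  have h1 : ∀ n, E.E B * E.simpleIntegral (φ n) = E.simpleIntegral (φ n) * E.E B := fun n =>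
    E.commute_simpleIntegral (fun C hC => E.commute hB hC) (φ n)
  simp only [h1]
  exact hφ.mul_const (E.E B)

/-- On the range of `E(g⁻¹(δ))` the operator `∫ g dE` has no spectrum outside the closure of `δ`.
The inverse of `w - ∫ φ dE`, for a simple function `φ` close to `g`, is bounded independently of
`φ`, so that invertibility survives in the limit. -/
theorem HasIntegralOf.isUnit [CompleteSpace H] (h : E.HasIntegralOf g A) (hg : Measurable g)
    {δ : Set ℂ} (hδ : MeasurableSet δ) {w : ℂ} (hw : w ∉ closure δ) :
    IsUnit ((w • (1 : H →L[ℂ] H) - A) * E.E (g ⁻¹' δ) + (1 - E.E (g ⁻¹' δ))) := by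
  obtain ⟨φ, hφ, hlim⟩ := h
  obtain ⟨M, hM, hb⟩ := E.exists_norm_simpleIntegral_le
  obtain ⟨r, hr, hrδ⟩ : ∃ r > 0, ∀ z ∈ δ, r ≤ ‖w - z‖ := by
    rw [Metric.mem_closure_iff] at hw
    push Not at hw
    simpa only [dist_eq_norm] using hw
  have hD : MeasurableSet (g ⁻¹' δ) := hg hδ
  set c : ℝ := max (2 / r) 1 with hc
  have hc0 : 0 < c := lt_max_of_lt_right one_pos
  -- the simple functions that are `w - φ` on `g⁻¹(δ)` and `1` elsewhere
  set ξ : ℕ → SimpleFunc ℂ ℂ := fun n =>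
    (SimpleFunc.const ℂ w - φ n) * indicatorFunc hD + (SimpleFunc.const ℂ 1 - indicatorFunc hD)
    with hξ
  have hξint : ∀ n, E.simpleIntegral (ξ n) =
      (w • (1 : H →L[ℂ] H) - E.simpleIntegral (φ n)) * E.E (g ⁻¹' δ) +
        (1 - E.E (g ⁻¹' δ)) := by
    intro n
    rw [hξ, simpleIntegral_add, simpleIntegral_mul, simpleIntegral_sub, simpleIntegral_sub,
      simpleIntegral_const, simpleIntegral_const, simpleIntegral_indicatorFunc, one_smul]
  have hξlim : Tendsto (fun n => E.simpleIntegral (ξ n)) atTop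
      (𝓝 ((w • (1 : H →L[ℂ] H) - A) * E.E (g ⁻¹' δ) + (1 - E.E (g ⁻¹' δ)))) := by
    simp only [hξint]
    exact ((tendsto_const_nhds.sub hlim).mul_const _).add_const _
  have hclose := (Metric.tendsto_nhds.1 hξlim) (1 / (M * c)) (by positivity)
  obtain ⟨n, hn, hnull⟩ := (hclose.and (hφ (r / 2) (by positivity))).exists
  set X := (w • (1 : H →L[ℂ] H) - A) * E.E (g ⁻¹' δ) + (1 - E.E (g ⁻¹' δ)) with hX
  have hNm : MeasurableSet {z | r / 2 ≤ ‖φ n z - g z‖} := measurableSet_le_norm_sub _ hg _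
  have hgood : ∀ z ∉ {z | r / 2 ≤ ‖φ n z - g z‖}, c⁻¹ ≤ ‖ξ n z‖ := by
    intro z hz
    have hz' : ‖φ n z - g z‖ < r / 2 := not_le.1 hz
    by_cases hzD : z ∈ g ⁻¹' δ
    · have e : ξ n z = w - φ n z := by simp [hξ, indicatorFunc, hzD]
      have h1 := hrδ _ hzD
      have h2 : ‖w - g z‖ ≤ ‖w - φ n z‖ + ‖φ n z - g z‖ := norm_sub_le_norm_sub_add_norm_sub _ _ _
      have h3 : r / 2 ≤ ‖w - φ n z‖ := by linarith
      rw [e]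
      refine le_trans ?_ h3
      rw [inv_le_comm₀ hc0 (by positivity), inv_div]
      exact le_max_left _ _
    · have e : ξ n z = 1 := by simp [hξ, indicatorFunc, hzD]
      rw [e, norm_one]
      exact inv_le_one_of_one_le₀ (le_max_right _ _)
  set Y := E.simpleIntegral ((ξ n).map fun z => z⁻¹) with hY
  have hYn : ‖Y‖ ≤ M * c := by
    refine hb _ c hc0 (E.null_mono hNm
      (measurableSet_lt measurable_const (SimpleFunc.measurable _).norm) (fun z hz => ?_) hnull)
    by_contra hzN
    have h1 := hgood z hzN
    have h2 : c < ‖(ξ n z)⁻¹‖ := hz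
    rw [norm_inv] at h2
    have h3 : 0 < ‖ξ n z‖ := (by positivity : 0 < c⁻¹).trans_le h1
    rw [inv_le_comm₀ hc0 h3] at h1
    exact absurd h2 h1.not_gt
  have hξY : E.simpleIntegral (ξ n) * Y = 1 := by
    rw [hY, ← simpleIntegral_mul, ← one_smul ℂ (1 : H →L[ℂ] H), ← E.simpleIntegral_const]
    refine E.simpleIntegral_congr hNm hnull fun z hz => ?_
    have h1 : ξ n z ≠ 0 := fun h0 => by
      have := hgood z hz
      rw [h0, norm_zero] at this
      exact absurd this (by positivity : 0 < c⁻¹).not_ge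
    exact mul_inv_cancel₀ h1
  have hYξ : Y * E.simpleIntegral (ξ n) = 1 := by
    rw [hY, ← simpleIntegral_mul, mul_comm, simpleIntegral_mul, ← hY, hξY]
  have hXe : X = E.simpleIntegral (ξ n) * (1 - Y * (E.simpleIntegral (ξ n) - X)) := by
    rw [mul_sub, ← mul_assoc, hξY]
    simp
  rw [hXe]
  refine IsUnit.mul ⟨⟨_, Y, hξY, hYξ⟩, rfl⟩ (isUnit_one_sub_of_norm_lt_one ?_)
  rw [dist_eq_norm] at hn
  calc ‖Y * (E.simpleIntegral (ξ n) - X)‖ ≤ ‖Y‖ * ‖E.simpleIntegral (ξ n) - X‖ := norm_mul_le _ _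
    _ ≤ M * c * ‖E.simpleIntegral (ξ n) - X‖ := mul_le_mul_of_nonneg_right hYn (norm_nonneg _)
    _ < M * c * (1 / (M * c)) := mul_lt_mul_of_pos_left hn (by positivity)
    _ = 1 := mul_one_div_cancel (by positivity)

theorem HasIntegralOf.spectrum_subset [CompleteSpace H] (h : E.HasIntegralOf g A)
    (hg : Measurable g) {K : Set ℂ} (hK : IsClosed K) (hgK : E.E (g ⁻¹' K)ᶜ = 0) :
    spectrum ℂ A ⊆ K := by
  intro w hw
  by_contra hwK
  have hu := h.isUnit hg hK.measurableSet (w := w) (by rwa [hK.closure_eq])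
  have h1 : E.E (g ⁻¹' K) = 1 := by
    rw [E.compl (hg hK.measurableSet), sub_eq_zero] at hgK
    exact hgK.symm
  rw [h1, mul_one, sub_self, add_zero, ← Algebra.algebraMap_eq_smul_one] at hu
  exact hw hu

/-- If `(w - A) P + (1 - P)`, which is `w - A` on the range of `P` and the identity on its kernel,
is invertible, then so is `w - A` on the range of `P`. -/
theorem notMem_spectrum_restrictToRange {P A : H →L[ℂ] H} (hP : P * P = P) (h : P * A = A * P)
    {w : ℂ} (hu : IsUnit ((w • (1 : H →L[ℂ] H) - A) * P + (1 - P))) :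
    w ∉ spectrum ℂ (restrictToRange P A h) := by
  obtain ⟨u, hu⟩ := hu
  have hPX : Commute P (u : H →L[ℂ] H) := by
    rw [hu]
    refine Commute.add_right (Commute.mul_right (Commute.sub_right ?_ h) (Commute.refl P))
      ((Commute.one_right P).sub_right (Commute.refl P))
    exact (Commute.one_right P).smul_right w
  have hPY : P * (↑u⁻¹ : H →L[ℂ] H) = (↑u⁻¹ : H →L[ℂ] H) * P := hPX.units_inv_right
  have hPr : ∀ y ∈ P.range, P y = y := by
    rintro _ ⟨x, rfl⟩
    exact DFunLike.congr_fun hP x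
  have hXr : ∀ y ∈ P.range, (u : H →L[ℂ] H) y = w • y - A y := by
    intro y hy
    rw [hu]
    simp [hPr y hy]
  rw [spectrum.mem_iff, not_not]
  refine spectrum.mem_resolventSet_of_left_right_inverse
    (b := restrictToRange P _ hPY) (c := restrictToRange P _ hPY) ?_ ?_
  · ext y
    have hy : (↑u⁻¹ : H →L[ℂ] H) y ∈ P.range := mem_range_of_comm hPY y y.2
    have h1 : w • (↑u⁻¹ : H →L[ℂ] H) y - A ((↑u⁻¹ : H →L[ℂ] H) y) = y := by
      rw [← hXr _ hy]
      exact DFunLike.congr_fun u.mul_inv (y : H)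
    exact h1
  · ext y
    have h1 : (↑u⁻¹ : H →L[ℂ] H) (w • (y : H) - A y) = y := by
      rw [← hXr _ y.2]
      exact DFunLike.congr_fun u.inv_mul (y : H)
    exact h1

variable (E) in
/-- The image of a spectral measure under a Borel function. -/
def pushforward (g : ℂ → ℂ) (hg : Measurable g) : SpectralMeasure H where
  E δ := E.E (g ⁻¹' δ)
  empty := E.empty
  univ := E.univ
  inter _ _ hδ hε := E.inter _ _ (hg hδ) (hg hε)
  hasSum δ hδ hd x := by
    rw [Set.preimage_iUnion]
    exact E.hasSum _ (fun n => hg (hδ n)) (fun i j hij => (hd hij).preimage g) x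

theorem HasIntegralOf.isResolutionOfIdentity_pushforward [CompleteSpace H]
    (h : E.HasIntegralOf g A) (hg : Measurable g) :
    (E.pushforward g hg).IsResolutionOfIdentity A := by
  intro δ hδ
  refine ⟨h.commute (hg hδ), fun w hw => by_contra fun hwδ => ?_⟩
  exact notMem_spectrum_restrictToRange (E.mul_self (hg hδ)) (h.commute (hg hδ))
    (h.isUnit hg hδ hwδ) hw

variable (E) in
theorem simpleIntegral_pushforward (hg : Measurable g) (ψ : SimpleFunc ℂ ℂ) :
    (E.pushforward g hg).simpleIntegral ψ = E.simpleIntegral (ψ.comp g hg) := by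
  rw [simpleIntegral, simpleIntegral,
    Finset.sum_subset (SimpleFunc.range_comp_subset_range ψ hg)]
  · rfl
  · intro z _ hz
    rw [SimpleFunc.mem_range] at hz
    rw [Set.preimage_singleton_eq_empty.2 hz, E.empty, smul_zero]

/-- On a compact set the identity is a uniform limit of simple functions. -/
theorem exists_simpleFunc_tendsto_id {K : Set ℂ} (hK : IsCompact K) :
    ∃ ψ : ℕ → SimpleFunc ℂ ℂ, ∀ ε : ℝ, 0 < ε → ∀ᶠ n in atTop, ∀ z ∈ K, ‖ψ n z - z‖ < ε := by
  refine ⟨SimpleFunc.nearestPt (TopologicalSpace.denseSeq ℂ), fun ε hε => ?_⟩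
  obtain ⟨t, ht⟩ := hK.elim_finite_subcover
    (fun k : ℕ => Metric.ball (TopologicalSpace.denseSeq ℂ k) ε) (fun _ => Metric.isOpen_ball)
    fun z _ => by
      obtain ⟨k, hk⟩ := (TopologicalSpace.denseRange_denseSeq ℂ).exists_dist_lt z hε
      exact Set.mem_iUnion.2 ⟨k, hk⟩
  filter_upwards [eventually_ge_atTop (t.sup id)] with n hn z hz
  obtain ⟨k, hk, hzk⟩ := Set.mem_iUnion₂.1 (ht hz)
  have h1 := SimpleFunc.edist_nearestPt_le (TopologicalSpace.denseSeq ℂ) z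
    ((Finset.le_sup (f := id) hk).trans hn)
  rw [edist_dist, edist_dist, ENNReal.ofReal_le_ofReal_iff dist_nonneg] at h1
  rw [← dist_eq_norm]
  exact h1.trans_lt (by rwa [Metric.mem_ball, dist_comm] at hzk)

/-- Change of variables: `∫ g dE = ∫ z E(g⁻¹(dz))`, for an essentially bounded function `g`. -/
theorem HasIntegralOf.hasIntegral_pushforward [CompleteSpace H] (h : E.HasIntegralOf g A)
    (hg : Measurable g) {K : Set ℂ} (hK : IsCompact K) (hgK : E.E (g ⁻¹' K)ᶜ = 0) :
    (E.pushforward g hg).HasIntegral A := by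
  obtain ⟨φ, hφ, hlim⟩ := h
  obtain ⟨M, hM, hb⟩ := E.exists_norm_simpleIntegral_le
  obtain ⟨ψ, hψ⟩ := exists_simpleFunc_tendsto_id hK
  have hKm : MeasurableSet (g ⁻¹' K)ᶜ := (hg hK.isClosed.measurableSet).compl
  refine ⟨ψ, fun ε hε => ?_, ?_⟩
  · filter_upwards [hψ ε hε] with n hn
    refine E.null_mono hKm (hg (measurableSet_le_norm_sub _ measurable_id ε)) (fun z hz hzK => ?_)
      hgK
    have hz' : ε ≤ ‖ψ n (g z) - g z‖ := hz
    exact absurd (hn _ hzK) hz'.not_gt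
  · simp only [simpleIntegral_pushforward]
    have hdiff : Tendsto (fun n => E.simpleIntegral ((ψ n).comp g hg) - E.simpleIntegral (φ n))
        atTop (𝓝 0) := by
      rw [Metric.tendsto_nhds]
      intro ε hε
      have hη : 0 < ε / (4 * M) := by positivity
      filter_upwards [hψ _ hη, hφ _ hη] with n h1 h2
      rw [dist_zero_right, ← simpleIntegral_sub]
      refine (hb _ (2 * (ε / (4 * M))) (by positivity) ?_).trans_lt ?_
      · refine E.null_mono (hKm.union (measurableSet_le_norm_sub (φ n) hg (ε / (4 * M))))
          (measurableSet_lt measurable_const (SimpleFunc.measurable _).norm) (fun z hz => ?_)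
          (E.null_union hKm (measurableSet_le_norm_sub (φ n) hg (ε / (4 * M))) hgK h2)
        by_contra hcon
        rw [Set.mem_union, not_or, Set.notMem_compl_iff] at hcon
        have h3 := h1 _ hcon.1
        have h4 : ‖φ n z - g z‖ < ε / (4 * M) := not_le.1 hcon.2
        have h5 : 2 * (ε / (4 * M)) < ‖ψ n (g z) - φ n z‖ := hz
        have h6 := norm_sub_le_norm_sub_add_norm_sub (ψ n (g z)) (g z) (φ n z)
        rw [norm_sub_rev (g z)] at h6
        linarith
      · have e : M * (2 * (ε / (4 * M))) = ε / 2 := by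
          field_simp
          ring
        linarith
    simpa using hdiff.add hlim

end SpectralMeasure

namespace SpectralMeasure

open MeasureTheory (SimpleFunc)

variable {H : Type*} [NormedAddCommGroup H] [InnerProductSpace ℂ H] [CompleteSpace H]
  {E : SpectralMeasure H} {S : H →L[ℂ] H}

/-! ### Analytic functions of operators of scalar type -/

/-- A point `w` outside the spectrum has a neighbourhood `B` that is null for the spectral measure:
`E(B) = (w - S)⁻¹ (w - S) E(B)` has norm less than `1` if `B` is small, and is idempotent. -/
theorem HasIntegral.exists_ball_null (h : E.HasIntegral S) {w : ℂ} (hw : w ∉ spectrum ℂ S) :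
    ∃ r > 0, E.E (Metric.ball w r) = 0 := by
  obtain ⟨φ, hφ, hlim⟩ := h
  obtain ⟨M, hM, hb⟩ := E.exists_norm_simpleIntegral_le
  set r : ℝ := 1 / (4 * M * (‖resolvent S w‖ + 1)) with hr
  have hr0 : 0 < r := by positivity
  refine ⟨r, hr0, ?_⟩
  have hB : MeasurableSet (Metric.ball w r) := Metric.isOpen_ball.measurableSet
  set P := E.E (Metric.ball w r) with hP
  have hle : ‖(w • (1 : H →L[ℂ] H) - S) * P‖ ≤ M * (2 * r) := by
    refine le_of_tendsto (((tendsto_const_nhds (x := w • (1 : H →L[ℂ] H))).sub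
      hlim).mul_const P).norm ?_
    filter_upwards [hφ r hr0] with n hn
    have e : (w • (1 : H →L[ℂ] H) - E.simpleIntegral (φ n)) * P =
        E.simpleIntegral ((SimpleFunc.const ℂ w - φ n) * indicatorFunc hB) := by
      rw [simpleIntegral_mul, simpleIntegral_sub, simpleIntegral_const,
        simpleIntegral_indicatorFunc]
    rw [e]
    refine hb _ _ (by positivity) (E.null_mono (measurableSet_le_norm_sub (φ n) measurable_id r)
      (measurableSet_lt measurable_const (SimpleFunc.measurable _).norm) (fun z hz => ?_) hn)
    by_contra hcon
    have h1 : ‖φ n z - z‖ < r := not_le.1 hcon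
    have h2 : 2 * r < ‖(w - φ n z) * indicatorFunc hB z‖ := hz
    by_cases hzB : z ∈ Metric.ball w r
    · have e1 : indicatorFunc hB z = 1 := by simp [indicatorFunc, hzB]
      rw [e1, mul_one] at h2
      have h3 := norm_sub_le_norm_sub_add_norm_sub w z (φ n z)
      rw [norm_sub_rev z] at h3
      rw [Metric.mem_ball, dist_comm, dist_eq_norm] at hzB
      linarith
    · have e1 : indicatorFunc hB z = 0 := by simp [indicatorFunc, hzB]
      rw [e1, mul_zero, norm_zero] at h2
      linarith
  have hPe : P = resolvent S w * ((w • (1 : H →L[ℂ] H) - S) * P) := by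
    rw [← mul_assoc, resolvent, ← Algebra.algebraMap_eq_smul_one,
      Ring.inverse_mul_cancel _ (spectrum.notMem_iff.1 hw), one_mul]
  have hlt : ‖P‖ < 1 := by
    calc ‖P‖ = ‖resolvent S w * ((w • (1 : H →L[ℂ] H) - S) * P)‖ := by rw [← hPe]
      _ ≤ ‖resolvent S w‖ * (M * (2 * r)) :=
        (norm_mul_le _ _).trans (mul_le_mul_of_nonneg_left hle (norm_nonneg _))
      _ = ‖resolvent S w‖ / (2 * (‖resolvent S w‖ + 1)) := by
        rw [hr]
        field_simp
        ring
      _ < 1 := by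
        rw [div_lt_one (by positivity)]
        linarith [norm_nonneg (resolvent S w)]
  have hsq : ‖P‖ ≤ ‖P‖ * ‖P‖ := by
    have hPP : P * P = P := E.mul_self hB
    simpa only [hPP] using norm_mul_le P P
  have : ‖P‖ = 0 := by
    nlinarith [norm_nonneg P]
  exact norm_eq_zero.1 this

theorem HasIntegral.null_compl_spectrum (h : E.HasIntegral S) : E.E (spectrum ℂ S)ᶜ = 0 := by
  have hσ : MeasurableSet (spectrum ℂ S)ᶜ := (spectrum.isClosed S).measurableSet.compl
  have hr : ∀ w, ∃ r : ℝ, w ∉ spectrum ℂ S → 0 < r ∧ E.E (Metric.ball w r) = 0 := by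
    intro w
    by_cases hw : w ∈ spectrum ℂ S
    · exact ⟨0, fun h => absurd hw h⟩
    · obtain ⟨r, hr⟩ := h.exists_ball_null hw
      exact ⟨r, fun _ => hr⟩
  choose r hr using hr
  obtain ⟨t, hts, htc, htU⟩ := TopologicalSpace.countable_cover_nhdsWithin
    (f := fun w => Metric.ball w (r w)) (s := (spectrum ℂ S)ᶜ)
    fun w hw => mem_nhdsWithin_of_mem_nhds (Metric.ball_mem_nhds w (hr w hw).1)
  rcases t.eq_empty_or_nonempty with rfl | hne
  · rw [Set.biUnion_empty, Set.subset_empty_iff] at htU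
    rw [htU, E.empty]
  · obtain ⟨u, rfl⟩ := htc.exists_eq_range hne
    rw [Set.biUnion_range] at htU
    refine E.null_mono (MeasurableSet.iUnion fun n => Metric.isOpen_ball.measurableSet) hσ htU
      (E.null_iUnion (fun n => Metric.isOpen_ball.measurableSet) fun n => ?_)
    exact (hr _ (hts (Set.mem_range_self n))).2

variable (E) in
theorem resolvent_simpleIntegral (φ : SimpleFunc ℂ ℂ) {w : ℂ} (hw : E.E (φ ⁻¹' {w}) = 0) :
    w ∉ spectrum ℂ (E.simpleIntegral φ) ∧
      resolvent (E.simpleIntegral φ) w = E.simpleIntegral (φ.map fun z => (w - z)⁻¹) := by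
  have h1 : algebraMap ℂ (H →L[ℂ] H) w - E.simpleIntegral φ =
      E.simpleIntegral (φ.map fun z => w - z) := by
    rw [Algebra.algebraMap_eq_smul_one, ← simpleIntegral_const, ← simpleIntegral_sub]
    rfl
  have h2 : E.simpleIntegral (φ.map fun z => w - z) *
      E.simpleIntegral (φ.map fun z => (w - z)⁻¹) = 1 := by
    rw [← simpleIntegral_mul, ← one_smul ℂ (1 : H →L[ℂ] H), ← E.simpleIntegral_const]
    refine E.simpleIntegral_congr (φ.measurableSet_preimage {w}) hw fun z hz => ?_
    exact mul_inv_cancel₀ (sub_ne_zero.2 fun h => hz h.symm)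
  have h3 : E.simpleIntegral (φ.map fun z => (w - z)⁻¹) *
      E.simpleIntegral (φ.map fun z => w - z) = 1 := by
    rw [← simpleIntegral_mul, mul_comm, simpleIntegral_mul, h2]
  refine ⟨?_, ?_⟩
  · rw [spectrum.mem_iff, not_not, h1]
    exact ⟨⟨_, _, h2, h3⟩, rfl⟩
  · rw [resolvent, h1]
    exact Ring.inverse_unit (⟨_, _, h2, h3⟩ : (H →L[ℂ] H)ˣ)

variable (E) in
/-- For the integral of a simple function the functional calculus is composition. -/
theorem cauchyIntegral_simpleIntegral {C : Contour} {f : ℂ → ℂ} {K : Set ℂ}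
    (hC : C.IsAdmissible f K) (hf : AnalyticOnNhd ℂ f K) (φ : SimpleFunc ℂ ℂ)
    (hφ : ∀ z, E.E (φ ⁻¹' {z}) ≠ 0 → z ∈ K) :
    cauchyIntegral C f (E.simpleIntegral φ) = E.simpleIntegral (φ.map f) := by
  have h0 : ∀ w ∈ C.trace, E.E (φ ⁻¹' {w}) = 0 := fun w hw =>
    by_contra fun h => hC.avoids w hw (hφ w h)
  have h1 : C.integral (fun w => f w • resolvent (E.simpleIntegral φ) w) =
      C.integral fun w => ∑ z ∈ φ.range, (f w * (w - z)⁻¹) • E.E (φ ⁻¹' {z}) := by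
    refine C.integral_congr fun w hw => ?_
    rw [(E.resolvent_simpleIntegral φ (h0 w hw)).2, simpleIntegral_map, Finset.smul_sum]
    simp only [smul_smul]
  rw [cauchyIntegral, h1, C.integral_finset_sum, simpleIntegral_map, Finset.smul_sum]
  · refine Finset.sum_congr rfl fun z _ => ?_
    by_cases hz : E.E (φ ⁻¹' {z}) = 0
    · rw [C.integral_smul_const, hz, smul_zero, smul_zero, smul_zero]
    · rw [C.integral_smul_const, smul_smul, hC.integral_inv_sub_mul (hφ z hz) (hf z (hφ z hz))]
  · intro z _
    by_cases hz : E.E (φ ⁻¹' {z}) = 0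
    · simp only [hz, smul_zero]
      exact continuousOn_const
    · exact (hC.continuousOn.mul (C.continuousOn_inv_sub fun h => hC.avoids z h (hφ z hz))).smul
        continuousOn_const

/-- `f(S) = ∫ f dE`, computed with a contour around a neighbourhood of the spectrum: both sides are
limits of the corresponding expressions for the integrals of simple functions. The indicator of the
spectrum, whose complement is a null set, makes the integrand a Borel function. -/
theorem HasIntegral.hasIntegralOf_cauchyIntegral (h : E.HasIntegral S) {f : ℂ → ℂ} {ε : ℝ}
    (hε : 0 < ε) (hf : AnalyticOnNhd ℂ f (Metric.cthickening ε (spectrum ℂ S))) {C : Contour}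
    (hC : C.IsAdmissible f (Metric.cthickening ε (spectrum ℂ S)))
    (hfm : Measurable ((spectrum ℂ S).indicator f)) :
    E.HasIntegralOf ((spectrum ℂ S).indicator f) (cauchyIntegral C f S) := by
  have hnullσ := h.null_compl_spectrum
  have hσm : MeasurableSet (spectrum ℂ S)ᶜ := (spectrum.isClosed S).measurableSet.compl
  obtain ⟨φ, hφ, hlim⟩ := h
  obtain ⟨M, hM, hb⟩ := E.exists_norm_simpleIntegral_le
  have hKc : IsCompact (Metric.cthickening ε (spectrum ℂ S)) := (spectrum.isCompact S).cthickening
  have hσK : spectrum ℂ S ⊆ Metric.cthickening ε (spectrum ℂ S) :=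
    Metric.self_subset_cthickening _
  have hmem : ∀ z : ℂ, ∀ v ∈ spectrum ℂ S, ‖z - v‖ ≤ ε →
      z ∈ Metric.cthickening ε (spectrum ℂ S) := fun z v hv hzv =>
    Metric.mem_cthickening_of_dist_le z v ε _ hv (by rwa [dist_eq_norm])
  -- once `φ n` is close to the identity, its essential values are close to the spectrum
  have hnear : ∀ n, E.E {z | ε / 2 ≤ ‖φ n z - id z‖} = 0 → ∀ z, E.E (φ n ⁻¹' {z}) ≠ 0 →
      ∃ v ∈ spectrum ℂ S, ‖z - v‖ < ε / 2 := by
    intro n hn z hz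
    by_contra! hcon
    refine hz (E.null_mono ((measurableSet_le_norm_sub (φ n) measurable_id _).union hσm)
      ((φ n).measurableSet_preimage _) (fun v hv => ?_)
      (E.null_union (measurableSet_le_norm_sub (φ n) measurable_id _) hσm hn hnullσ))
    by_cases hvσ : v ∈ spectrum ℂ S
    · have hv' : φ n v = z := hv
      exact Or.inl (show ε / 2 ≤ ‖φ n v - v‖ by rw [hv']; exact hcon v hvσ)
    · exact Or.inr hvσ
  have hev : ∀ᶠ n in atTop, E.E {z | ε / 2 ≤ ‖φ n z - id z‖} = 0 := hφ _ (by positivity)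
  refine ⟨fun n => (φ n).map f, fun η hη => ?_, ?_⟩
  · obtain ⟨d, hd, hfd⟩ := Metric.uniformContinuousOn_iff.1
      (hKc.uniformContinuousOn_of_continuous fun z hz =>
        (hf z hz).continuousAt.continuousWithinAt)
      η hη
    filter_upwards [hφ (min d ε) (by positivity)] with n hn
    refine E.null_mono ((measurableSet_le_norm_sub (φ n) measurable_id _).union hσm)
      (measurableSet_le_norm_sub _ hfm η) (fun z hz => ?_)
      (E.null_union (measurableSet_le_norm_sub (φ n) measurable_id _) hσm hn hnullσ)
    by_contra hcon
    rw [Set.mem_union, not_or, Set.notMem_compl_iff] at hcon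
    have h1 : ‖φ n z - z‖ < min d ε := not_le.1 hcon.1
    have h2 := hfd (φ n z) (hmem _ z hcon.2 (h1.le.trans (min_le_right _ _))) z (hσK hcon.2)
      (by rw [dist_eq_norm]; exact h1.trans_le (min_le_left _ _))
    have h3 : η ≤ ‖f (φ n z) - (spectrum ℂ S).indicator f z‖ := hz
    rw [Set.indicator_of_mem hcon.2, ← dist_eq_norm] at h3
    exact absurd h2 h3.not_gt
  · have hCσ : C.IsAdmissible f (spectrum ℂ S) := hC.mono hσK
    obtain ⟨L, hL, hLb⟩ := C.exists_norm_integral_le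
    obtain ⟨B, hB⟩ := C.isCompact_trace.exists_bound_of_continuousOn
      (continuousOn_resolvent_trace hCσ.avoids)
    obtain ⟨F, hF⟩ := C.isCompact_trace.exists_bound_of_continuousOn hC.continuousOn
    rw [tendsto_iff_norm_sub_tendsto_zero]
    have hlim0 := tendsto_iff_norm_sub_tendsto_zero.1 hlim
    have hlim1 : Tendsto (fun n => ‖(2 * Real.pi * Complex.I : ℂ)⁻¹‖ *
        (L * (F * (M * (2 / ε) * ‖E.simpleIntegral (φ n) - S‖ * B)))) atTop (𝓝 0) := by
      simpa using ((((hlim0.const_mul (M * (2 / ε))).mul_const B).const_mul F).const_mul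
        L).const_mul ‖(2 * Real.pi * Complex.I : ℂ)⁻¹‖
    refine squeeze_zero' (.of_forall fun n => norm_nonneg _) ?_ hlim1
    filter_upwards [hev] with n hn
    have hval : ∀ z, E.E (φ n ⁻¹' {z}) ≠ 0 → z ∈ Metric.cthickening ε (spectrum ℂ S) := by
      intro z hz
      obtain ⟨v, hv, hzv⟩ := hnear n hn z hz
      exact hmem z v hv (by linarith)
    have h0 : ∀ w ∈ C.trace, E.E (φ n ⁻¹' {w}) = 0 := fun w hw =>
      by_contra fun hne => hC.avoids w hw (hval w hne)
    have hR := fun w hw => E.resolvent_simpleIntegral (φ n) (h0 w hw)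
    have hRb : ∀ w ∈ C.trace, ‖resolvent (E.simpleIntegral (φ n)) w‖ ≤ M * (2 / ε) := by
      intro w hw
      rw [(hR w hw).2]
      refine hb _ _ (by positivity) (E.null_mono
        ((measurableSet_le_norm_sub (φ n) measurable_id _).union hσm)
        (measurableSet_lt measurable_const (SimpleFunc.measurable _).norm) (fun z hz => ?_)
        (E.null_union (measurableSet_le_norm_sub (φ n) measurable_id _) hσm hn hnullσ))
      by_contra hcon
      rw [Set.mem_union, not_or, Set.notMem_compl_iff] at hcon
      have h1 : ‖φ n z - z‖ < ε / 2 := not_le.1 hcon.1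
      have h2 : ε < ‖w - z‖ := not_le.1 fun hle => hC.avoids w hw (hmem w z hcon.2 hle)
      have h3 := norm_sub_le_norm_sub_add_norm_sub w (φ n z) z
      have h4 : 2 / ε < ‖(w - φ n z)⁻¹‖ := hz
      have h5 : ε / 2 < ‖w - φ n z‖ := by linarith
      have h6 : ‖(w - φ n z)⁻¹‖ < 2 / ε := by
        rw [norm_inv, ← inv_div]
        exact inv_strictAnti₀ (by positivity) h5
      exact absurd h4 h6.not_gt
    have hcont : ContinuousOn (fun w => f w • resolvent (E.simpleIntegral (φ n)) w) C.trace :=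
      hC.continuousOn.smul (continuousOn_resolvent_trace fun w hw => (hR w hw).1)
    rw [← E.cauchyIntegral_simpleIntegral hC hf (φ n) hval, cauchyIntegral, cauchyIntegral,
      ← smul_sub, ← C.integral_sub hcont hCσ.continuousOn_smul_resolvent, norm_smul]
    refine mul_le_mul_of_nonneg_left (hLb _ _ fun w hw => ?_) (norm_nonneg _)
    have hFw := hF w hw
    rw [← smul_sub, spectrum.resolvent_sub_resolvent (spectrum.notMem_iff.1 (hR w hw).1)
      (spectrum.notMem_iff.1 (hCσ.avoids w hw)), norm_smul]
    refine mul_le_mul hFw ((norm_mul_le _ _).trans (mul_le_mul ((norm_mul_le _ _).trans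
      (mul_le_mul_of_nonneg_right (hRb w hw) (norm_nonneg _))) (hB w hw) (norm_nonneg _)
      (by positivity))) (norm_nonneg _) ((norm_nonneg _).trans hFw)

end SpectralMeasure

section ScalarType

variable {H : Type*} [NormedAddCommGroup H] [InnerProductSpace ℂ H] [CompleteSpace H]

/-- An analytic function of an operator of scalar type is of scalar type, its resolution of the
identity being `δ ↦ E(f⁻¹(δ))`, and its spectrum is contained in the image of the spectrum. -/
theorem IsScalarType.cauchyIntegral {S : H →L[ℂ] H} (hS : IsScalarType S) {f : ℂ → ℂ}
    (hf : AnalyticOnNhd ℂ f (spectrum ℂ S)) {C : Contour}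
    (hC : C.IsAdmissible f (spectrum ℂ S)) :
    IsScalarType (cauchyIntegral C f S) ∧
      spectrum ℂ (TriangularOperators.cauchyIntegral C f S) ⊆ f '' spectrum ℂ S := by
  classical
  obtain ⟨E, -, hE⟩ := hS
  obtain ⟨ε, hε, hεf⟩ := (spectrum.isCompact S).exists_cthickening_subset_open
    (isOpen_analyticAt ℂ f) hf
  obtain ⟨D, hD⟩ := Contour.exists_isAdmissible
    (K := Metric.cthickening ε (spectrum ℂ S)) (spectrum.isCompact S).cthickening hεf
  have hfm : Measurable ((spectrum ℂ S).indicator f) := by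
    rw [← Set.piecewise_eq_indicator]
    exact ContinuousOn.measurable_piecewise
      (fun z hz => (hf z hz).continuousAt.continuousWithinAt) continuousOn_const
      (spectrum.isClosed S).measurableSet
  have hK : IsCompact (f '' spectrum ℂ S) := (spectrum.isCompact S).image_of_continuousOn
    fun z hz => (hf z hz).continuousAt.continuousWithinAt
  have hnull : E.E ((spectrum ℂ S).indicator f ⁻¹' (f '' spectrum ℂ S))ᶜ = 0 := by
    refine E.null_mono (spectrum.isClosed S).measurableSet.compl
      (hfm hK.isClosed.measurableSet).compl (fun z hz hzσ => hz ?_) hE.null_compl_spectrum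
    rw [Set.mem_preimage, Set.indicator_of_mem hzσ]
    exact Set.mem_image_of_mem f hzσ
  have hI := hE.hasIntegralOf_cauchyIntegral hε hεf hD hfm
  have hDσ : D.IsAdmissible f (spectrum ℂ S) := hD.mono (Metric.self_subset_cthickening _)
  -- `f(S)` may be computed with the contour around the thickened spectrum
  rw [← (isAnalyticFunctionOf_cauchyIntegral hDσ).2 C hC]
  exact ⟨⟨_, hI.isResolutionOfIdentity_pushforward hfm, hI.hasIntegral_pushforward hfm hK hnull⟩,
    hI.spectrum_subset hfm hK.isClosed hnull⟩

end ScalarType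

/-! ### Strong limits and compact operators -/

section StrongLimits

variable {H : Type*} [NormedAddCommGroup H] [InnerProductSpace ℂ H]
  {ι : Type*} {l : Filter ι} {A B : ι → H →L[ℂ] H} {A₀ B₀ : H →L[ℂ] H}

/-- Multiplication is jointly continuous for strong convergence on bounded sets. -/
theorem tendsto_mul_apply (hA : ∀ x, Tendsto (fun i => A i x) l (𝓝 (A₀ x)))
    (hB : ∀ x, Tendsto (fun i => B i x) l (𝓝 (B₀ x))) (hA1 : ∀ᶠ i in l, ‖A i‖ ≤ 1) (x : H) :
    Tendsto (fun i => (A i * B i) x) l (𝓝 ((A₀ * B₀) x)) := by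
  have h0 : Tendsto (fun i => A i (B i x - B₀ x)) l (𝓝 0) := by
    refine squeeze_zero_norm' (hA1.mono fun i hi => ?_)
      (tendsto_iff_norm_sub_tendsto_zero.1 (hB x))
    exact (A i).le_of_opNorm_le_of_le hi le_rfl |>.trans (one_mul _).le
  have h1 := h0.add (hA (B₀ x))
  simp only [map_sub, sub_add_cancel, zero_add] at h1
  exact h1

/-- A compact operator turns strong convergence of bounded families into norm convergence. -/
theorem tendsto_norm_mul_of_isCompactOperator {K : H →L[ℂ] H} (hK : IsCompactOperator K)
    (hA : ∀ x, Tendsto (fun i => A i x) l (𝓝 0)) {c : ℝ} (hc : ∀ᶠ i in l, ‖A i‖ ≤ c) :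
    Tendsto (fun i => ‖A i * K‖) l (𝓝 0) := by
  rw [Metric.tendsto_nhds]
  intro ε hε
  obtain ⟨S, hS, hKS⟩ := hK.image_closedBall_subset_compact 1
  set e : ℝ := ε / (2 * (|c| + 1)) with he
  have he0 : 0 < e := by positivity
  obtain ⟨t, -, htf, ht⟩ := hS.finite_cover_balls he0
  have hev : ∀ᶠ i in l, ∀ x ∈ t, ‖A i x‖ < e := by
    rw [htf.eventually_all]
    intro x _
    have := (hA x).norm
    rw [norm_zero] at this
    exact this.eventually (gt_mem_nhds he0)
  filter_upwards [hc, hev] with i hi h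
  rw [dist_zero_right, norm_norm]
  refine lt_of_le_of_lt (b := (|c| + 1) * e) (ContinuousLinearMap.opNorm_le_of_unit_norm
    (by positivity) fun y hy => ?_) ?_
  · have hyS : K y ∈ S := hKS ⟨y, mem_closedBall_zero_iff.2 hy.le, rfl⟩
    obtain ⟨x, hx, hxy⟩ := Set.mem_iUnion₂.1 (ht hyS)
    rw [Metric.mem_ball, dist_eq_norm] at hxy
    have h1 : A i (K y) = A i (K y - x) + A i x := by rw [map_sub, sub_add_cancel]
    have h2 : ‖A i (K y - x)‖ ≤ |c| * e :=
      (A i).le_of_opNorm_le_of_le (hi.trans (le_abs_self c)) hxy.le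
    calc ‖(A i * K) y‖ = ‖A i (K y - x) + A i x‖ := by rw [← h1]; rfl
      _ ≤ |c| * e + e := (norm_add_le _ _).trans (add_le_add h2 (h x hx).le)
      _ = (|c| + 1) * e := by ring
  · have : (|c| + 1) * e = ε / 2 := by
      rw [he]
      field_simp
    linarith

theorem RankLEOne.isCompactOperator {D : H →L[ℂ] H} (hD : RankLEOne D) : IsCompactOperator D := by
  have hfin : FiniteDimensional ℂ D.range :=
    Module.rank_lt_aleph0_iff.1 (lt_of_le_of_lt hD Cardinal.one_lt_aleph0)
  have : ProperSpace D.range := FiniteDimensional.proper ℂ D.range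
  have h1 : IsCompactOperator (D.codRestrict D.range fun x => ⟨x, rfl⟩) :=
    isCompactOperator_of_locallyCompactSpace_dom (D.codRestrict D.range fun x => ⟨x, rfl⟩)
  exact h1.clm_comp D.range.subtypeL

/-- The compression of an operator to a subspace of dimension at most one is a scalar. -/
theorem RankLEOne.exists_smul {D : H →L[ℂ] H} (hD : RankLEOne D)
    (K : H →L[ℂ] H) : ∃ α : ℂ, D * K * D = α • D := by
  obtain ⟨⟨v, hv⟩, hspan⟩ := (rank_le_one_iff (K := ℂ)).1 hD
  have hr : ∀ x, ∃ r : ℂ, D x = r • v := fun x => by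
    obtain ⟨r, hr⟩ := hspan ⟨D x, x, rfl⟩
    exact ⟨r, (congrArg Subtype.val hr).symm⟩
  obtain ⟨α, hα⟩ := hr (K v)
  refine ⟨α, ?_⟩
  ext x
  obtain ⟨r, hx⟩ := hr x
  change D (K (D x)) = α • D x
  rw [hx, map_smul, map_smul, hα, smul_comm]

end StrongLimits

/-! ### Operators leaving a chain of projections invariant -/

/-- A maximal chain of orthogonal projections, extended constantly to the real line; `Δ t` is the
jump `P (t+0) - P (t-0)`, written as the strong limit of `P s - P r` for `r ↑ t`, `s ↓ t`. -/
structure IsChainWithJumps {H : Type*} [NormedAddCommGroup H] [InnerProductSpace ℂ H]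
    [CompleteSpace H] (a b : ℝ) (P Δ : ℝ → H →L[ℂ] H) : Prop where
  le : a ≤ b
  proj : ∀ t, IsStarProjection (P t)
  mono : ∀ r s, r ≤ s → P s * P r = P r
  left : P a = 0
  right : ∀ t, b ≤ t → P t = 1
  jump : ∀ t ∈ Set.Icc a b, ∀ x,
    Tendsto (fun p : ℝ × ℝ => (P p.2 - P p.1) x) (𝓝[<] t ×ˢ 𝓝[>] t) (𝓝 (Δ t x))
  rank : ∀ t ∈ Set.Icc a b, RankLEOne (Δ t)

/-- The closed algebra of the operators that leave the ranges of all `P t` invariant. -/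
def chainAlgebra {H : Type*} [NormedAddCommGroup H] [InnerProductSpace ℂ H]
    (P : ℝ → H →L[ℂ] H) (hP : ∀ t, P t * P t = P t) : Subalgebra ℂ (H →L[ℂ] H) where
  carrier := {A | ∀ t, P t * A * P t = A * P t}
  mul_mem' {A B} hA hB t := by
    have h1 := hA t
    have h2 := hB t
    calc P t * (A * B) * P t = P t * A * (B * P t) := by simp only [mul_assoc]
      _ = P t * A * (P t * B * P t) := by rw [h2]
      _ = (P t * A * P t) * B * P t := by simp only [mul_assoc]
      _ = A * (P t * B * P t) := by rw [h1]; simp only [mul_assoc]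
      _ = A * B * P t := by rw [h2, mul_assoc]
  add_mem' {A B} hA hB t := by rw [mul_add, add_mul, add_mul, hA t, hB t]
  algebraMap_mem' z t := by
    rw [← Algebra.commutes, mul_assoc, hP]

section Chain

variable {H : Type*} [NormedAddCommGroup H] [InnerProductSpace ℂ H]

theorem mem_chainAlgebra {P : ℝ → H →L[ℂ] H} {hP : ∀ t, P t * P t = P t} {A : H →L[ℂ] H} :
    A ∈ chainAlgebra P hP ↔ ∀ t, P t * A * P t = A * P t := Iff.rfl

theorem mem_chainAlgebra_of_commute {P : ℝ → H →L[ℂ] H} {hP : ∀ t, P t * P t = P t}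
    {A : H →L[ℂ] H} (h : ∀ t, Commute (P t) A) : A ∈ chainAlgebra P hP := fun t => by
  rw [(h t).eq, mul_assoc, hP]

theorem isClosed_chainAlgebra (P : ℝ → H →L[ℂ] H) (hP : ∀ t, P t * P t = P t) :
    IsClosed (chainAlgebra P hP : Set (H →L[ℂ] H)) := by
  have : (chainAlgebra P hP : Set (H →L[ℂ] H)) = ⋂ t, {A | P t * A * P t = A * P t} := by
    ext A
    simp only [SetLike.mem_coe, mem_chainAlgebra, Set.mem_iInter, Set.mem_ofPred_eq]
  rw [this]
  exact isClosed_iInter fun t => isClosed_eq (by fun_prop) (by fun_prop)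

/-- If `N` is a quasinilpotent element of a closed algebra of operators, then `(z - N)⁻¹` belongs to
the algebra for `z ≠ 0`, because the complement of the spectrum of `N` is connected. -/
theorem IsQuasinilpotent.exists_inverse_mem [CompleteSpace H] {N : H →L[ℂ] H}
    (hN : IsQuasinilpotent N) (M : Subalgebra ℂ (H →L[ℂ] H))
    (hM : IsClosed (M : Set (H →L[ℂ] H))) (hNM : N ∈ M) {z : ℂ} (hz : z ≠ 0) :
    ∃ W ∈ M, (z • (1 : H →L[ℂ] H) - N) * W = 1 ∧ W * (z • (1 : H →L[ℂ] H) - N) = 1 := by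
  have : CompleteSpace M := hM.completeSpace_coe
  have hc : IsPreconnected (spectrum ℂ N)ᶜ :=
    (Set.Countable.isConnected_compl_of_one_lt_rank
      (by rw [Complex.rank_real_complex]; exact Nat.one_lt_ofNat)
      ((Set.countable_singleton (0 : ℂ)).mono hN)).isPreconnected
  have hs : spectrum ℂ (⟨N, hNM⟩ : M) = spectrum ℂ N :=
    Subalgebra.spectrum_eq_of_isPreconnected_compl M ⟨N, hNM⟩ hc
  have hzN : z ∉ spectrum ℂ (⟨N, hNM⟩ : M) := fun h => hz (hN (hs ▸ h))
  obtain ⟨u, hu⟩ := spectrum.notMem_iff.1 hzN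
  have hu' : ((u : M) : H →L[ℂ] H) = z • (1 : H →L[ℂ] H) - N := by
    rw [hu, Algebra.algebraMap_eq_smul_one]
    rfl
  refine ⟨((↑u⁻¹ : M) : H →L[ℂ] H), (↑u⁻¹ : M).2, ?_, ?_⟩
  · rw [← hu']
    exact congrArg Subtype.val u.mul_inv
  · rw [← hu']
    exact congrArg Subtype.val u.inv_mul

end Chain

namespace IsChainWithJumps

variable {H : Type*} [NormedAddCommGroup H] [InnerProductSpace ℂ H] [CompleteSpace H]
  {a b : ℝ} {P Δ : ℝ → H →L[ℂ] H}

theorem mul_self (h : IsChainWithJumps a b P Δ) (t : ℝ) : P t * P t = P t :=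
  (h.proj t).isIdempotentElem

theorem mono' (h : IsChainWithJumps a b P Δ) {r s : ℝ} (hrs : r ≤ s) : P r * P s = P r := by
  have := congrArg star (h.mono r s hrs)
  rwa [star_mul, (h.proj r).isSelfAdjoint.star_eq, (h.proj s).isSelfAdjoint.star_eq] at this

theorem isStarProjection_sub (h : IsChainWithJumps a b P Δ) {r s : ℝ} (hrs : r ≤ s) :
    IsStarProjection (P s - P r) :=
  (h.proj r).sub_of_mul_eq_left (h.proj s) (h.mono' hrs)

/-- The compression to `P s - P r` is multiplicative on the chain algebra. -/
theorem sub_mul_mul_sub (h : IsChainWithJumps a b P Δ) {r s : ℝ} (hrs : r ≤ s) {A B : H →L[ℂ] H}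
    (hA : P r * A * P r = A * P r) (hB : P s * B * P s = B * P s) :
    (P s - P r) * (A * B) * (P s - P r) =
      (P s - P r) * A * (P s - P r) * (B * (P s - P r)) := by
  have h1 : (P s - P r) * A * P r = 0 := by
    rw [mul_assoc, ← hA, mul_assoc, ← mul_assoc, sub_mul, h.mono r s hrs, h.mul_self, sub_self,
      zero_mul]
  have h2 : B * (P s - P r) = P s * (B * (P s - P r)) := by
    have h3 : P s - P r = P s * (P s - P r) := by
      rw [mul_sub, h.mul_self, h.mono r s hrs]
    calc B * (P s - P r) = B * P s * (P s - P r) := by rw [mul_assoc, ← h3]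
      _ = P s * B * P s * (P s - P r) := by rw [hB]
      _ = P s * (B * (P s - P r)) := by rw [mul_assoc (P s * B), ← h3, mul_assoc]
  calc (P s - P r) * (A * B) * (P s - P r)
      = (P s - P r) * A * (B * (P s - P r)) := by simp only [mul_assoc]
    _ = (P s - P r) * A * (P s * (B * (P s - P r))) := by rw [← h2]
    _ = (P s - P r) * A * P s * (B * (P s - P r)) := by simp only [mul_assoc]
    _ = (P s - P r) * A * (P s - P r) * (B * (P s - P r)) := by
      rw [mul_sub ((P s - P r) * A) (P s) (P r), h1, sub_zero]

theorem eventually_le (t : ℝ) : ∀ᶠ p : ℝ × ℝ in 𝓝[<] t ×ˢ 𝓝[>] t, p.1 ≤ p.2 := by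
  have h1 : ∀ᶠ r : ℝ in 𝓝[<] t, r < t := self_mem_nhdsWithin
  have h2 : ∀ᶠ s : ℝ in 𝓝[>] t, t < s := self_mem_nhdsWithin
  filter_upwards [h1.prod_mk h2] with p hp
  exact (hp.1.trans hp.2).le

theorem eventually_norm_sub_le (h : IsChainWithJumps a b P Δ) (t : ℝ) :
    ∀ᶠ p : ℝ × ℝ in 𝓝[<] t ×ˢ 𝓝[>] t, ‖P p.2 - P p.1‖ ≤ 1 :=
  (eventually_le t).mono fun _ hp => (h.isStarProjection_sub hp).norm_le

/-- Strong limits of compressions. -/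
theorem tendsto_compression (h : IsChainWithJumps a b P Δ) {t : ℝ} (ht : t ∈ Set.Icc a b)
    (A : H →L[ℂ] H) (x : H) :
    Tendsto (fun p : ℝ × ℝ => ((P p.2 - P p.1) * A * (P p.2 - P p.1)) x)
      (𝓝[<] t ×ˢ 𝓝[>] t) (𝓝 ((Δ t * A * Δ t) x)) := by
  have h1 : ∀ x, Tendsto (fun p : ℝ × ℝ => (A * (P p.2 - P p.1)) x)
      (𝓝[<] t ×ˢ 𝓝[>] t) (𝓝 ((A * Δ t) x)) := fun x =>
    (A.continuous.tendsto _).comp (h.jump t ht x)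
  simp only [mul_assoc]
  exact tendsto_mul_apply (h.jump t ht) h1 (h.eventually_norm_sub_le t) x

theorem jump_mul_self (h : IsChainWithJumps a b P Δ) {t : ℝ} (ht : t ∈ Set.Icc a b) :
    Δ t * Δ t = Δ t := by
  ext x
  have h1 := h.tendsto_compression ht 1 x
  simp only [mul_one] at h1
  refine tendsto_nhds_unique h1 ((h.jump t ht x).congr' ?_)
  filter_upwards [eventually_le t] with p hp
  rw [(h.isStarProjection_sub hp).isIdempotentElem.eq]

theorem jump_isSelfAdjoint (h : IsChainWithJumps a b P Δ) {t : ℝ} (ht : t ∈ Set.Icc a b) :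
    star (Δ t) = Δ t := by
  rw [ContinuousLinearMap.star_eq_adjoint, eq_comm, ContinuousLinearMap.eq_adjoint_iff]
  intro x y
  refine tendsto_nhds_unique ((h.jump t ht x).inner tendsto_const_nhds)
    ((tendsto_const_nhds.inner (h.jump t ht y)).congr' ?_)
  filter_upwards [eventually_le t] with p hp
  have h1 := (h.isStarProjection_sub hp).isSelfAdjoint.star_eq
  rw [ContinuousLinearMap.star_eq_adjoint] at h1
  conv_rhs => rw [← h1]
  rw [ContinuousLinearMap.adjoint_inner_left]

/-- The compression to a jump of the chain is multiplicative on the chain algebra. -/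
theorem jump_mul_mul_jump (h : IsChainWithJumps a b P Δ) {t : ℝ} (ht : t ∈ Set.Icc a b)
    {A B : H →L[ℂ] H} (hA : A ∈ chainAlgebra P h.mul_self) (hB : B ∈ chainAlgebra P h.mul_self) :
    Δ t * (A * B) * Δ t = Δ t * A * Δ t * (B * Δ t) := by
  ext x
  have h1 : ∀ x, Tendsto (fun p : ℝ × ℝ => (B * (P p.2 - P p.1)) x)
      (𝓝[<] t ×ˢ 𝓝[>] t) (𝓝 ((B * Δ t) x)) := fun x =>
    (B.continuous.tendsto _).comp (h.jump t ht x)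
  have h2 : ∀ x, Tendsto (fun p : ℝ × ℝ => ((P p.2 - P p.1) * (B * (P p.2 - P p.1))) x)
      (𝓝[<] t ×ˢ 𝓝[>] t) (𝓝 ((Δ t * (B * Δ t)) x)) :=
    tendsto_mul_apply (h.jump t ht) h1 (h.eventually_norm_sub_le t)
  have h3 : ∀ x, Tendsto (fun p : ℝ × ℝ => (A * ((P p.2 - P p.1) * (B * (P p.2 - P p.1)))) x)
      (𝓝[<] t ×ˢ 𝓝[>] t) (𝓝 ((A * (Δ t * (B * Δ t))) x)) := fun x =>
    (A.continuous.tendsto _).comp (h2 x)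
  have h4 := tendsto_mul_apply (h.jump t ht) h3 (h.eventually_norm_sub_le t) x
  refine tendsto_nhds_unique (h.tendsto_compression ht (A * B) x) ?_
  simp only [mul_assoc] at h4 ⊢
  refine h4.congr' ?_
  filter_upwards [eventually_le t] with p hp
  have := h.sub_mul_mul_sub hp (hA p.1) (hB p.2)
  simp only [mul_assoc] at this
  rw [this]

/-- A quasinilpotent operator leaving the chain invariant has zero diagonal: its compression to a
jump is a scalar `α`, and if `α` were not zero, compressing `(α - V)(α - V)⁻¹ = 1` would give
`0 = 1`. -/
theorem jump_mul_jump_eq_zero (h : IsChainWithJumps a b P Δ) {t : ℝ} (ht : t ∈ Set.Icc a b)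
    {V : H →L[ℂ] H} (hV : V ∈ chainAlgebra P h.mul_self) (hq : IsQuasinilpotent V) :
    Δ t * V * Δ t = 0 := by
  obtain ⟨α, hα⟩ := (h.rank t ht).exists_smul V
  by_cases hα0 : α = 0
  · rw [hα, hα0, zero_smul]
  · obtain ⟨W, hW, hVW, -⟩ := hq.exists_inverse_mem (chainAlgebra P h.mul_self)
      (isClosed_chainAlgebra P h.mul_self) hV hα0
    have hmem : α • (1 : H →L[ℂ] H) - V ∈ chainAlgebra P h.mul_self :=
      sub_mem (Subalgebra.smul_mem _ (one_mem _) α) hV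
    have h1 := h.jump_mul_mul_jump ht hmem hW
    have h2 : Δ t * (α • (1 : H →L[ℂ] H) - V) * Δ t = 0 := by
      rw [mul_sub, sub_mul, hα, mul_smul_comm, mul_one, smul_mul_assoc, h.jump_mul_self ht,
        sub_self]
    rw [hVW, h2, zero_mul, mul_one, h.jump_mul_self ht] at h1
    rw [hα, h1, smul_zero]

/-- If the diagonal entry of the compact operator `K` at `t` vanishes, then the compressions of `K`
to small intervals around `t` are small in norm. -/
theorem tendsto_norm_compression (h : IsChainWithJumps a b P Δ) {t : ℝ} (ht : t ∈ Set.Icc a b)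
    {K : H →L[ℂ] H} (hK : IsCompactOperator K) (hd : Δ t * K * Δ t = 0) :
    Tendsto (fun p : ℝ × ℝ => ‖(P p.2 - P p.1) * K * (P p.2 - P p.1)‖)
      (𝓝[<] t ×ˢ 𝓝[>] t) (𝓝 0) := by
  have hs : ∀ x, Tendsto (fun p : ℝ × ℝ => ((P p.2 - P p.1) - Δ t) x)
      (𝓝[<] t ×ˢ 𝓝[>] t) (𝓝 0) := fun x => by
    simpa using (h.jump t ht x).sub_const (Δ t x)
  have hb : ∀ᶠ p : ℝ × ℝ in 𝓝[<] t ×ˢ 𝓝[>] t, ‖(P p.2 - P p.1) - Δ t‖ ≤ 1 + ‖Δ t‖ :=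
    (h.eventually_norm_sub_le t).mono fun p hp =>
      (norm_sub_le _ _).trans (add_le_add_left hp _)
  have h1 := tendsto_norm_mul_of_isCompactOperator hK hs hb
  have hc : IsCompactOperator (star K * Δ t) :=
    (h.rank t ht).isCompactOperator.clm_comp (star K)
  have h2 := tendsto_norm_mul_of_isCompactOperator hc hs hb
  refine squeeze_zero' (.of_forall fun _ => norm_nonneg _) ?_ (by simpa using h1.add h2)
  filter_upwards [eventually_le t, h.eventually_norm_sub_le t] with p hp hp1
  set D := P p.2 - P p.1 with hD
  have e : D * K * D = (D - Δ t) * K * D + Δ t * K * (D - Δ t) := by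
    have e1 : Δ t * K * (D - Δ t) = Δ t * K * D := by rw [mul_sub (Δ t * K), hd, sub_zero]
    rw [e1, ← add_mul, ← add_mul, sub_add_cancel]
  -- passing to the adjoint brings the factor that converges strongly to the left
  have e2 : ‖Δ t * K * (D - Δ t)‖ = ‖(D - Δ t) * (star K * Δ t)‖ := by
    rw [← norm_star (Δ t * K * (D - Δ t)), star_mul, star_mul, star_sub, h.jump_isSelfAdjoint ht,
      (h.isStarProjection_sub hp).isSelfAdjoint.star_eq]
  rw [e]
  refine (norm_add_le _ _).trans (add_le_add ?_ e2.le)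
  exact (norm_mul_le _ _).trans (mul_le_of_le_one_right (norm_nonneg _) hp1)

/-- If the compression of `K` to `P s - P r` is smaller than `z`, then invertibility passes from
`z - K P r` to `z - K P s`. -/
theorem isUnit_of_isUnit (h : IsChainWithJumps a b P Δ) {K : H →L[ℂ] H}
    (hK : K ∈ chainAlgebra P h.mul_self) {z : ℂ} (hz : z ≠ 0) {r s : ℝ} (hrs : r ≤ s)
    (hlt : ‖(P s - P r) * K * (P s - P r)‖ < ‖z‖)
    (hr : IsUnit (z • (1 : H →L[ℂ] H) - K * P r)) :
    IsUnit (z • (1 : H →L[ℂ] H) - K * P s) := by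
  obtain ⟨u, hu⟩ := hr
  set D := P s - P r with hD
  set W : H →L[ℂ] H := ↑u⁻¹ with hW
  have hDD : D * D = D := (h.isStarProjection_sub hrs).isIdempotentElem
  have hDu : D * u = z • D := by
    have h1 : D * (K * P r) = 0 := by
      rw [← hK r, mul_assoc (P r), ← mul_assoc, hD, sub_mul, h.mono r s hrs, h.mul_self, sub_self,
        zero_mul]
    rw [hu, mul_sub, h1, sub_zero, mul_smul_comm, mul_one]
  have hDW : D * W = z⁻¹ • D := by
    have h1 : D * u * W = D := by rw [mul_assoc, hW, u.mul_inv, mul_one]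
    rw [hDu, smul_mul_assoc] at h1
    rw [← h1, smul_smul, inv_mul_cancel₀ hz, one_smul, h1]
  -- `1 - W K D` is invertible, as `1 - D W K D = 1 - z⁻¹ D K D` is
  have hunit : IsUnit (1 - D * (W * K * D)) := by
    refine isUnit_one_sub_of_norm_lt_one ?_
    rw [← mul_assoc, ← mul_assoc, hDW, smul_mul_assoc, smul_mul_assoc, norm_smul, norm_inv,
      inv_mul_lt_iff₀ (norm_pos_iff.2 hz), mul_one]
    exact hlt
  have hunit' : IsUnit (1 - W * K * D) := by
    have h1 : ((1 : ℂˣ) : ℂ) ∉ spectrum ℂ (D * (W * K * D)) := by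
      rw [spectrum.notMem_iff, Units.val_one, map_one]
      exact hunit
    rw [spectrum.unit_mem_mul_comm, spectrum.notMem_iff, Units.val_one, map_one, mul_assoc (W * K),
      hDD] at h1
    exact h1
  have e : z • (1 : H →L[ℂ] H) - K * P s = u * (1 - W * K * D) := by
    rw [mul_sub, mul_one, mul_assoc W, ← mul_assoc, hW, u.mul_inv, one_mul, hu, hD, mul_sub]
    abel
  rw [e]
  exact u.isUnit.mul hunit'

/-- A compact operator that leaves the chain invariant and has zero diagonal is quasinilpotent:
the set of all `t` for which `z - K P t` is invertible contains `a`, and by `isUnit_of_isUnit` and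
the smallness of the local compressions it can neither end nor have a gap before `b`. -/
theorem isQuasinilpotent (h : IsChainWithJumps a b P Δ) {K : H →L[ℂ] H}
    (hK : K ∈ chainAlgebra P h.mul_self) (hc : IsCompactOperator K)
    (hd : ∀ t ∈ Set.Icc a b, Δ t * K * Δ t = 0) : IsQuasinilpotent K := by
  intro z hzK
  by_contra hz
  have hz : z ≠ 0 := hz
  refine (spectrum.mem_iff.1 hzK) ?_
  rw [Algebra.algebraMap_eq_smul_one]
  set G : Set ℝ := {t | t ∈ Set.Icc a b ∧ IsUnit (z • (1 : H →L[ℂ] H) - K * P t)} with hG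
  have haG : a ∈ G := by
    refine ⟨⟨le_rfl, h.le⟩, ?_⟩
    rw [h.left, mul_zero, sub_zero, ← Algebra.algebraMap_eq_smul_one]
    exact (IsUnit.mk0 z hz).map (algebraMap ℂ (H →L[ℂ] H))
  have hbdd : BddAbove G := ⟨b, fun t ht => ht.1.2⟩
  set c := sSup G with hcdef
  have hcI : c ∈ Set.Icc a b := ⟨le_csSup hbdd haG, csSup_le ⟨a, haG⟩ fun t ht => ht.1.2⟩
  have hev := (h.tendsto_norm_compression hcI hc (hd c hcI)).eventually
    (gt_mem_nhds (norm_pos_iff.2 hz))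
  have h1 : ∀ᶠ r : ℝ in 𝓝[<] c, r < c := self_mem_nhdsWithin
  have h2 : ∀ᶠ s : ℝ in 𝓝[>] c, c < s := self_mem_nhdsWithin
  obtain ⟨⟨r₀, s₀⟩, hlt, hr₀, hs₀⟩ := (hev.and (h1.prod_mk h2)).exists
  simp only at hlt hr₀ hs₀
  obtain ⟨r, hrG, hr⟩ := exists_lt_of_lt_csSup ⟨a, haG⟩ hr₀
  have hrc : r ≤ c := le_csSup hbdd hrG
  have step : ∀ s, c ≤ s → s ≤ s₀ → IsUnit (z • (1 : H →L[ℂ] H) - K * P s) := by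
    intro s hcs hs
    have hrs := hrc.trans hcs
    refine h.isUnit_of_isUnit hK hz hrs (lt_of_le_of_lt ?_ hlt) hrG.2
    have e1 : (P s - P r) * (P s₀ - P r₀) = P s - P r := by
      rw [mul_sub, sub_mul, sub_mul, h.mono' hs, h.mono' (hrs.trans hs),
        h.mono r₀ s (hr.le.trans hrs), h.mono r₀ r hr.le, sub_self, sub_zero]
    have e2 : (P s₀ - P r₀) * (P s - P r) = P s - P r := by
      rw [mul_sub, sub_mul, sub_mul, h.mono s s₀ hs, h.mono r s₀ (hrs.trans hs), h.mono' hr.le,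
        h.mono' (hr.le.trans hrs), sub_sub_sub_cancel_right]
    have e3 : (P s - P r) * K * (P s - P r) =
        (P s - P r) * ((P s₀ - P r₀) * K * (P s₀ - P r₀)) * (P s - P r) := by
      calc (P s - P r) * K * (P s - P r) = ((P s - P r) * (P s₀ - P r₀)) * K *
            ((P s₀ - P r₀) * (P s - P r)) := by rw [e1, e2]
        _ = _ := by simp only [mul_assoc]
    have hn : ‖P s - P r‖ ≤ 1 := (h.isStarProjection_sub hrs).norm_le
    rw [e3]
    refine (norm_mul_le _ _).trans ((mul_le_of_le_one_right (norm_nonneg _) hn).trans ?_)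
    exact (norm_mul_le _ _).trans (mul_le_of_le_one_left (norm_nonneg _) hn)
  have hcb : c = b := by
    by_contra hne
    have hlt' : c < min s₀ b := lt_min hs₀ (lt_of_le_of_ne hcI.2 hne)
    exact absurd (le_csSup hbdd ⟨⟨hcI.1.trans hlt'.le, min_le_right _ _⟩,
      step _ hlt'.le (min_le_left _ _)⟩) (not_le.2 hlt')
  have := step c le_rfl hs₀.le
  rwa [h.right c hcb.ge, mul_one] at this

end IsChainWithJumps

/-! ### Maximal chains as chains on the real line -/

section MaximalChain

variable {H : Type*} [NormedAddCommGroup H] [InnerProductSpace ℂ H] {a b : ℝ} {P : ℝ → H →L[ℂ] H}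

/-- The extension of a chain on `[a, b]` to the real line, constant outside of `[a, b]`. -/
def extendChain (a b : ℝ) (P : ℝ → H →L[ℂ] H) (t : ℝ) : H →L[ℂ] H :=
  P (max a (min t b))

theorem extendChain_of_mem {t : ℝ} (ht : t ∈ Set.Icc a b) : extendChain a b P t = P t := by
  rw [extendChain, min_eq_left ht.2, max_eq_right ht.1]

theorem extendChain_of_le {t : ℝ} (hab : a ≤ b) (ht : t ≤ a) : extendChain a b P t = P a := by
  rw [extendChain, min_eq_left (ht.trans hab), max_eq_left ht]

theorem extendChain_of_ge {t : ℝ} (hab : a ≤ b) (ht : b ≤ t) : extendChain a b P t = P b := by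
  rw [extendChain, min_eq_right ht, max_eq_right hab]

variable [CompleteSpace H]

/-- A property that holds for the trivial projections and for `P t`, `a < t < b`, holds for the
whole extended chain. -/
theorem IsMaximalChain.extendChain_induction (h : IsMaximalChain a b P)
    {p : (H →L[ℂ] H) → Prop} (h0 : p 0) (h1 : p 1) (hp : ∀ t ∈ Set.Ioo a b, p (P t)) (t : ℝ) :
    p (extendChain a b P t) := by
  rcases le_or_gt t a with ha | ha
  · rw [extendChain_of_le h.lt.le ha, h.left]
    exact h0
  rcases le_or_gt b t with hb | hb
  · rw [extendChain_of_ge h.lt.le hb, h.right]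
    exact h1
  · rw [extendChain_of_mem ⟨ha.le, hb.le⟩]
    exact hp t ⟨ha, hb⟩

theorem IsMaximalChain.exists_jump (h : IsMaximalChain a b P) {t : ℝ} (ht : t ∈ Set.Icc a b) :
    ∃ Q R, HasStrongLimit (extendChain a b P) (𝓝[>] t) Q ∧
      HasStrongLimit (extendChain a b P) (𝓝[<] t) R ∧ RankLEOne (Q - R) := by
  have hlow : ∀ t, t < b → a ≤ t → ∀ Q, HasStrongLimit P (𝓝[>] t) Q →
      HasStrongLimit (extendChain a b P) (𝓝[>] t) Q := by
    intro t htb hat Q hQ x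
    refine (hQ x).congr' ?_
    filter_upwards [Ioo_mem_nhdsGT htb] with s hs
    rw [extendChain_of_mem ⟨hat.trans hs.1.le, hs.2.le⟩]
  have hup : ∀ t, a < t → t ≤ b → ∀ Q, HasStrongLimit P (𝓝[<] t) Q →
      HasStrongLimit (extendChain a b P) (𝓝[<] t) Q := by
    intro t htb hat Q hQ x
    refine (hQ x).congr' ?_
    filter_upwards [Ioo_mem_nhdsLT htb] with s hs
    rw [extendChain_of_mem ⟨hs.1.le, hs.2.le.trans hat⟩]
  rcases eq_or_lt_of_le ht.1 with rfl | ha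
  · obtain ⟨Q, hQ, hr⟩ := h.jump_left
    refine ⟨Q, P a, hlow a h.lt le_rfl Q hQ, fun x => ?_, hr⟩
    refine tendsto_const_nhds.congr' ?_
    filter_upwards [self_mem_nhdsWithin] with s hs
    rw [extendChain_of_le h.lt.le (le_of_lt hs)]
  rcases eq_or_lt_of_le ht.2 with rfl | hb
  · obtain ⟨Q, hQ, hr⟩ := h.jump_right
    refine ⟨P t, Q, fun x => ?_, hup t h.lt le_rfl Q hQ, hr⟩
    refine tendsto_const_nhds.congr' ?_
    filter_upwards [self_mem_nhdsWithin] with s hs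
    rw [extendChain_of_ge h.lt.le (le_of_lt hs)]
  · obtain ⟨Q, R, hQ, hR, hr⟩ := h.jump t ⟨ha, hb⟩
    exact ⟨Q, R, hlow t hb ha.le Q hQ, hup t ha hb.le R hR, hr⟩

theorem IsMaximalChain.exists_isChainWithJumps (h : IsMaximalChain a b P) :
    ∃ Δ, IsChainWithJumps a b (extendChain a b P) Δ := by
  have hm : ∀ t, max a (min t b) ∈ Set.Icc a b := fun t =>
    ⟨le_max_left _ _, max_le h.lt.le (min_le_right _ _)⟩
  have hj : ∀ t, ∃ D : H →L[ℂ] H, t ∈ Set.Icc a b → (∀ x, Tendsto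
      (fun p : ℝ × ℝ => (extendChain a b P p.2 - extendChain a b P p.1) x)
      (𝓝[<] t ×ˢ 𝓝[>] t) (𝓝 (D x))) ∧ RankLEOne D := by
    intro t
    by_cases ht : t ∈ Set.Icc a b
    · obtain ⟨Q, R, hQ, hR, hr⟩ := h.exists_jump ht
      exact ⟨Q - R, fun _ => ⟨fun x =>
        ((hQ x).comp tendsto_snd).sub ((hR x).comp tendsto_fst), hr⟩⟩
    · exact ⟨0, fun h => absurd h ht⟩
  choose Δ hΔ using hj
  refine ⟨Δ, h.lt.le, fun t => h.isStarProjection _ (hm t), fun r s hrs => ?_, ?_, fun t ht => ?_,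
    fun t ht => (hΔ t ht).1, fun t ht => (hΔ t ht).2⟩
  · have hle : (extendChain a b P r).range ≤ (extendChain a b P s).range :=
      h.mono _ (hm r) _ (hm s) (max_le_max le_rfl (min_le_min hrs le_rfl))
    ext x
    obtain ⟨y, hy⟩ := hle ⟨x, rfl⟩
    have hi : extendChain a b P s * extendChain a b P s = extendChain a b P s :=
      (h.isStarProjection _ (hm s)).isIdempotentElem
    change extendChain a b P s (extendChain a b P r x) = extendChain a b P r x
    have hy' : extendChain a b P s y = extendChain a b P r x := hy
    rw [← hy']
    exact DFunLike.congr_fun hi y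
  · rw [extendChain_of_le h.lt.le le_rfl, h.left]
  · rw [extendChain_of_ge h.lt.le ht, h.right]

end MaximalChain

/-! ### The spectrum of a triangular operator -/

section Triangular

variable {H : Type*} [NormedAddCommGroup H] [InnerProductSpace ℂ H]

theorem IsQuasinilpotent.isUnit_one_add {N : H →L[ℂ] H} (hN : IsQuasinilpotent N) :
    IsUnit (1 + N) := by
  have h1 : (-1 : ℂ) ∉ spectrum ℂ N := fun h => by
    have h2 : (-1 : ℂ) = 0 := hN h
    norm_num at h2
  rw [spectrum.notMem_iff, map_neg, map_one, ← neg_add', IsUnit.neg_iff] at h1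
  exact h1

theorem isUnit_sub_smul_one {S : H →L[ℂ] H} {z : ℂ} (hz : z ∉ spectrum ℂ S) :
    IsUnit (S - z • (1 : H →L[ℂ] H)) := by
  rw [spectrum.notMem_iff, Algebra.algebraMap_eq_smul_one] at hz
  rw [← neg_sub]
  exact hz.neg

/-- If `(S - z)⁻¹ V` is quasinilpotent for all `z` off the spectrum of `S`, then
`S + V - z = (S - z)(1 + (S - z)⁻¹ V)` is invertible for these `z`. -/
theorem spectrum_add_subset {S V : H →L[ℂ] H} (h : ∀ z ∈ resolventSet ℂ S,
    IsQuasinilpotent (Ring.inverse (S - z • (1 : H →L[ℂ] H)) * V)) :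
    spectrum ℂ (S + V) ⊆ spectrum ℂ S := by
  intro z hz
  by_contra hzS
  refine hz ?_
  have hu := isUnit_sub_smul_one hzS
  have e : S + V - z • (1 : H →L[ℂ] H) = (S - z • (1 : H →L[ℂ] H)) *
      (1 + Ring.inverse (S - z • (1 : H →L[ℂ] H)) * V) := by
    rw [mul_add, mul_one, ← mul_assoc, Ring.mul_inverse_cancel _ hu, one_mul]
    abel
  have h1 : IsUnit (S + V - z • (1 : H →L[ℂ] H)) := by
    rw [e]
    exact hu.mul (h z (Set.notMem_compl_iff.1 hzS)).isUnit_one_add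
  change IsUnit (algebraMap ℂ (H →L[ℂ] H) z - (S + V))
  rw [Algebra.algebraMap_eq_smul_one, ← neg_sub]
  exact h1.neg

/-- Each of the conditions (A) and (B) gives one inclusion. -/
theorem IsSNTriangularWith.spectrum_eq [CompleteSpace H] {a b : ℝ} {P : ℝ → H →L[ℂ] H}
    {S V T : H →L[ℂ] H} (hT : IsSNTriangularWith a b P S V T) : spectrum ℂ T = spectrum ℂ S := by
  refine subset_antisymm ?_ ?_
  · rw [hT.eq_add]
    exact spectrum_add_subset hT.condA
  · have e : S = T + -V := by rw [hT.eq_add, add_neg_cancel_right]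
    conv_lhs => rw [e]
    refine spectrum_add_subset fun z hz w hw => ?_
    have h1 := hT.condB z hz
    rw [mul_neg, ← spectrum.neg_eq] at hw
    have h2 : -w = 0 := h1 (Set.mem_neg.1 hw)
    exact neg_eq_zero.1 h2

end Triangular

/-! ### The compact operators with zero diagonal -/

section ZeroDiagonal

variable {H : Type*} [NormedAddCommGroup H] [InnerProductSpace ℂ H] [CompleteSpace H]
  {a b : ℝ} {P Δ : ℝ → H →L[ℂ] H}

/-- The compact operators that leave a chain invariant and whose compressions to all jumps of the
chain vanish. They form an ideal of the algebra of the chain. -/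
def IsChainWithJumps.zeroDiagonal (h : IsChainWithJumps a b P Δ) : Submodule ℂ (H →L[ℂ] H) where
  carrier := {K | K ∈ chainAlgebra P h.mul_self ∧ IsCompactOperator K ∧
    ∀ t ∈ Set.Icc a b, Δ t * K * Δ t = 0}
  add_mem' {K L} hK hL := ⟨add_mem hK.1 hL.1, hK.2.1.add hL.2.1, fun t ht => by
    rw [mul_add, add_mul, hK.2.2 t ht, hL.2.2 t ht, add_zero]⟩
  zero_mem' := ⟨zero_mem _, isCompactOperator_zero, fun t _ => by rw [mul_zero, zero_mul]⟩
  smul_mem' c K hK := ⟨Subalgebra.smul_mem _ hK.1 c, hK.2.1.smul c, fun t ht => by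
    rw [mul_smul_comm, smul_mul_assoc, hK.2.2 t ht, smul_zero]⟩

namespace IsChainWithJumps

theorem mem_zeroDiagonal (h : IsChainWithJumps a b P Δ) {K : H →L[ℂ] H} :
    K ∈ h.zeroDiagonal ↔ K ∈ chainAlgebra P h.mul_self ∧ IsCompactOperator K ∧
      ∀ t ∈ Set.Icc a b, Δ t * K * Δ t = 0 := Iff.rfl

theorem isClosed_zeroDiagonal (h : IsChainWithJumps a b P Δ) :
    IsClosed (h.zeroDiagonal : Set (H →L[ℂ] H)) := by
  have e : (h.zeroDiagonal : Set (H →L[ℂ] H)) = (chainAlgebra P h.mul_self : Set (H →L[ℂ] H)) ∩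
      ({K : H →L[ℂ] H | IsCompactOperator K} ∩
        ⋂ t, ⋂ (_ : t ∈ Set.Icc a b), {K | Δ t * K * Δ t = 0}) := by
    ext K
    simp only [SetLike.mem_coe, mem_zeroDiagonal, Set.mem_inter_iff, Set.mem_iInter,
      Set.mem_ofPred_eq]
  rw [e]
  exact (isClosed_chainAlgebra P h.mul_self).inter (isClosed_setOfPred_isCompactOperator.inter
    (isClosed_iInter fun t => isClosed_iInter fun _ => isClosed_eq (by fun_prop) (by fun_prop)))

theorem mul_mem_zeroDiagonal (h : IsChainWithJumps a b P Δ) {A K : H →L[ℂ] H}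
    (hA : A ∈ chainAlgebra P h.mul_self) (hK : K ∈ h.zeroDiagonal) : A * K ∈ h.zeroDiagonal := by
  refine ⟨mul_mem hA hK.1, hK.2.1.clm_comp A, fun t ht => ?_⟩
  rw [h.jump_mul_mul_jump ht hA hK.1, mul_assoc (Δ t * A), ← mul_assoc (Δ t) K, hK.2.2 t ht,
    mul_zero]

theorem zeroDiagonal_mul_mem (h : IsChainWithJumps a b P Δ) {A K : H →L[ℂ] H}
    (hK : K ∈ h.zeroDiagonal) (hA : A ∈ chainAlgebra P h.mul_self) : K * A ∈ h.zeroDiagonal := by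
  refine ⟨mul_mem hK.1 hA, hK.2.1.comp_clm A, fun t ht => ?_⟩
  rw [h.jump_mul_mul_jump ht hK.1 hA, hK.2.2 t ht, zero_mul]

theorem isQuasinilpotent_of_mem (h : IsChainWithJumps a b P Δ) {K : H →L[ℂ] H}
    (hK : K ∈ h.zeroDiagonal) : IsQuasinilpotent K :=
  h.isQuasinilpotent hK.1 hK.2.1 hK.2.2

theorem mem_zeroDiagonal_of_isQuasinilpotent (h : IsChainWithJumps a b P Δ) {K : H →L[ℂ] H}
    (hK : K ∈ chainAlgebra P h.mul_self) (hc : IsCompactOperator K) (hq : IsQuasinilpotent K) :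
    K ∈ h.zeroDiagonal :=
  ⟨hK, hc, fun _ ht => h.jump_mul_jump_eq_zero ht hK hq⟩

end IsChainWithJumps

end ZeroDiagonal

/-! ### Analytic functions of triangular operators -/

section Calculus

variable {H : Type*} [NormedAddCommGroup H] [InnerProductSpace ℂ H]

theorem ringInverse_sub_smul_one {S : H →L[ℂ] H} {z : ℂ} (hz : z ∉ spectrum ℂ S) :
    Ring.inverse (S - z • (1 : H →L[ℂ] H)) = -resolvent S z := by
  obtain ⟨u, hu⟩ := spectrum.notMem_iff.1 hz
  have e : S - z • (1 : H →L[ℂ] H) = ↑(-u) := by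
    rw [Units.val_neg, hu, Algebra.algebraMap_eq_smul_one, neg_sub]
  rw [e, Ring.inverse_unit, resolvent, ← hu, Ring.inverse_unit, ← Units.val_neg, inv_neg]

variable [CompleteSpace H]

/-- `z - (S + V) = (z - S)(1 + (S - z)⁻¹ V)`; if `(S - z)⁻¹ V` is quasinilpotent, then the last
factor has its inverse in every closed algebra that contains `(S - z)⁻¹ V`. -/
theorem resolvent_add_mem {M : Subalgebra ℂ (H →L[ℂ] H)} (hM : IsClosed (M : Set (H →L[ℂ] H)))
    {S V : H →L[ℂ] H} {z : ℂ} (hz : z ∉ spectrum ℂ S) (hS : resolvent S z ∈ M) (hV : V ∈ M)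
    (hq : IsQuasinilpotent (Ring.inverse (S - z • (1 : H →L[ℂ] H)) * V)) :
    resolvent (S + V) z ∈ M := by
  rw [ringInverse_sub_smul_one hz] at hq
  obtain ⟨W, hW, h1, h2⟩ := hq.exists_inverse_mem M hM (mul_mem (neg_mem hS) hV)
    (neg_ne_zero.2 one_ne_zero)
  rw [neg_smul, one_smul] at h1 h2
  obtain ⟨u, hu⟩ := spectrum.notMem_iff.1 hz
  have hR : resolvent S z = ↑u⁻¹ := by rw [resolvent, ← hu, Ring.inverse_unit]
  have e : algebraMap ℂ (H →L[ℂ] H) z - (S + V) = u * -(-1 - -resolvent S z * V) := by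
    rw [hR, neg_mul, sub_neg_eq_add, neg_add, neg_neg, mul_add, mul_one, mul_neg, ← mul_assoc,
      u.mul_inv, one_mul, hu]
    abel
  let v : (H →L[ℂ] H)ˣ := ⟨-(-1 - -resolvent S z * V), -W, by rw [neg_mul_neg, h1],
    by rw [neg_mul_neg, h2]⟩
  have e2 : resolvent (S + V) z = -W * resolvent S z := by
    have : algebraMap ℂ (H →L[ℂ] H) z - (S + V) = ↑(u * v) := e
    rw [resolvent, this, Ring.inverse_unit, mul_inv_rev, Units.val_mul, ← hR]
    rfl
  rw [e2]
  exact mul_mem (neg_mem hW) hS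

/-- By the second resolvent identity, `f(T) - f(S)` is a contour integral of
`f(z) (z - T)⁻¹ (T - S) (z - S)⁻¹`. -/
theorem cauchyIntegral_sub_mem {f : ℂ → ℂ} {S T : H →L[ℂ] H} {C : Contour}
    (hf : ContinuousOn f C.trace) (hS : ∀ z ∈ C.trace, z ∉ spectrum ℂ S)
    (hT : ∀ z ∈ C.trace, z ∉ spectrum ℂ T) (M : Submodule ℂ (H →L[ℂ] H))
    (hM : IsClosed (M : Set (H →L[ℂ] H)))
    (h : ∀ z ∈ C.trace, resolvent T z * (T - S) * resolvent S z ∈ M) :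
    cauchyIntegral C f T - cauchyIntegral C f S ∈ M := by
  have hcT : ContinuousOn (fun z => f z • resolvent T z) C.trace :=
    hf.smul (continuousOn_resolvent_trace hT)
  have hcS : ContinuousOn (fun z => f z • resolvent S z) C.trace :=
    hf.smul (continuousOn_resolvent_trace hS)
  rw [cauchyIntegral, cauchyIntegral, ← smul_sub, ← C.integral_sub hcT hcS]
  refine M.smul_mem _ (C.integral_mem M hM (hcT.sub hcS) fun z hz => ?_)
  rw [← smul_sub, spectrum.resolvent_sub_resolvent (spectrum.notMem_iff.1 (hT z hz))
    (spectrum.notMem_iff.1 (hS z hz))]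
  exact M.smul_mem _ (h z hz)

end Calculus

end TriangularOperators

end

open TriangularOperators in
theorem proposition2p4 {H : Type*} [NormedAddCommGroup H] [InnerProductSpace ℂ H]
    [CompleteSpace H] [TopologicalSpace.SeparableSpace H]
    {a b : ℝ} {P : ℝ → H →L[ℂ] H} {S V T : H →L[ℂ] H}
    (hT : TriangularOperators.IsSVTriangularWith a b P S V T)
    (f : ℂ → ℂ) (hf : AnalyticOnNhd ℂ f (spectrum ℂ T)) :
    ∃ fT fS Vf : H →L[ℂ] H,
      TriangularOperators.IsAnalyticFunctionOf f T fT ∧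
      TriangularOperators.IsAnalyticFunctionOf f S fS ∧
      fT = fS + Vf ∧
      TriangularOperators.IsQuasinilpotent Vf ∧
      IsCompactOperator Vf ∧
      TriangularOperators.IsSVTriangularWith a b P fS Vf fT ∧
      TriangularOperators.IsSVTriangular fT ∧
      spectrum ℂ fT = spectrum ℂ fS ∧
      spectrum ℂ fS = f '' spectrum ℂ S ∧
      f '' spectrum ℂ S = f '' spectrum ℂ T := by
  have hσ : spectrum ℂ T = spectrum ℂ S := hT.spectrum_eq
  obtain ⟨C, hC⟩ := Contour.exists_isAdmissible (spectrum.isCompact T) hf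
  have hfS : AnalyticOnNhd ℂ f (spectrum ℂ S) := hσ ▸ hf
  have hCS : C.IsAdmissible f (spectrum ℂ S) := hσ ▸ hC
  obtain ⟨Δ, hΔ⟩ := hT.chain.exists_isChainWithJumps
  set 𝒜 := chainAlgebra (extendChain a b P) hΔ.mul_self with h𝒜
  have h𝒜c : IsClosed (𝒜 : Set (H →L[ℂ] H)) := isClosed_chainAlgebra _ _
  -- the extended chain consists of `0`, `1` and the `P t` with `a < t < b`
  have hSP : ∀ t, Commute (extendChain a b P t) S :=
    hT.chain.extendChain_induction (p := fun A => Commute A S) (Commute.zero_left S)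
      (Commute.one_left S) hT.comm
  have hV : V ∈ 𝒜 :=
    hT.chain.extendChain_induction (p := fun A => A * V * A = V * A) (by simp) (by simp)
      hT.triangular
  have hVJ : V ∈ hΔ.zeroDiagonal :=
    hΔ.mem_zeroDiagonal_of_isQuasinilpotent hV hT.compact hT.quasinilpotent
  have hRS : ∀ z, resolvent S z ∈ 𝒜 := fun z =>
    mem_chainAlgebra_of_commute fun t => commute_resolvent (hSP t) z
  set fT := cauchyIntegral C f T with hfT
  set fS := cauchyIntegral C f S with hfS'
  have hfSP : ∀ t, Commute (extendChain a b P t) fS := fun t =>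
    commute_cauchyIntegral hCS.continuousOn hCS.avoids (hSP t)
  have hVf : fT - fS ∈ hΔ.zeroDiagonal := by
    refine cauchyIntegral_sub_mem hC.continuousOn hCS.avoids hC.avoids _ hΔ.isClosed_zeroDiagonal
      fun z hz => ?_
    have hzS := hCS.avoids z hz
    have hRT : resolvent T z ∈ 𝒜 := by
      rw [hT.eq_add]
      exact resolvent_add_mem h𝒜c hzS (hRS z) hV (hT.condA z (Set.notMem_compl_iff.1 hzS))
    rw [hT.eq_add, add_sub_cancel_left, ← hT.eq_add]
    exact hΔ.zeroDiagonal_mul_mem (hΔ.mul_mem_zeroDiagonal hRT hVJ) (hRS z)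
  have hRfS : ∀ z, resolvent fS z ∈ 𝒜 := fun z =>
    mem_chainAlgebra_of_commute fun t => commute_resolvent (hfSP t) z
  have hcondA : ∀ z ∈ resolventSet ℂ fS,
      IsQuasinilpotent (Ring.inverse (fS - z • (1 : H →L[ℂ] H)) * (fT - fS)) := by
    intro z hz
    rw [ringInverse_sub_smul_one (Set.notMem_compl_iff.2 hz)]
    exact hΔ.isQuasinilpotent_of_mem (hΔ.mul_mem_zeroDiagonal (neg_mem (hRfS z)) hVf)
  have hadd : fT = fS + (fT - fS) := (add_sub_cancel fS fT).symm
  obtain ⟨hscal, hsub⟩ := hT.scalarType.cauchyIntegral hfS hCS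
  have hσfS : spectrum ℂ fS = f '' spectrum ℂ S := by
    refine subset_antisymm hsub ?_
    rintro _ ⟨w, hw, rfl⟩
    exact mem_spectrum_cauchyIntegral hfS hCS hw
  have hσf : spectrum ℂ fT = spectrum ℂ fS := by
    refine subset_antisymm ?_ ?_
    · rw [hadd]
      exact spectrum_add_subset hcondA
    · rw [hσfS, ← hσ]
      rintro _ ⟨w, hw, rfl⟩
      exact mem_spectrum_cauchyIntegral hf hC hw
  have hcondB : ∀ z ∈ resolventSet ℂ fT,
      IsQuasinilpotent (Ring.inverse (fT - z • (1 : H →L[ℂ] H)) * (fT - fS)) := by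
    intro z hz
    have hzT : z ∉ spectrum ℂ fT := Set.notMem_compl_iff.2 hz
    have hzS : z ∉ spectrum ℂ fS := hσf ▸ hzT
    have hR : resolvent fT z ∈ 𝒜 := by
      rw [hadd]
      exact resolvent_add_mem h𝒜c hzS (hRfS z) hVf.1 (hcondA z (Set.notMem_compl_iff.1 hzS))
    rw [ringInverse_sub_smul_one hzT]
    exact hΔ.isQuasinilpotent_of_mem (hΔ.mul_mem_zeroDiagonal (neg_mem hR) hVf)
  have hq := hΔ.isQuasinilpotent_of_mem hVf
  have hmem : ∀ t ∈ Set.Ioo a b, extendChain a b P t = P t := fun t ht =>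
    extendChain_of_mem (Set.Ioo_subset_Icc_self ht)
  have htri : IsSVTriangularWith a b P fS (fT - fS) fT :=
    { chain := hT.chain
      scalarType := hscal
      quasinilpotent := hq
      eq_add := hadd
      comm := fun t ht => hmem t ht ▸ hfSP t
      triangular := fun t ht => hmem t ht ▸ hVf.1 t
      condA := hcondA
      condB := hcondB
      compact := hVf.2.1 }
  exact ⟨fT, fS, fT - fS, isAnalyticFunctionOf_cauchyIntegral hC,
    isAnalyticFunctionOf_cauchyIntegral hCS, hadd, hq, hVf.2.1, htri, ⟨a, b, P, fS, fT - fS, htri⟩,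
    hσf, hσfS, by rw [hσ]⟩
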